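/- For an $N\times N$ matrix $X$ let $\sigma_1(X)\ge\cdots\ge\sigma_N(X)\ge 0$ be its singular values and $\mathrm{nnz}(X)$ the number of its non-zero entries. In the turnstile streaming model an integer matrix $X$, initially $0$, undergoes a sequence of at most $L$ updates $X_{i,j}\leftarrow X_{i,j}+d$ with $d\in\{-M,\dots,M\}$. A (non-uniform, randomized, one-pass) streaming algorithm with $S$ bits of space has $2^S$ memory states; random bits are not charged. It gives a $(1+c)$-approximation to $F(X)$ with error probability at most $\delta$ on $B$-sparse matrices if for each such stream whose final matrix $X$ satisfies $\mathrm{nnz}(X)\le B$ it outputs, with probability at least $1-\delta$, a number $Y$ with $|Y-F(X)|\le c\,|F(X)|$. (1) There are absolute constants $a_1,a_2>0$ and exponents $\theta(\alpha)<1$ with $a_1/\ln(1/\alpha)\le\theta(\alpha)\le a_2/\ln(1/\alpha)$ for $\alpha\in(0,1/2)$, such that the following holds. Let $\alpha\in(0,1/2)$. There are a constant $K=K(\alpha)$ and constants $C_{\alpha,\delta}>0$ ($0<\delta<1/2$) such that for every function $f$ that is strictly monotone on $[0,\infty)$ with $f(0)=0$ there are $c_0>0$ and $N_0$ such that for all $N\ge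 N_0$, all $1\le k\le\alpha N$, all $c\in(0,c_0)$, all $\delta\in(0,1/2)$, all $M\ge1$ and all $L\ge KN$: every streaming algorithm that gives, with error probability at most $\delta$ on $KN$-sparse matrices, a $(1+c)$-approximation to $\sum_{i=1}^k f(\sigma_i(X))$ uses at least $C_{\alpha,\delta}\,N^{1-\theta(\alpha)}$ bits of space; that is, $\Omega_{\alpha}(N^{1+\Theta(1/\ln\alpha)})$ bits, even when $\mathrm{nnz}(X)=O(N)$. (2) For every $\eta\in(0,1)$ there are $K$, $c_0>0$, $N_0$ and constants $C_{\eta,\delta}>0$ ($0<\delta<1/2$) such that for all $N\ge N_0$, all $1\le k\le N$, all $c\in(0,c_0)$, all $\delta\in(0,1/2)$, all $M\ge 1$ and all $L\ge KN$: every streaming algorithm that gives, with error probability at most $\delta$ on $KN$-sparse matrices, a $(1+c)$-approximation to the Ky-Fan $k$-norm $\sum_{i=1}^k\sigma_i(X)$ uses at least $C_{\eta,\delta}\,N^{1-\eta}$ bits of space. -/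

import Mathlib

open MeasureTheory

/-- An update `(i, j, d)` of a turnstile stream on an `N × N` integer matrix: `A i j ← A i j + d`. -/
structure EntryUpdate (N : ℕ) where
  row : Fin N
  col : Fin N
  delta : ℤ

/-- The matrix at the end of the stream (it is zero at the beginning). -/
def finalMatrix {N : ℕ} (s : List (EntryUpdate N)) : Matrix (Fin N) (Fin N) ℤ :=
  (s.map fun u => Matrix.single u.row u.col u.delta).sum

/-- The number of non-zero entries of a matrix. -/
def matrixNnz {N : ℕ} (A : Matrix (Fin N) (Fin N) ℤ) : ℕ :=
  (Finset.univ.filter fun p : Fin N × Fin N => A p.1 p.2 ≠ 0).card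

/-- `sigma A i` is the `(i + 1)`-st largest singular value of `A`, counted with multiplicity. -/
noncomputable def sigma {N : ℕ} (A : Matrix (Fin N) (Fin N) ℤ) (i : ℕ) : ℝ :=
  (Matrix.toEuclideanLin (A.map ((↑) : ℤ → ℝ))).singularValues i

/-- The sum of `f` over the `k` largest singular values of `A`. -/
noncomputable def partialSpectralSum (f : ℝ → ℝ) (k : ℕ) {N : ℕ}
    (A : Matrix (Fin N) (Fin N) ℤ) : ℝ :=
  ∑ i ∈ Finset.range k, f (sigma A i)

/-- The Ky-Fan `k`-norm: the sum of the `k` largest singular values. -/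
noncomputable def kyFanNorm (k : ℕ) {N : ℕ} (A : Matrix (Fin N) (Fin N) ℤ) : ℝ :=
  ∑ i ∈ Finset.range k, sigma A i

/-- A randomized one-pass streaming algorithm with `S` bits of memory for `N × N` matrices.
The random tape `ω : Ω` may be read at any time and as often as wanted, and the algorithm knows the
number of updates seen so far; neither is charged to its memory. No uniformity is required. -/
structure StreamingAlgorithm (Ω : Type) [MeasurableSpace Ω] (N S : ℕ) where
  /-- initial memory contents -/
  init : Ω → (Fin S → Bool)
  /-- new memory contents, from the position in the stream, the old contents and the update -/
  update : Ω → ℕ → (Fin S → Bool) → EntryUpdate N → (Fin S → Bool)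
  /-- the answer, from the final memory contents -/
  output : Ω → (Fin S → Bool) → ℝ
  measurable_init : Measurable init
  measurable_update : ∀ t b u, Measurable fun ω => update ω t b u
  measurable_output : ∀ b, Measurable fun ω => output ω b

namespace StreamingAlgorithm

variable {Ω : Type} [MeasurableSpace Ω] {N S : ℕ}

/-- Process a list of updates, starting at position `t` with memory contents `b`. -/
def runFrom (alg : StreamingAlgorithm Ω N S) (ω : Ω) :
    ℕ → (Fin S → Bool) → List (EntryUpdate N) → (Fin S → Bool)
  | _, b, [] => b
  | t, b, u :: us => alg.runFrom ω (t + 1) (alg.update ω t b u) us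

/-- The answer on the stream `s` with random tape `ω`. -/
def answer (alg : StreamingAlgorithm Ω N S) (ω : Ω) (s : List (EntryUpdate N)) : ℝ :=
  alg.output ω (alg.runFrom ω 0 (alg.init ω) s)

/-- On every stream of at most `L` updates, each by at most `M` in absolute value, whose final
matrix `A` has at most `B` non-zero entries, the answer is within a factor `1 ± c` of `F A`,
except with probability at most `δ`. -/
def Approximates (alg : StreamingAlgorithm Ω N S) (P : Measure Ω)
    (F : Matrix (Fin N) (Fin N) ℤ → ℝ) (c δ : ℝ) (M L B : ℕ) : Prop :=
  ∀ s : List (EntryUpdate N), s.length ≤ L → (∀ u ∈ s, |u.delta| ≤ (M : ℤ)) →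
    matrixNnz (finalMatrix s) ≤ B →
      1 - δ ≤ P.real {ω | |alg.answer ω s - F (finalMatrix s)| ≤ c * |F (finalMatrix s)|}

end StreamingAlgorithm

/-- Every streaming algorithm that approximates `F` within a factor `1 ± c` with error probability
at most `δ`, on the streams described by `M`, `L`, `B`, uses at least `b` bits of memory. -/
def RequiresSpace {N : ℕ} (F : Matrix (Fin N) (Fin N) ℤ → ℝ) (c δ : ℝ) (M L B : ℕ) (b : ℝ) : Prop :=
  ∀ (Ω : Type) [MeasurableSpace Ω] (P : Measure Ω) [IsProbabilityMeasure P] (S : ℕ)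
    (alg : StreamingAlgorithm Ω N S), alg.Approximates P F c δ M L B → b ≤ (S : ℝ)

/-! The bound comes from a one-way communication problem, a distributional hidden hypermatching.
Uniform signs `x` sit on `t * m` vertices, `π` is a random `t`-partite perfect hypermatching with
`m` edges, and the labels `w` are `b` times the products of the signs along the edges. The sign `b`
has to be found from a short message about `x` together with `π` and `w`. A stream that writes `x`
on the diagonal and afterwards, from `π` and `w` alone, the off-diagonal entries makes the memory at
the halfway point such a message.

Each edge becomes a `t × t` block which, up to the sign of one row, is the all-ones matrix with its
diagonal replaced by signs of product `b`. Row signs do not alter singular values. With `q` negative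
signs, the spectrum consists of copies of -2 and 0 and of the roots (t - 2 ± √((t - 2)² + 8(t -
q)))/2 (`blockSpectrum_eq`). Two facts separate the signs of `b`. The norm `t` is attained by the
all-ones block, but never when the product is -1, since `q` is then odd, hence positive
(`abs_lt_of_mem_blockSpectrum`). This settles `k ≤ α N` once `α t` is below the probability that a
block of product 1 has norm `t`. Moreover the mean nuclear norms differ, since their difference is a
nonzero multiple of a `t`-th finite difference of a square root
(`alternating_sum_blockRoot_ne_zero`). This settles Ky-Fan norms with `k` at least a constant
fraction of `N`, on a hypermatching with at most `k` vertices. Chebyshev's inequality makes typical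
inputs behave like the mean.

The communication bound (`advantage_le`) is Fourier analytic. A message of `S` bits cuts the cube
into `2 ^ S` cells. For each cell, the difference of the laws of the labels for `b = 1` and `b = -1`
has Fourier coefficients only at odd edge sets, where they are multiples of the coefficients of the
cell at the union of these edges. Averaging over `π` spreads a set of `k` edges evenly over C(m,k)^t
vertex sets, and Bonami's inequality bounds the weight of a cell on level `t k`
(`level_inequality`). The gain C(m,k)^(1-t) beats the hypercontractive loss, of order (S/k)^(tk), as
long as `S ^ t` is below a small multiple of `m ^ (t - 1)`. Hence `S` is at least of order N^(1 -
1/t), and it remains to take `t` near log₄(1/α), or at least 1/η. -/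

set_option linter.unusedSectionVars false

/-! ### Hypercontractivity and the level inequality on the sign cube -/

section

open Finset

/-- `C(2q,2i) ≤ C(q,i) (2q-1)^i`. -/
theorem choose_two_mul_le (q i : ℕ) :
    (2 * q).choose (2 * i) ≤ q.choose i * (2 * q - 1) ^ i := by
  induction i with
  | zero => simp
  | succ i ih =>
    rcases Nat.lt_or_ge i q with hi | hi
    · have h1 := Nat.choose_succ_right_eq (2 * q) (2 * i)
      have h2 := Nat.choose_succ_right_eq (2 * q) (2 * i + 1)
      have h3 := Nat.choose_succ_right_eq q i
      obtain ⟨d, rfl⟩ : ∃ d, q = i + 1 + d := ⟨q - (i + 1), by omega⟩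
      have e1 : 2 * (i + 1 + d) - 2 * i = 2 * (d + 1) := by omega
      have e2 : 2 * (i + 1 + d) - (2 * i + 1) = 2 * d + 1 := by omega
      have e3 : i + 1 + d - i = d + 1 := by omega
      have e4 : 2 * (i + 1 + d) - 1 = 2 * i + 2 * d + 1 := by omega
      rw [e1] at h1
      rw [e2] at h2
      rw [e3] at h3
      rw [e4] at ih ⊢
      have e5 : 2 * (i + 1) = 2 * i + 1 + 1 := by ring
      rw [e5]
      set A := (2 * (i + 1 + d)).choose (2 * i)
      set B := (2 * (i + 1 + d)).choose (2 * i + 1)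
      set C := (2 * (i + 1 + d)).choose (2 * i + 1 + 1)
      set a := (i + 1 + d).choose i
      set b := (i + 1 + d).choose (i + 1)
      set s := 2 * i + 2 * d + 1 with hs
      -- Two steps of the recursion for C(2q,·) against one step for C(q,·): the ratio lost is
      -- (2d+1)/(2i+1), which is at most s = 2q - 1.
      have key : C * ((2 * i + 1) * (2 * i + 2)) = A * (2 * (d + 1)) * (2 * d + 1) := by
        rw [← h1]; linear_combination (2 * i + 1) * h2
      have h4 : C * ((2 * i + 1) * (2 * i + 2)) ≤
          (b * s ^ (i + 1)) * ((2 * i + 1) * (2 * i + 2)) := by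
        calc C * ((2 * i + 1) * (2 * i + 2)) = A * (2 * (d + 1)) * (2 * d + 1) := key
          _ ≤ (a * s ^ i) * (2 * (d + 1)) * (2 * d + 1) := by gcongr
          _ = (a * (d + 1)) * (2 * (2 * d + 1) * s ^ i) := by ring
          _ = (b * (i + 1)) * (2 * (2 * d + 1) * s ^ i) := by rw [h3]
          _ = (b * s ^ i) * (2 * i + 2) * (2 * d + 1) := by ring
          _ ≤ (b * s ^ i) * (2 * i + 2) * ((2 * i + 1) * s) := by
              gcongr
              rw [hs]; nlinarith
          _ = _ := by ring
      exact Nat.le_of_mul_le_mul_right h4 (by positivity)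
    · rw [Nat.choose_eq_zero_of_lt (by omega)]; simp

/-- The two-point inequality behind hypercontractivity. -/
theorem two_point (q : ℕ) (a b : ℝ) :
    (a + b) ^ (2 * q) + (a - b) ^ (2 * q) ≤ 2 * (a ^ 2 + (2 * q - 1 : ℕ) * b ^ 2) ^ q := by
  have h1 : (a + b) ^ (2 * q) + (a - b) ^ (2 * q) =
      ∑ k ∈ range (2 * q + 1), b ^ k * a ^ (2 * q - k) * ((2 * q).choose k) * (1 + (-1) ^ k) := by
    rw [add_comm a b, add_pow, show a - b = -b + a by ring, add_pow, ← sum_add_distrib]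
    refine sum_congr rfl fun k _ => ?_
    rw [neg_pow]; ring
  have h2 : ∑ k ∈ range (2 * q + 1), b ^ k * a ^ (2 * q - k) * ((2 * q).choose k) * (1 + (-1) ^ k)
      = ∑ i ∈ range (q + 1), 2 * (b ^ (2 * i) * a ^ (2 * q - 2 * i) * ((2 * q).choose (2 * i))) := by
    symm
    refine sum_of_injOn (fun i => 2 * i) (fun x _ y _ h => by simpa using h) ?_ ?_ ?_
    · intro i hi; simp only [coe_range, Set.mem_Iio] at hi ⊢; omega
    · intro k hk hk2
      have : Odd k := by
        by_contra h
        rw [Nat.not_odd_iff_even] at h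
        obtain ⟨r, hr⟩ := h
        simp only [mem_range] at hk
        exact hk2 ⟨r, by simp only [coe_range, Set.mem_Iio]; omega, by simp only; omega⟩
      rw [this.neg_one_pow]; ring
    · intro i _
      rw [(even_two_mul i).neg_one_pow]; ring
  rw [h1, h2, add_comm (a ^ 2), add_pow, ← mul_sum]
  refine mul_le_mul_of_nonneg_left (sum_le_sum fun i hi => ?_) zero_le_two
  have e : 2 * q - 2 * i = 2 * (q - i) := by omega
  rw [e, mul_pow, ← pow_mul, ← pow_mul]
  -- The odd powers of `b` have cancelled, and the even ones are compared coefficient by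
  -- coefficient.
  have hc : ((2 * q).choose (2 * i) : ℝ) ≤ q.choose i * (2 * q - 1 : ℕ) ^ i := by
    exact_mod_cast choose_two_mul_le q i
  have h0 : 0 ≤ b ^ (2 * i) * a ^ (2 * (q - i)) :=
    mul_nonneg ((even_two_mul i).pow_nonneg b) ((even_two_mul (q - i)).pow_nonneg a)
  calc b ^ (2 * i) * a ^ (2 * (q - i)) * ((2 * q).choose (2 * i))
      ≤ b ^ (2 * i) * a ^ (2 * (q - i)) * (q.choose i * (2 * q - 1 : ℕ) ^ i) := by gcongr
    _ = _ := by ring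

section Cube

variable {V : Type*}

/-- The character of the sign cube indexed by `T`. -/
def chi (T : Finset V) (x : V → ℤˣ) : ℝ := ∏ v ∈ T, ((x v : ℤ) : ℝ)

theorem unit_sq (u : ℤˣ) : (((u : ℤ) : ℝ)) ^ 2 = 1 := by
  rcases Int.units_eq_one_or u with rfl | rfl <;> norm_num

theorem chi_sq (T : Finset V) (x : V → ℤˣ) : chi T x ^ 2 = 1 := by
  rw [chi, ← prod_pow]; exact prod_eq_one fun v _ => unit_sq _

section
variable [DecidableEq V]

/-- Negating one coordinate of the sign cube. -/
def flipAt (v : V) : (V → ℤˣ) ≃ (V → ℤˣ) :=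
  Function.Involutive.toPerm (fun x => Function.update x v (-x v)) (by
    intro x; simp)

theorem flipAt_apply (v : V) (x : V → ℤˣ) : flipAt v x = Function.update x v (-x v) := rfl

theorem chi_flipAt_of_notMem {T : Finset V} {v : V} (hv : v ∉ T) (x : V → ℤˣ) :
    chi T (flipAt v x) = chi T x := by
  refine prod_congr rfl fun u hu => ?_
  rw [flipAt_apply, Function.update_of_ne (by rintro rfl; exact hv hu)]

theorem chi_insert {T : Finset V} {v : V} (hv : v ∉ T) (x : V → ℤˣ) :
    chi (insert v T) x = ((x v : ℤ) : ℝ) * chi T x := prod_insert hv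

end

/-- Minkowski's inequality in ℓ^q with roots cleared and a normalising factor `n`; in this form the
induction in `bonami` closes. -/
theorem minkowski_pow {ι : Type*} (s : Finset ι) (q : ℕ) (hq : 1 ≤ q) (u v : ι → ℝ)
    (hu : ∀ i ∈ s, 0 ≤ u i) (hv : ∀ i ∈ s, 0 ≤ v i) {P Q n : ℝ} (hP : 0 ≤ P) (hQ : 0 ≤ Q)
    (hn : 0 ≤ n)
    (h1 : ∑ i ∈ s, u i ^ q ≤ n * P ^ q) (h2 : ∑ i ∈ s, v i ^ q ≤ n * Q ^ q) :
    ∑ i ∈ s, (u i + v i) ^ q ≤ n * (P + Q) ^ q := by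
  have hq1 : (1 : ℝ) ≤ q := by exact_mod_cast hq
  have hq0 : (q : ℝ) ≠ 0 := by positivity
  have := Real.Lp_add_le_of_nonneg (s := s) hq1 hu hv
  simp only [Real.rpow_natCast] at this
  have key : ∀ w : ι → ℝ, ∀ R : ℝ, 0 ≤ R → (∀ i ∈ s, 0 ≤ w i) → ∑ i ∈ s, w i ^ q ≤ n * R ^ q →
      (∑ i ∈ s, w i ^ q) ^ (1 / (q : ℝ)) ≤ n ^ (1 / (q : ℝ)) * R := by
    intro w R hR hw h
    calc (∑ i ∈ s, w i ^ q) ^ (1 / (q : ℝ)) ≤ (n * R ^ q) ^ (1 / (q : ℝ)) :=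
          Real.rpow_le_rpow (sum_nonneg fun i hi => pow_nonneg (hw i hi) _) h (by positivity)
      _ = n ^ (1 / (q : ℝ)) * R := by
          rw [Real.mul_rpow hn (by positivity), one_div, Real.pow_rpow_inv_natCast hR (by omega)]
  have h3 : (∑ i ∈ s, (u i + v i) ^ q) ^ (1 / (q : ℝ)) ≤ n ^ (1 / (q : ℝ)) * (P + Q) := by
    rw [mul_add]
    exact this.trans (add_le_add (key u P hP hu h1) (key v Q hQ hv h2))
  have h0 : 0 ≤ ∑ i ∈ s, (u i + v i) ^ q :=
    sum_nonneg fun i hi => pow_nonneg (add_nonneg (hu i hi) (hv i hi)) _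
  have h4 := pow_le_pow_left₀ (Real.rpow_nonneg h0 _) h3 q
  rwa [one_div, Real.rpow_inv_natCast_pow h0 (by omega), mul_pow,
    Real.rpow_inv_natCast_pow hn (by omega)] at h4

variable [Fintype V] [DecidableEq V]

/-- Bonami's inequality for the exponent `2q`. -/
theorem bonami (q : ℕ) (hq : 1 ≤ q) (s : Finset V) (a : Finset V → ℝ) :
    ∑ x : V → ℤˣ, (∑ T ∈ s.powerset, a T * chi T x) ^ (2 * q) ≤
      2 ^ Fintype.card V * (∑ T ∈ s.powerset, ((2 * q - 1 : ℕ) : ℝ) ^ #T * a T ^ 2) ^ q := by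
  induction s using Finset.induction_on generalizing a with
  | empty =>
    simp [chi, pow_mul, Fintype.card_units_int]
  | insert v s hv ih =>
    set κ : ℝ := ((2 * q - 1 : ℕ) : ℝ) with hκ
    have hκ0 : 0 ≤ κ := by positivity
    set F : (V → ℤˣ) → ℝ := fun x => ∑ T ∈ s.powerset, a T * chi T x with hF
    set G : (V → ℤˣ) → ℝ := fun x => ∑ T ∈ s.powerset, a (insert v T) * chi T x with hG
    have hvT : ∀ T ∈ s.powerset, v ∉ T := fun T hT h => hv (mem_powerset.1 hT h)
    have split : ∀ x : V → ℤˣ, ∑ T ∈ (insert v s).powerset, a T * chi T x =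
        F x + ((x v : ℤ) : ℝ) * G x := by
      intro x
      rw [sum_powerset_insert hv, hF, hG]
      simp only [mul_sum]
      congr 1
      refine sum_congr rfl fun T hT => ?_
      rw [chi_insert (hvT T hT)]; ring
    have hFf : ∀ x, F (flipAt v x) = F x := fun x =>
      sum_congr rfl fun T hT => by rw [chi_flipAt_of_notMem (hvT T hT)]
    have hGf : ∀ x, G (flipAt v x) = G x := fun x =>
      sum_congr rfl fun T hT => by rw [chi_flipAt_of_notMem (hvT T hT)]
    -- Neither `F` nor `G` depends on coordinate `v`, so pairing each point with its flip at `v`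
    -- produces the two sides of `two_point`.
    have step : 2 * ∑ x : V → ℤˣ, (F x + ((x v : ℤ) : ℝ) * G x) ^ (2 * q) ≤
        2 * ∑ x : V → ℤˣ, (F x ^ 2 + κ * G x ^ 2) ^ q := by
      have e : ∑ x : V → ℤˣ, (F x + ((x v : ℤ) : ℝ) * G x) ^ (2 * q) =
          ∑ x : V → ℤˣ, (F x - ((x v : ℤ) : ℝ) * G x) ^ (2 * q) := by
        rw [← Equiv.sum_comp (flipAt v)]
        refine sum_congr rfl fun x _ => ?_
        rw [hFf, hGf, flipAt_apply, Function.update_self]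
        push_cast; ring
      rw [two_mul]
      nth_rw 2 [e]
      rw [← sum_add_distrib, mul_sum]
      refine sum_le_sum fun x _ => ?_
      refine (two_point q _ _).trans (le_of_eq ?_)
      rw [mul_pow, unit_sq, one_mul]
    have hsum : ∑ T ∈ (insert v s).powerset, κ ^ #T * a T ^ 2 =
        ∑ T ∈ s.powerset, κ ^ #T * a T ^ 2 + κ * ∑ T ∈ s.powerset, κ ^ #T * a (insert v T) ^ 2 := by
      rw [sum_powerset_insert hv, mul_sum]
      congr 1
      refine sum_congr rfl fun T hT => ?_
      rw [card_insert_of_notMem (hvT T hT)]; ring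
    rw [hsum]
    simp only [split]
    refine (le_of_mul_le_mul_left step two_pos).trans ?_
    refine minkowski_pow univ q hq _ _ (fun x _ => by positivity) (fun x _ => by positivity)
      (sum_nonneg fun T _ => by positivity)
      (mul_nonneg hκ0 (sum_nonneg fun T _ => by positivity)) (by positivity) ?_ ?_
    · simpa only [← pow_mul] using ih a
    · simp only [mul_pow κ, ← mul_sum, ← pow_mul]
      rw [mul_left_comm]
      exact mul_le_mul_of_nonneg_left (by simpa only [← pow_mul] using ih fun T => a (insert v T))
        (by positivity)

/-- Fourier coefficients on the sign cube. -/
noncomputable def cubeCoeff (h : (V → ℤˣ) → ℝ) (T : Finset V) : ℝ :=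
  (∑ x, h x * chi T x) / 2 ^ Fintype.card V

/-- The level-`l` inequality for a function dominated by an indicator. -/
theorem level_inequality (q : ℕ) (hq : 1 ≤ q) (l : ℕ) (A : Finset (V → ℤˣ)) (h : (V → ℤˣ) → ℝ)
    (hA : ∀ x ∈ A, |h x| ≤ 1) (hA' : ∀ x ∉ A, h x = 0) :
    (∑ T ∈ powersetCard l univ, cubeCoeff h T ^ 2) ^ q ≤
      ((#A : ℝ) / 2 ^ Fintype.card V) ^ (2 * q - 1) * ((2 * q - 1 : ℕ) : ℝ) ^ (q * l) := by
  classical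
  set n : ℝ := 2 ^ Fintype.card V with hn
  have hn0 : 0 < n := by positivity
  set κ : ℝ := ((2 * q - 1 : ℕ) : ℝ) with hκ
  set W := ∑ T ∈ powersetCard l univ, cubeCoeff h T ^ 2 with hW
  have hW0 : 0 ≤ W := sum_nonneg fun T _ => sq_nonneg _
  set f : (V → ℤˣ) → ℝ := fun x => ∑ T ∈ powersetCard l univ, cubeCoeff h T * chi T x with hf
  -- Duality: `W` is the correlation of `h` with its own level-`l` part `f`. Hölder on the support
  -- `A` and Bonami for `f` then bound `W` by a power of itself.
  have h1 : n * W = ∑ x, h x * f x := by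
    simp only [hW, hf, mul_sum]
    rw [sum_comm]
    refine sum_congr rfl fun T _ => ?_
    have : n * cubeCoeff h T = ∑ x, h x * chi T x := by
      rw [cubeCoeff, ← hn]; field_simp
    rw [sq, ← mul_assoc, this, sum_mul]
    exact sum_congr rfl fun x _ => by ring
  have h2 : n * W ≤ ∑ x ∈ A, |f x| := by
    rw [h1, ← sum_subset (subset_univ A) (fun x _ hx => by rw [hA' x hx, zero_mul])]
    refine sum_le_sum fun x hx => ?_
    calc h x * f x ≤ |h x * f x| := le_abs_self _
      _ = |h x| * |f x| := abs_mul _ _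
      _ ≤ 1 * |f x| := by gcongr; exact hA x hx
      _ = |f x| := one_mul _
  have h3 : ∑ x, f x ^ (2 * q) ≤ n * (κ ^ l * W) ^ q := by
    have := bonami q hq (univ : Finset V) (fun T => if #T = l then cubeCoeff h T else 0)
    have e1 : ∀ x, ∑ T ∈ (univ : Finset V).powerset,
        (if #T = l then cubeCoeff h T else 0) * chi T x = f x := by
      intro x
      simp only [ite_mul, zero_mul, hf]
      rw [← sum_filter, powersetCard_eq_filter]
    have e2 : ∑ T ∈ (univ : Finset V).powerset,
        κ ^ #T * (if #T = l then cubeCoeff h T else 0) ^ 2 = κ ^ l * W := by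
      rw [hW, mul_sum, powersetCard_eq_filter, sum_filter]
      refine sum_congr rfl fun T _ => ?_
      split_ifs with hT
      · rw [hT]
      · ring
    rw [e2] at this
    simpa only [e1] using this
  have h4 : (∑ x ∈ A, |f x|) ^ (2 * q) ≤ (#A : ℝ) ^ (2 * q - 1) * ∑ x ∈ A, |f x| ^ (2 * q) := by
    obtain ⟨d, hd⟩ : ∃ d, 2 * q = d + 1 := ⟨2 * q - 1, by omega⟩
    rw [hd, Nat.add_sub_cancel]
    rcases A.eq_empty_or_nonempty with rfl | hne
    · simp
    · have hc : (0 : ℝ) < (#A : ℝ) ^ d := by have := hne.card_pos; positivity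
      have := pow_sum_div_card_le_sum_pow (s := A) (f := fun x => |f x|)
        (fun x _ => abs_nonneg _) d
      rwa [div_le_iff₀' hc] at this
  have h5 : ∑ x ∈ A, |f x| ^ (2 * q) ≤ n * (κ ^ l * W) ^ q := by
    refine le_trans ?_ h3
    refine (sum_le_sum_of_subset_of_nonneg (subset_univ A) fun x _ _ => by positivity).trans
      (le_of_eq ?_)
    refine sum_congr rfl fun x _ => ?_
    rw [pow_mul, sq_abs, ← pow_mul]
  have h6 : (n * W) ^ (2 * q) ≤ (#A : ℝ) ^ (2 * q - 1) * (n * (κ ^ l * W) ^ q) :=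
    (pow_le_pow_left₀ (by positivity) h2 _).trans (h4.trans (by gcongr))
  -- The self-bound contains `W ^ q` on its right side, which can only be cancelled when `W > 0`.
  rcases hW0.eq_or_lt with h0 | h0
  · rw [← h0, zero_pow (by omega)]; positivity
  · obtain ⟨d, hd⟩ : ∃ d, 2 * q = d + 1 := ⟨2 * q - 1, by omega⟩
    have hd' : 2 * q - 1 = d := by omega
    rw [hd'] at h6 ⊢
    rw [div_pow, div_mul_eq_mul_div, le_div_iff₀ (by positivity)]
    have h7 : (W ^ q * n ^ d) * (n * W ^ q) ≤ ((#A : ℝ) ^ d * κ ^ (q * l)) * (n * W ^ q) := by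
      calc (W ^ q * n ^ d) * (n * W ^ q) = (n * W) ^ (2 * q) := by
            rw [mul_pow]
            rw [show W ^ (2 * q) = W ^ q * W ^ q by rw [two_mul, pow_add],
              show n ^ (2 * q) = n ^ d * n by rw [hd, pow_succ]]
            ring
        _ ≤ _ := h6
        _ = _ := by rw [mul_pow, ← pow_mul, mul_comm l q]; ring
    exact le_of_mul_le_mul_right h7 (by positivity)

end Cube

end

/-! ### Parseval's identity and the Fourier weights of a partition -/

section

open Finset

section Completeness

variable {V : Type*} [Fintype V] [DecidableEq V]

/-- The sum over `U` factors into ∏ (w v * w' v + 1), and one differing coordinate makes a factor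
vanish. -/
theorem sum_chi_mul_chi (w w' : V → ℤˣ) :
    ∑ U : Finset V, chi U w * chi U w' = if w = w' then 2 ^ Fintype.card V else 0 := by
  have h1 : ∑ U : Finset V, chi U w * chi U w' =
      ∏ v : V, (((w v : ℤ) : ℝ) * ((w' v : ℤ) : ℝ) + 1) := by
    rw [prod_add_one, powerset_univ]
    exact sum_congr rfl fun U _ => by rw [chi, chi, prod_mul_distrib]
  rw [h1]
  split_ifs with h
  · subst h
    simp only [← sq, unit_sq]
    norm_num
  · obtain ⟨v, hv⟩ := Function.ne_iff.1 h
    refine prod_eq_zero (mem_univ v) ?_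
    have : w v = -w' v := by
      rcases Int.units_eq_one_or (w v) with e | e <;>
        rcases Int.units_eq_one_or (w' v) with e' | e' <;> simp_all
    rw [this]
    have := unit_sq (w' v)
    push_cast
    linarith

theorem parseval_cube (r : (V → ℤˣ) → ℝ) :
    ∑ U : Finset V, (∑ w, r w * chi U w) ^ 2 = 2 ^ Fintype.card V * ∑ w, r w ^ 2 := by
  have h1 : ∀ U : Finset V, (∑ w, r w * chi U w) ^ 2 =
      ∑ w, ∑ w', r w * r w' * (chi U w * chi U w') := by
    intro U
    rw [sq, sum_mul_sum]
    exact sum_congr rfl fun w _ => sum_congr rfl fun w' _ => by ring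
  simp only [h1]
  rw [sum_comm, mul_sum]
  refine sum_congr rfl fun w _ => ?_
  rw [sum_comm]
  simp only [← mul_sum, sum_chi_mul_chi, mul_ite, mul_zero]
  rw [sum_ite_eq]
  simp; ring

/-- The factor lost in Cauchy–Schwarz is exactly the factor in Parseval's identity. -/
theorem sq_sum_abs_le_sum_chi (r : (V → ℤˣ) → ℝ) :
    (∑ w, |r w|) ^ 2 ≤ ∑ U : Finset V, (∑ w, r w * chi U w) ^ 2 := by
  rw [parseval_cube]
  have := sq_sum_le_card_mul_sum_sq (s := (univ : Finset (V → ℤˣ))) (f := fun w => |r w|)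
  simp only [sq_abs] at this
  refine this.trans (le_of_eq ?_)
  rw [card_univ, Fintype.card_fun, Fintype.card_units_int]
  push_cast; rfl

theorem chi_neg (U : Finset V) (w : V → ℤˣ) : chi U (-w) = (-1) ^ #U * chi U w := by
  simp only [chi, Pi.neg_apply, Units.val_neg, Int.cast_neg]
  rw [prod_neg]

theorem chi_mul_chi_compl (T : Finset V) (x : V → ℤˣ) : chi univ x * chi Tᶜ x = chi T x := by
  have h : chi T x * chi Tᶜ x = chi univ x := prod_mul_prod_compl T _
  rw [← h, mul_assoc, ← sq, chi_sq, mul_one]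

/-- The Fourier weight on level `l`. -/
noncomputable def levelWeight (h : (V → ℤˣ) → ℝ) (l : ℕ) : ℝ :=
  ∑ T ∈ powersetCard l univ, cubeCoeff h T ^ 2

/-- Multiplication by the full character exchanges a set with its complement and preserves absolute
values, so levels near the top are as well controlled as those near the bottom. -/
theorem levelWeight_compl (h : (V → ℤˣ) → ℝ) {l : ℕ} (hl : l ≤ Fintype.card V) :
    levelWeight h l = levelWeight (fun x => h x * chi univ x) (Fintype.card V - l) := by
  refine sum_nbij' (fun T => Tᶜ) (fun T => Tᶜ) ?_ ?_ (fun T _ => compl_compl T)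
    (fun T _ => compl_compl T) ?_
  · intro T hT
    simp only [mem_powersetCard, subset_univ, true_and] at hT ⊢
    rw [card_compl, hT]
  · intro T hT
    simp only [mem_powersetCard, subset_univ, true_and] at hT ⊢
    rw [card_compl, hT]; omega
  · intro T _
    simp only [cubeCoeff, mul_assoc, chi_mul_chi_compl]

theorem levelWeight_nonneg (h : (V → ℤˣ) → ℝ) (l : ℕ) : 0 ≤ levelWeight h l :=
  sum_nonneg fun _ _ => sq_nonneg _

/-- The level inequality, at level `l` or at its complement. -/
theorem levelWeight_pow_le (q : ℕ) (hq : 1 ≤ q) {l l' : ℕ} (hl : l ≤ Fintype.card V)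
    (hl' : l' = l ∨ l' = Fintype.card V - l) (A : Finset (V → ℤˣ)) :
    levelWeight (fun x => if x ∈ A then 1 else 0) l ^ q ≤
      ((#A : ℝ) / 2 ^ Fintype.card V) ^ (2 * q - 1) * ((2 * q - 1 : ℕ) : ℝ) ^ (q * l') := by
  rcases hl' with rfl | rfl
  · refine level_inequality q hq _ A _ (fun x hx => ?_) (fun x hx => ?_) <;> simp [hx]
  · rw [levelWeight_compl _ hl]
    refine level_inequality q hq _ A _ (fun x hx => ?_) (fun x hx => ?_)
    · have := chi_sq univ x
      simp only [hx, if_true, one_mul]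
      rw [← Real.sqrt_sq_eq_abs, this, Real.sqrt_one]
    · simp [hx]

/-- Square roots of the weights of the cells of a partition into at most `S` cells. -/
theorem sum_sqrt_levelWeight_le {α : Type*} [Fintype α] [DecidableEq α] [Nonempty α]
    (g : (V → ℤˣ) → α) (q : ℕ)
    (hq : 1 ≤ q) {l l' : ℕ} (hl : l ≤ Fintype.card V) (hl' : l' = l ∨ l' = Fintype.card V - l) :
    ∑ a, √(levelWeight (fun x => if g x = a then 1 else 0) l) ≤
      (Fintype.card α : ℝ) ^ (1 / (2 * q : ℝ)) * √(((2 * q - 1 : ℕ) : ℝ) ^ l') := by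
  set κ : ℝ := ((2 * q - 1 : ℕ) : ℝ) with hκ
  set n : ℝ := 2 ^ Fintype.card V with hn
  have hn0 : 0 < n := by positivity
  set μ : α → ℝ := fun a => (#{x | g x = a} : ℝ) / n with hμ
  have hq0 : (0 : ℝ) < 2 * q := by positivity
  have hμ1 : ∑ a, μ a = 1 := by
    rw [hμ, ← sum_div, div_eq_one_iff_eq hn0.ne']
    have := card_eq_sum_card_fiberwise (f := g) (s := univ) (t := univ) (fun x _ => mem_coe.2 (mem_univ (g x)))
    rw [card_univ, Fintype.card_fun, Fintype.card_units_int] at this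
    rw [hn]; exact_mod_cast this.symm
  have hK : (0 : ℝ) < Fintype.card α := by exact_mod_cast Fintype.card_pos
  set c : ℝ := (Fintype.card α : ℝ) ^ (1 / (2 * q : ℝ)) with hc
  have hc0 : 0 < c := by positivity
  -- Weighted AM–GM between the mass of the cell and the uniform mass replaces the power `1 -
  -- 1/(2q)` by an expression linear in `μ a`, whose sum over all cells is 1.
  have main : ∀ a, √(levelWeight (fun x => if g x = a then 1 else 0) l) ≤
      c * √(κ ^ l') * ((1 - 1 / (2 * q)) * μ a + 1 / (2 * q) * (1 / Fintype.card α)) := by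
    intro a
    have h1 := levelWeight_pow_le q hq hl hl' (univ.filter fun x => g x = a)
    simp only [mem_filter, mem_univ, true_and] at h1
    set W := levelWeight (fun x => if g x = a then 1 else 0) l with hW
    have hW0 : 0 ≤ W := levelWeight_nonneg _ _
    have hμ0 : 0 ≤ μ a := by positivity
    have h2 : √W ≤ μ a ^ (1 - 1 / (2 * q : ℝ)) * √(κ ^ l') := by
      refine le_of_pow_le_pow_left₀ (n := 2 * q) (by omega) (by positivity) ?_
      rw [pow_mul, Real.sq_sqrt hW0, mul_pow, pow_mul √(κ ^ l'), Real.sq_sqrt (by positivity),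
        ← pow_mul, mul_comm l' q, ← Real.rpow_natCast (μ a ^ (1 - 1 / (2 * q : ℝ))),
        ← Real.rpow_mul hμ0]
      have e : (1 - 1 / (2 * q : ℝ)) * ((2 * q : ℕ) : ℝ) = ((2 * q - 1 : ℕ) : ℝ) := by
        rw [Nat.cast_sub (by omega)]; push_cast; field_simp
      rw [e, Real.rpow_natCast]
      exact h1
    have h3 := Real.geom_mean_le_arith_mean2_weighted (w₁ := 1 - 1 / (2 * q : ℝ))
      (w₂ := 1 / (2 * q : ℝ)) (p₁ := μ a) (p₂ := 1 / Fintype.card α)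
      (by rw [sub_nonneg, div_le_one hq0]; exact_mod_cast (by omega : 1 ≤ 2 * q))
      (by positivity) hμ0 (by positivity) (by ring)
    have h4 : c * (1 / (Fintype.card α : ℝ)) ^ (1 / (2 * q : ℝ)) = 1 := by
      rw [hc, ← Real.mul_rpow hK.le (by positivity), mul_one_div_cancel hK.ne', Real.one_rpow]
    calc √W ≤ μ a ^ (1 - 1 / (2 * q : ℝ)) * √(κ ^ l') := h2
      _ = c * √(κ ^ l') * (μ a ^ (1 - 1 / (2 * q : ℝ)) *
            (1 / (Fintype.card α : ℝ)) ^ (1 / (2 * q : ℝ))) := by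
          rw [show ∀ A B C D : ℝ, A * B * (C * D) = (A * D) * (C * B) by intros; ring, h4, one_mul]
      _ ≤ _ := by gcongr
  refine (sum_le_sum fun a _ => main a).trans (le_of_eq ?_)
  rw [← mul_sum, sum_add_distrib, ← mul_sum, hμ1, sum_const, card_univ, nsmul_eq_mul]
  field_simp
  ring

end Completeness

/-! ### Fourier analysis of the hidden hypermatching problem -/

section Matching

variable {t m : ℕ}

/-- The products of the signs along the edges of the `t`-partite hypermatching given by `π`. -/
def edgeProd (π : Fin t → Equiv.Perm (Fin m)) (x : Fin t × Fin m → ℤˣ) (j : Fin m) : ℤˣ :=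
  ∏ p, x (p, π p j)

/-- The set of vertices with prescribed parts. -/
def ofParts (F : Fin t → Finset (Fin m)) : Finset (Fin t × Fin m) :=
  univ.filter fun v => v.2 ∈ F v.1

theorem ofParts_injective : Function.Injective (ofParts (t := t) (m := m)) := by
  intro F G h
  funext p
  ext j
  have := congrArg ((p, j) ∈ ·) h
  simpa [ofParts] using this

theorem prod_ofParts {M : Type*} [CommMonoid M] (F : Fin t → Finset (Fin m))
    (f : Fin t × Fin m → M) : ∏ v ∈ ofParts F, f v = ∏ p, ∏ j ∈ F p, f (p, j) := by
  rw [ofParts, prod_filter, ← univ_product_univ, prod_product]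
  refine prod_congr rfl fun p _ => ?_
  simp only []
  rw [prod_ite_mem, univ_inter]

theorem card_ofParts (F : Fin t → Finset (Fin m)) : #(ofParts F) = ∑ p, #(F p) := by
  rw [ofParts, card_filter, ← univ_product_univ, sum_product]
  exact sum_congr rfl fun p _ => by simp

theorem chi_edgeProd (π : Fin t → Equiv.Perm (Fin m)) (x : Fin t × Fin m → ℤˣ)
    (U : Finset (Fin m)) :
    chi U (edgeProd π x) = chi (ofParts fun p => U.map (π p).toEmbedding) x := by
  rw [chi, chi, prod_ofParts]
  simp only [prod_map, edgeProd]
  rw [prod_comm]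
  refine prod_congr rfl fun j _ => ?_
  simp

/-- Permutations act transitively on sets of a given size, so all C(m,#U) fibres have the same
number of elements. -/
theorem card_perm_map_eq (U U' : Finset (Fin m)) (h : #U = #U') :
    #{σ : Equiv.Perm (Fin m) | U.map σ.toEmbedding = U'} * m.choose #U = m.factorial := by
  have hconst : ∀ W W' : Finset (Fin m), #W = #U → #W' = #U →
      #{σ : Equiv.Perm (Fin m) | U.map σ.toEmbedding = W} ≤
        #{σ : Equiv.Perm (Fin m) | U.map σ.toEmbedding = W'} := by
    intro W W' hW hW'
    obtain ⟨τ, hτ⟩ : ∃ τ : Equiv.Perm (Fin m), W.map τ.toEmbedding = W' := by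
      have e : {x // x ∈ W} ≃ {x // x ∈ W'} := Finset.equivOfCardEq (hW.trans hW'.symm)
      refine ⟨e.extendSubtype, ?_⟩
      refine eq_of_subset_of_card_le ?_ (by rw [card_map, hW, hW'])
      intro y hy
      obtain ⟨x, hx, rfl⟩ := mem_map.1 hy
      exact e.extendSubtype_mem x hx
    refine card_le_card_of_injOn (fun σ => τ * σ) ?_ (fun a _ b _ hab => mul_left_cancel hab)
    intro σ hσ
    simp only [coe_filter, mem_univ, true_and, Set.mem_ofPred_eq] at hσ ⊢
    rw [← hτ, ← hσ, map_map]
    rfl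
  have hsum : ∑ W ∈ powersetCard #U univ, #{σ : Equiv.Perm (Fin m) | U.map σ.toEmbedding = W} =
      m.factorial := by
    rw [← card_eq_sum_card_fiberwise (f := fun σ : Equiv.Perm (Fin m) => U.map σ.toEmbedding)
      (s := univ) (fun σ _ => by simp), card_univ, Fintype.card_perm, Fintype.card_fin]
  rw [sum_congr rfl (fun W hW => le_antisymm
    (hconst W U' (mem_powersetCard.1 hW).2 h.symm) (hconst U' W h.symm (mem_powersetCard.1 hW).2)),
    sum_const, card_powersetCard, card_univ, Fintype.card_fin, smul_eq_mul, mul_comm] at hsum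
  exact hsum

/-- Under independent uniform permutations, the parts of a fixed edge set are independent uniform
sets of its size. This spreading is the source of the gain C(m,k)^(-t). -/
theorem sum_perm_eq (U : Finset (Fin m)) (Φ : (Fin t → Finset (Fin m)) → ℝ) :
    ∑ π : Fin t → Equiv.Perm (Fin m), Φ (fun p => U.map (π p).toEmbedding) =
      (m.factorial / m.choose #U : ℝ) ^ t *
        ∑ F ∈ Fintype.piFinset fun _ : Fin t => powersetCard #U univ, Φ F := by
  rw [← sum_fiberwise_of_maps_to (s := univ)
    (t := Fintype.piFinset fun _ : Fin t => powersetCard #U univ)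
    (g := fun π : Fin t → Equiv.Perm (Fin m) => fun p => U.map (π p).toEmbedding)
    (fun π _ => by simp [Fintype.mem_piFinset, mem_powersetCard]), mul_sum]
  refine sum_congr rfl fun F hF => ?_
  rw [Fintype.mem_piFinset] at hF
  have hcU : (m.choose #U : ℝ) ≠ 0 := by
    have := Nat.choose_pos (by simpa using card_le_univ U : #U ≤ m)
    positivity
  have e1 : (univ.filter fun π : Fin t → Equiv.Perm (Fin m) =>
      (fun p => U.map (π p).toEmbedding) = F) =
      Fintype.piFinset fun p => univ.filter fun σ : Equiv.Perm (Fin m) =>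
        U.map σ.toEmbedding = F p := by
    ext π; simp [Fintype.mem_piFinset, funext_iff]
  rw [sum_congr rfl (g := fun _ => Φ F) (fun π hπ => by rw [(mem_filter.1 hπ).2]), sum_const, e1,
    Fintype.card_piFinset, nsmul_eq_mul]
  congr 1
  push_cast
  rw [prod_congr rfl (g := fun _ => (m.factorial / m.choose #U : ℝ)), prod_const, card_univ,
    Fintype.card_fin]
  intro p _
  rw [eq_div_iff hcU]
  exact_mod_cast card_perm_map_eq U (F p) (mem_powersetCard.1 (hF p)).2.symm

theorem sum_piFinset_levelWeight_le (h : (Fin t × Fin m → ℤˣ) → ℝ) (k : ℕ) :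
    ∑ F ∈ Fintype.piFinset fun _ : Fin t => powersetCard k univ, cubeCoeff h (ofParts F) ^ 2 ≤
      levelWeight h (t * k) := by
  rw [← sum_image (f := fun T => cubeCoeff h T ^ 2) (fun F _ G _ e => ofParts_injective e)]
  refine sum_le_sum_of_subset_of_nonneg ?_ fun _ _ _ => sq_nonneg _
  intro T hT
  obtain ⟨F, hF, rfl⟩ := mem_image.1 hT
  rw [Fintype.mem_piFinset] at hF
  rw [mem_powersetCard, card_ofParts]
  refine ⟨subset_univ _, ?_⟩
  rw [sum_congr rfl (fun p _ => (mem_powersetCard.1 (hF p)).2)]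
  simp

/-- The signed difference, for a weight `h`, of the laws of `edgeProd π x` and its negative. -/
noncomputable def signedLaw (h : (Fin t × Fin m → ℤˣ) → ℝ) (π : Fin t → Equiv.Perm (Fin m))
    (w : Fin m → ℤˣ) : ℝ :=
  ∑ x, h x * ((if edgeProd π x = w then 1 else 0) - if -edgeProd π x = w then 1 else 0)

/-- A character of the labels pulls back to the character of all vertices on the chosen edges
(`chi_edgeProd`). Negating the labels leaves even characters fixed, so only odd edge sets survive.
-/
theorem sum_signedLaw_mul_chi (h : (Fin t × Fin m → ℤˣ) → ℝ) (π : Fin t → Equiv.Perm (Fin m))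
    (U : Finset (Fin m)) :
    ∑ w, signedLaw h π w * chi U w = (1 - (-1) ^ #U) *
      (2 ^ (t * m) * cubeCoeff h (ofParts fun p => U.map (π p).toEmbedding)) := by
  have e : 2 ^ (t * m) * cubeCoeff h (ofParts fun p => U.map (π p).toEmbedding) =
      ∑ x, h x * chi U (edgeProd π x) := by
    simp only [chi_edgeProd]
    rw [cubeCoeff, Fintype.card_prod, Fintype.card_fin, Fintype.card_fin]
    field_simp
  rw [e, mul_sum]
  simp only [signedLaw, sum_mul]
  rw [sum_comm]
  refine sum_congr rfl fun x _ => ?_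
  simp only [mul_assoc, ← mul_sum, sub_mul, sum_sub_distrib, ite_mul, one_mul, zero_mul]
  rw [sum_ite_eq, sum_ite_eq]
  simp only [mem_univ, if_true, chi_neg]
  ring

theorem sum_perm_signedLaw_le (h : (Fin t × Fin m → ℤˣ) → ℝ) :
    ∑ π : Fin t → Equiv.Perm (Fin m), ∑ w, |signedLaw h π w| ≤
      (m.factorial : ℝ) ^ t * 2 ^ (t * m) * (2 * ∑ k ∈ (range (m + 1)).filter Odd,
        √(m.choose k * (1 / m.choose k : ℝ) ^ t * levelWeight h (t * k))) := by
  set n : ℝ := 2 ^ (t * m) with hn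
  have hn0 : 0 ≤ n := by positivity
  set Q : ℕ → ℝ := fun k => m.choose k * (1 / m.choose k : ℝ) ^ t * levelWeight h (t * k) with hQ
  have hQ0 : ∀ k, 0 ≤ Q k := fun k => mul_nonneg (by positivity) (levelWeight_nonneg _ _)
  have hcard : ((univ : Finset (Fin t → Equiv.Perm (Fin m))).card : ℝ) = (m.factorial : ℝ) ^ t := by
    rw [card_univ, Fintype.card_fun, Fintype.card_perm]; simp
  have h1 : ∑ π : Fin t → Equiv.Perm (Fin m), (∑ w, |signedLaw h π w|) ^ 2 ≤
      (m.factorial : ℝ) ^ t * (2 * n) ^ 2 * ∑ k ∈ (range (m + 1)).filter Odd, Q k := by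
    calc ∑ π : Fin t → Equiv.Perm (Fin m), (∑ w, |signedLaw h π w|) ^ 2
        ≤ ∑ π : Fin t → Equiv.Perm (Fin m), ∑ U : Finset (Fin m), ((1 - (-1) ^ #U) *
          (n * cubeCoeff h (ofParts fun p => U.map (π p).toEmbedding))) ^ 2 := by
          refine sum_le_sum fun π _ => ?_
          refine (sq_sum_abs_le_sum_chi _).trans (le_of_eq ?_)
          exact sum_congr rfl fun U _ => by rw [sum_signedLaw_mul_chi]
      _ = ∑ U : Finset (Fin m), ((1 - (-1) ^ #U) * n) ^ 2 *
          ((m.factorial / m.choose #U : ℝ) ^ t *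
          ∑ F ∈ Fintype.piFinset fun _ : Fin t => powersetCard #U univ,
            cubeCoeff h (ofParts F) ^ 2) := by
          rw [sum_comm]
          refine sum_congr rfl fun U _ => ?_
          rw [← sum_perm_eq U (fun F => cubeCoeff h (ofParts F) ^ 2), mul_sum]
          exact sum_congr rfl fun π _ => by ring
      _ ≤ ∑ U : Finset (Fin m), ((1 - (-1) ^ #U) * n) ^ 2 *
          ((m.factorial / m.choose #U : ℝ) ^ t * levelWeight h (t * #U)) := by
          refine sum_le_sum fun U _ => ?_
          gcongr
          exact sum_piFinset_levelWeight_le h _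
      _ = ∑ k ∈ range (m + 1), m.choose k * (((1 - (-1) ^ k) * n) ^ 2 *
          ((m.factorial / m.choose k : ℝ) ^ t * levelWeight h (t * k))) := by
          rw [← powerset_univ, sum_powerset_apply_card (fun k => ((1 - (-1) ^ k) * n) ^ 2 *
          ((m.factorial / m.choose k : ℝ) ^ t * levelWeight h (t * k))), card_univ,
            Fintype.card_fin]
          simp only [nsmul_eq_mul]
      _ = _ := by
          rw [sum_filter, mul_sum]
          refine sum_congr rfl fun k _ => ?_
          split_ifs with hk
          · rw [hk.neg_one_pow, hQ]; simp only [div_pow, one_pow]; ring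
          · rw [Nat.not_odd_iff_even] at hk
            rw [hk.neg_one_pow]; ring
  -- Separating the levels under the root allows a different hypercontractive exponent for each of
  -- them.
  have h2 : √(∑ k ∈ (range (m + 1)).filter Odd, Q k) ≤
      ∑ k ∈ (range (m + 1)).filter Odd, √(Q k) := by
    refine Real.sqrt_le_iff.2 ⟨sum_nonneg fun _ _ => Real.sqrt_nonneg _, ?_⟩
    calc ∑ k ∈ (range (m + 1)).filter Odd, Q k
        = ∑ k ∈ (range (m + 1)).filter Odd, √(Q k) ^ 2 :=
          sum_congr rfl fun k _ => (Real.sq_sqrt (hQ0 k)).symm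
      _ ≤ _ := sum_sq_le_sq_sum_of_nonneg fun _ _ => Real.sqrt_nonneg _
  have h3 := sq_sum_le_card_mul_sum_sq (s := (univ : Finset (Fin t → Equiv.Perm (Fin m))))
    (f := fun π => ∑ w, |signedLaw h π w|)
  rw [hcard] at h3
  have hS0 : 0 ≤ ∑ k ∈ (range (m + 1)).filter Odd, Q k := sum_nonneg fun _ _ => hQ0 _
  calc ∑ π : Fin t → Equiv.Perm (Fin m), ∑ w, |signedLaw h π w|
      ≤ (m.factorial : ℝ) ^ t * n * (2 * √(∑ k ∈ (range (m + 1)).filter Odd, Q k)) := by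
        refine le_of_pow_le_pow_left₀ two_ne_zero (by positivity) (h3.trans ?_)
        calc _ ≤ (m.factorial : ℝ) ^ t * ((m.factorial : ℝ) ^ t * (2 * n) ^ 2 *
              ∑ k ∈ (range (m + 1)).filter Odd, Q k) := by gcongr
          _ = _ := by rw [mul_pow _ (2 * √_), mul_pow 2 √_, Real.sq_sqrt hS0]; ring
    _ ≤ _ := by gcongr

/-- The advantage of a one-way protocol with messages in `α` in telling the products along a random
hypermatching from their negatives. -/
theorem advantage_le {α : Type*} [Fintype α] [DecidableEq α] [Nonempty α]
    (g : (Fin t × Fin m → ℤˣ) → α)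
    (D : α → (Fin t → Equiv.Perm (Fin m)) → (Fin m → ℤˣ) → ℝ) (hD : ∀ a π w, |D a π w| ≤ 1)
    (q : ℕ → ℕ) (hq : ∀ k, 1 ≤ q k) :
    |∑ π, ∑ x, (D (g x) π (edgeProd π x) - D (g x) π (-edgeProd π x))| ≤
      (m.factorial : ℝ) ^ t * 2 ^ (t * m) * (2 * ∑ k ∈ (range (m + 1)).filter Odd,
        √(m.choose k * (1 / m.choose k : ℝ) ^ t) *
          ((Fintype.card α : ℝ) ^ (1 / (2 * q k : ℝ)) *
            √(((2 * q k - 1 : ℕ) : ℝ) ^ (t * min k (m - k))))) := by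
  -- Once the message `a` is fixed, the decision depends on `x` only through the labels, so the
  -- advantage is a pairing of `D` with the signed laws of the cells.
  have h1 : ∑ π, ∑ x, (D (g x) π (edgeProd π x) - D (g x) π (-edgeProd π x)) =
      ∑ π, ∑ a, ∑ w, D a π w * signedLaw (fun x => if g x = a then 1 else 0) π w := by
    refine sum_congr rfl fun π _ => ?_
    have e : ∀ a w, D a π w * signedLaw (fun x => if g x = a then 1 else 0) π w =
        ∑ x, if g x = a then D a π w * ((if edgeProd π x = w then 1 else 0) -
          if -edgeProd π x = w then 1 else 0) else 0 := by
      intro a w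
      rw [signedLaw, mul_sum]
      refine sum_congr rfl fun x _ => ?_
      split_ifs <;> simp
    simp only [e]
    have e2 : ∀ a, ∑ w, ∑ x, (if g x = a then D a π w * ((if edgeProd π x = w then 1 else 0) -
          if -edgeProd π x = w then 1 else 0) else 0) = ∑ x, if g x = a then
            (D a π (edgeProd π x) - D a π (-edgeProd π x)) else 0 := by
      intro a
      rw [sum_comm]
      refine sum_congr rfl fun x _ => ?_
      split_ifs
      · simp only [mul_sub, mul_ite, mul_one, mul_zero, sum_sub_distrib]
        rw [sum_ite_eq, sum_ite_eq]
        simp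
      · simp
    simp only [e2]
    rw [sum_comm]
    refine sum_congr rfl fun x _ => ?_
    rw [sum_ite_eq]
    simp
  rw [h1]
  calc |∑ π, ∑ a, ∑ w, D a π w * signedLaw (fun x => if g x = a then 1 else 0) π w|
      ≤ ∑ π, ∑ a, ∑ w, |signedLaw (fun x => if g x = a then 1 else 0) π w| := by
        refine (abs_sum_le_sum_abs _ _).trans (sum_le_sum fun π _ => ?_)
        refine (abs_sum_le_sum_abs _ _).trans (sum_le_sum fun a _ => ?_)
        refine (abs_sum_le_sum_abs _ _).trans (sum_le_sum fun w _ => ?_)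
        rw [abs_mul]
        exact mul_le_of_le_one_left (abs_nonneg _) (hD a π w)
    _ = ∑ a, ∑ π, ∑ w, |signedLaw (fun x => if g x = a then 1 else 0) π w| := sum_comm
    _ ≤ ∑ a, (m.factorial : ℝ) ^ t * 2 ^ (t * m) * (2 * ∑ k ∈ (range (m + 1)).filter Odd,
        √(m.choose k * (1 / m.choose k : ℝ) ^ t *
          levelWeight (fun x => if g x = a then 1 else 0) (t * k))) :=
        sum_le_sum fun a _ => sum_perm_signedLaw_le _
    _ = (m.factorial : ℝ) ^ t * 2 ^ (t * m) * (2 * ∑ k ∈ (range (m + 1)).filter Odd,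
        √(m.choose k * (1 / m.choose k : ℝ) ^ t) *
          ∑ a, √(levelWeight (fun x => if g x = a then 1 else 0) (t * k))) := by
        rw [← mul_sum, ← mul_sum, sum_comm]
        congr 2
        refine sum_congr rfl fun k _ => ?_
        rw [mul_sum]
        exact sum_congr rfl fun a _ => Real.sqrt_mul (by positivity) _
    _ ≤ _ := by
        gcongr with k hk
        have hkm : k ≤ m := by
          have := mem_range.1 (mem_filter.1 hk).1; omega
        have hc : Fintype.card (Fin t × Fin m) = t * m := by simp
        refine sum_sqrt_levelWeight_le g (q k) (hq k) (l' := t * min k (m - k)) ?_ ?_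
        · rw [hc]; gcongr
        · rw [hc]
          rcases le_total k (m - k) with h | h
          · left; rw [min_eq_left h]
          · right; rw [min_eq_right h, Nat.mul_sub]

end Matching

end

/-! ### Estimate of the advantage for short messages -/

section

open Finset

theorem pow_le_pow_mul_choose {m k : ℕ} (h : k ≤ m) : m ^ k ≤ k ^ k * m.choose k := by
  induction k generalizing m with
  | zero => simp
  | succ k ih =>
    obtain ⟨m, rfl⟩ : ∃ d, m = d + 1 := ⟨m - 1, by omega⟩
    have hkm : k ≤ m := by omega
    have h1 : (m + 1) ^ k ≤ (k + 1) ^ k * m.choose k := by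
      rcases Nat.eq_zero_or_pos k with rfl | hk
      · simp
      · refine le_of_mul_le_mul_right (a := k ^ k) ?_ (Nat.pow_pos hk)
        calc (m + 1) ^ k * k ^ k = ((m + 1) * k) ^ k := (mul_pow _ _ _).symm
          _ ≤ ((k + 1) * m) ^ k := Nat.pow_le_pow_left (by nlinarith) k
          _ = (k + 1) ^ k * m ^ k := mul_pow _ _ _
          _ ≤ (k + 1) ^ k * (k ^ k * m.choose k) := by gcongr; exact ih hkm
          _ = _ := by ring
    have h2 := Nat.add_one_mul_choose_eq m k
    calc (m + 1) ^ (k + 1) = (m + 1) * (m + 1) ^ k := by ring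
      _ ≤ (m + 1) * ((k + 1) ^ k * m.choose k) := by gcongr
      _ = (k + 1) ^ k * ((m + 1) * m.choose k) := by ring
      _ = (k + 1) ^ k * ((m + 1).choose (k + 1) * (k + 1)) := by rw [h2]
      _ = _ := by ring

theorem two_pow_le_choose {m k : ℕ} (h : 2 * k ≤ m) : 2 ^ k ≤ m.choose k := by
  rcases Nat.eq_zero_or_pos k with rfl | hk
  · simp
  · refine le_of_mul_le_mul_left (a := k ^ k) ?_ (Nat.pow_pos hk)
    calc k ^ k * 2 ^ k = (2 * k) ^ k := by rw [mul_pow, mul_comm]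
      _ ≤ m ^ k := Nat.pow_le_pow_left h k
      _ ≤ _ := pow_le_pow_mul_choose (by omega)

/-- The summand of level `k` in the bound on the advantage. -/
noncomputable def advantageTerm (t m S₂ S k : ℕ) : ℝ :=
  √(m.choose k * (1 / m.choose k : ℝ) ^ t) *
    (((2 : ℝ) ^ S) ^ (1 / (2 * (S₂ / min k (m - k) + 1 : ℕ) : ℝ)) *
      √(((2 * (S₂ / min k (m - k) + 1) - 1 : ℕ) : ℝ) ^ (t * min k (m - k))))

theorem advantageTerm_eq_sqrt (t m S₂ S k : ℕ) : advantageTerm t m S₂ S k =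
    √((m.choose k * (1 / m.choose k : ℝ) ^ t) *
      (((2 : ℝ) ^ (S / (S₂ / min k (m - k) + 1 : ℕ) : ℝ)) *
      ((2 * (S₂ / min k (m - k) + 1) - 1 : ℕ) : ℝ) ^ (t * min k (m - k)))) := by
  rw [advantageTerm,
    Real.sqrt_mul (x := m.choose k * (1 / m.choose k : ℝ) ^ t) (by positivity),
    Real.sqrt_mul (Real.rpow_nonneg two_pos.le _)]
  congr 2
  rw [Real.sqrt_eq_rpow (2 ^ _), ← Real.rpow_mul two_pos.le, ← Real.rpow_natCast,
    ← Real.rpow_mul two_pos.le]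
  congr 1
  field_simp

/-- Low levels: with q = ⌊S₂/j⌋ + 1 the number of cells costs at most 2^j in the square and 2q - 1 ≤
3 S₂/j. Together with C(m,j) ≥ (m/j)^j, the square is at most the `j`-th power of 2·3^t S₂^t /
m^(t-1). -/
theorem advantageTerm_le_of_le {t m S₂ S k j : ℕ} (ht : 1 ≤ t) (hkm : k ≤ m)
    (hj : j = min k (m - k)) (hj1 : 1 ≤ j) (hjS : j ≤ S₂) (hS : S ≤ S₂) {y κ : ℝ} (hy : 0 ≤ y)
    (hκ : 2 * 3 ^ t * κ ≤ y ^ 2) (h : (S₂ : ℝ) ^ t ≤ κ * (m : ℝ) ^ (t - 1)) :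
    advantageTerm t m S₂ S k ≤ y ^ j := by
  rw [advantageTerm_eq_sqrt, ← hj]
  have hjm : j ≤ m := by omega
  have hch : m.choose k = m.choose j := by
    rcases le_total k (m - k) with h' | h'
    · rw [hj, min_eq_left h']
    · rw [hj, min_eq_right h', Nat.choose_symm hkm]
  rw [hch]
  have hm0 : (0 : ℝ) < m := by exact_mod_cast (by omega : 0 < m)
  have hj0 : (0 : ℝ) < j := by exact_mod_cast hj1
  have hC0 : (0 : ℝ) < m.choose j := by exact_mod_cast Nat.choose_pos hjm
  obtain ⟨s, rfl⟩ : ∃ s, t = s + 1 := ⟨t - 1, by omega⟩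
  rw [Nat.add_sub_cancel] at h
  have hκ0 : 0 ≤ κ := by
    by_contra hneg
    push Not at hneg
    have : κ * (m : ℝ) ^ s < 0 := mul_neg_of_neg_of_pos hneg (by positivity)
    have : (0 : ℝ) ≤ (S₂ : ℝ) ^ (s + 1) := by positivity
    linarith
  have e1 : (m.choose j : ℝ) * (1 / m.choose j : ℝ) ^ (s + 1) = (1 / m.choose j : ℝ) ^ s := by
    rw [pow_succ]; field_simp
  have hC : 1 / (m.choose j : ℝ) ≤ ((j : ℝ) / m) ^ j := by
    rw [div_pow, div_le_div_iff₀ hC0 (by positivity), one_mul]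
    exact_mod_cast pow_le_pow_mul_choose hjm
  have hdiv : S₂ < j * (S₂ / j + 1) := Nat.lt_mul_div_succ S₂ hj1
  have h2 : (2 : ℝ) ^ (S / (S₂ / j + 1 : ℕ) : ℝ) ≤ 2 ^ j := by
    rw [← Real.rpow_natCast]
    refine Real.rpow_le_rpow_of_exponent_le one_le_two ?_
    rw [div_le_iff₀ (by positivity)]
    exact_mod_cast (by omega : S ≤ j * (S₂ / j + 1))
  have h3 : ((2 * (S₂ / j + 1) - 1 : ℕ) : ℝ) ≤ 3 * S₂ / j := by
    rw [le_div_iff₀ hj0]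
    have h4 : S₂ / j * j ≤ S₂ := Nat.div_mul_le_self S₂ j
    have h5 : 2 * (S₂ / j + 1) - 1 = 2 * (S₂ / j) + 1 := by omega
    rw [h5]
    exact_mod_cast (by nlinarith : (2 * (S₂ / j) + 1) * j ≤ 3 * S₂)
  refine Real.sqrt_le_iff.2 ⟨by positivity, ?_⟩
  rw [e1]
  calc (1 / m.choose j : ℝ) ^ s * ((2 : ℝ) ^ (S / (S₂ / j + 1 : ℕ) : ℝ) *
        ((2 * (S₂ / j + 1) - 1 : ℕ) : ℝ) ^ ((s + 1) * j))
      ≤ (((j : ℝ) / m) ^ j) ^ s * (2 ^ j * (3 * S₂ / j) ^ ((s + 1) * j)) := by gcongr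
    _ = (2 * 3 ^ (s + 1) * ((S₂ : ℝ) ^ (s + 1) / m ^ s) / j) ^ j := by
        rw [← pow_mul, mul_comm j s, pow_mul _ s, pow_mul _ (s + 1), ← mul_pow, ← mul_pow]
        congr 1
        rw [div_pow, div_pow, mul_pow, pow_succ (j : ℝ)]
        field_simp
    _ ≤ (2 * 3 ^ (s + 1) * κ / 1) ^ j := by
        have hj1' : (1 : ℝ) ≤ j := by exact_mod_cast hj1
        gcongr
        rwa [div_le_iff₀ (by positivity)]
    _ ≤ (y ^ 2) ^ j := by
        rw [div_one]
        refine pow_le_pow_left₀ ?_ hκ _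
        positivity
    _ = (y ^ j) ^ 2 := by rw [← pow_mul, ← pow_mul, mul_comm]

/-- High levels: the quotient is 0, so `q = 1` and no hypercontractive factor appears. The square is
at most 2^S / C(m,j) ≤ 2^(S-j), and the margin `r` supplies extra smallness. -/
theorem advantageTerm_le_of_lt {t m S r k j : ℕ} (ht : 2 ≤ t) (hkm : k ≤ m)
    (hj : j = min k (m - k)) (hjS : S + r < j) :
    advantageTerm t m (S + r) S k ≤ √(1 / 2) ^ r * √(1 / 2) ^ (j - (S + r)) := by
  rw [advantageTerm_eq_sqrt, ← hj]
  have hjm : 2 * j ≤ m := by omega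
  have hch : m.choose k = m.choose j := by
    rcases le_total k (m - k) with h' | h'
    · rw [hj, min_eq_left h']
    · rw [hj, min_eq_right h', Nat.choose_symm hkm]
  rw [hch, Nat.div_eq_of_lt hjS]
  have hC0 : (0 : ℝ) < m.choose j := by exact_mod_cast Nat.choose_pos (by omega)
  have hC : 1 / (m.choose j : ℝ) ≤ (1 / 2) ^ j := by
    rw [one_div, one_div, inv_pow]
    gcongr
    exact_mod_cast two_pow_le_choose hjm
  have hC1 : 1 / (m.choose j : ℝ) ≤ 1 := hC.trans (pow_le_one₀ (by norm_num) (by norm_num))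
  obtain ⟨s, rfl⟩ : ∃ s, t = s + 2 := ⟨t - 2, by omega⟩
  have e1 : (m.choose j : ℝ) * (1 / m.choose j : ℝ) ^ (s + 2) ≤ (1 / 2) ^ j := by
    calc (m.choose j : ℝ) * (1 / m.choose j : ℝ) ^ (s + 2)
        = (1 / m.choose j : ℝ) ^ s * (1 / m.choose j) := by rw [pow_add]; field_simp
      _ ≤ 1 * (1 / 2) ^ j := by
          gcongr
          exact pow_le_one₀ (by positivity) hC1
      _ = _ := one_mul _
  have e2 : √(1 / 2 : ℝ) ^ r * √(1 / 2) ^ (j - (S + r)) = √((1 / 2) ^ j * 2 ^ S) := by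
    rw [← pow_add]
    symm
    rw [Real.sqrt_eq_iff_mul_self_eq (by positivity) (by positivity), ← sq, ← pow_mul, mul_comm _ 2,
      pow_mul, Real.sq_sqrt (by norm_num)]
    obtain ⟨d, rfl⟩ : ∃ d, j = S + r + d := ⟨j - (S + r), by omega⟩
    rw [show r + (S + r + d - (S + r)) = r + d by omega, show S + r + d = S + (r + d) by omega,
      pow_add _ S, one_div, inv_pow 2 S]
    field_simp
  rw [e2]
  refine Real.sqrt_le_sqrt ?_
  simp only [zero_add, mul_one, Nat.cast_one, div_one, Real.rpow_natCast]
  norm_num only [one_pow, Nat.cast_one, mul_one]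
  norm_num only at e1
  exact mul_le_mul_of_nonneg_right e1 (by positivity)

theorem sum_pow_Icc_le {y : ℝ} (hy : 0 ≤ y) (hy1 : y ≤ 1 / 2) (m : ℕ) :
    ∑ j ∈ Icc 1 m, y ^ j ≤ 2 * y := by
  rw [← Finset.Ico_add_one_right_eq_Icc]
  refine (geom_sum_Ico_le_of_lt_one hy (by linarith)).trans ?_
  rw [div_le_iff₀ (by linarith)]
  nlinarith

theorem sum_shifted_pow_le {ρ : ℝ} (hρ : 0 ≤ ρ) (hρ1 : 4 * ρ ≤ 3) (a m : ℕ) :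
    ∑ j ∈ Icc 1 m, (if a < j then ρ ^ (j - a) else 0) ≤ 3 := by
  rw [← sum_filter]
  have : ∑ j ∈ (Icc 1 m).filter (a < ·), ρ ^ (j - a) = ∑ i ∈ Ico 1 (m + 1 - a), ρ ^ i := by
    refine sum_nbij' (fun j => j - a) (fun i => i + a) ?_ ?_ ?_ ?_ ?_ <;>
      intro i hi <;> simp only [mem_filter, mem_Icc, mem_Ico] at hi ⊢ <;> omega
  rw [this]
  refine (geom_sum_Ico_le_of_lt_one hρ (by linarith)).trans ?_
  rw [div_le_iff₀ (by linarith)]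
  linarith

/-- The bound on the advantage is small for messages of at most `c m ^ (1 - 1 / t)` bits. -/
theorem exists_advantageTerm_sum_le {t : ℕ} (ht : 2 ≤ t) {ε : ℝ} (hε : 0 < ε) :
    ∃ κ : ℝ, 0 < κ ∧ ∃ r : ℕ, ∀ m S : ℕ, Even m →
      ((S + r : ℕ) : ℝ) ^ t ≤ κ * (m : ℝ) ^ (t - 1) →
      2 * ∑ k ∈ (range (m + 1)).filter Odd, advantageTerm t m (S + r) S k ≤ ε := by
  -- One pass over the levels costs at most 2y + 3ρ^r ≤ ε/4. Two passes (`k` and `m - k`) and the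
  -- outer factor 2 give ε.
  set y : ℝ := min (1 / 2) (ε / 16) with hy
  have hy0 : 0 < y := lt_min (by norm_num) (by positivity)
  have hy1 : y ≤ 1 / 2 := min_le_left _ _
  have hy2 : y ≤ ε / 16 := min_le_right _ _
  set ρ : ℝ := √(1 / 2) with hρ
  have hρ0 : 0 ≤ ρ := Real.sqrt_nonneg _
  have hρ1 : 4 * ρ ≤ 3 := by
    have : ρ ≤ 3 / 4 := Real.sqrt_le_iff.2 ⟨by norm_num, by norm_num⟩
    linarith
  obtain ⟨r, hr⟩ := exists_pow_lt_of_lt_one (show 0 < ε / 24 by positivity)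
    (show ρ < 1 by linarith)
  refine ⟨y ^ 2 / (2 * 3 ^ t), by positivity, r, fun m S hm h => ?_⟩
  set φ : ℕ → ℝ := fun j => y ^ j + ρ ^ r * (if S + r < j then ρ ^ (j - (S + r)) else 0) with hφ
  have hφ0 : ∀ j, 0 ≤ φ j := fun j => by
    simp only [hφ]; split_ifs <;> positivity
  -- Evenness of `m` is essential: for odd `m` the level `k = m` would be present, where the product
  -- of all signs, a single bit, reveals `b`.
  have hodd : ∀ k ∈ (range (m + 1)).filter Odd, 1 ≤ k ∧ k < m := by
    intro k hk
    rw [mem_filter, mem_range] at hk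
    refine ⟨hk.2.pos, lt_of_le_of_ne (by omega) ?_⟩
    rintro rfl
    exact (Nat.not_odd_iff_even.2 hm) hk.2
  have hterm : ∀ k ∈ (range (m + 1)).filter Odd,
      advantageTerm t m (S + r) S k ≤ φ k + φ (m - k) := by
    intro k hk
    obtain ⟨hk1, hk2⟩ := hodd k hk
    have h1 : advantageTerm t m (S + r) S k ≤ φ (min k (m - k)) := by
      by_cases hc : S + r < min k (m - k)
      · refine (advantageTerm_le_of_lt ht hk2.le rfl hc).trans ?_
        simp only [hφ, if_pos hc]
        have : 0 ≤ y ^ min k (m - k) := by positivity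
        linarith
      · refine (advantageTerm_le_of_le (by omega) hk2.le rfl (by omega) (not_lt.1 hc) (by omega)
          hy0.le (le_of_eq ?_) h).trans ?_
        · field_simp
        · simp only [hφ, if_neg hc]; simp
    rcases min_choice k (m - k) with e | e <;> rw [e] at h1
    · linarith [hφ0 (m - k)]
    · linarith [hφ0 k]
  have hsum : ∑ j ∈ Icc 1 m, φ j ≤ ε / 4 := by
    simp only [hφ, sum_add_distrib, ← mul_sum]
    have h1 := sum_pow_Icc_le hy0.le hy1 m
    have h2 := sum_shifted_pow_le hρ0 hρ1 (S + r) m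
    have h3 : ρ ^ r * ∑ j ∈ Icc 1 m, (if S + r < j then ρ ^ (j - (S + r)) else 0) ≤ ρ ^ r * 3 := by
      gcongr
    linarith
  have hs1 : ∑ k ∈ (range (m + 1)).filter Odd, φ k ≤ ∑ j ∈ Icc 1 m, φ j := by
    refine sum_le_sum_of_subset_of_nonneg (fun k hk => ?_) fun _ _ _ => hφ0 _
    have := hodd k hk
    rw [mem_Icc]; omega
  have hs2 : ∑ k ∈ (range (m + 1)).filter Odd, φ (m - k) ≤ ∑ j ∈ Icc 1 m, φ j := by
    rw [← sum_image (f := φ) (g := fun k => m - k) (s := (range (m + 1)).filter Odd)]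
    · refine sum_le_sum_of_subset_of_nonneg (fun j hj => ?_) fun _ _ _ => hφ0 _
      obtain ⟨k, hk, rfl⟩ := mem_image.1 hj
      have := hodd k hk
      rw [mem_Icc]; omega
    · intro a ha b hb hab
      have h1 := hodd a ha
      have h2 := hodd b hb
      simp only at hab
      omega
  have := sum_le_sum hterm
  rw [sum_add_distrib] at this
  linarith

end

/-! ### Singular values of the hard matrices -/

section

open Finset Polynomial

section SingularValues

theorem charpoly_toEuclideanLin {n : Type*} [Fintype n] [DecidableEq n] (A : Matrix n n ℝ) :
    (Matrix.toEuclideanLin A).charpoly = A.charpoly := by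
  rw [Matrix.toEuclideanLin, Matrix.toLpLin_eq_toLin, Matrix.charpoly_toLin]

/-- As a multiset the singular values forget their order, so that a block decomposition becomes a
sum of multisets. -/
theorem map_sigma_eq {N : ℕ} (A : Matrix (Fin N) (Fin N) ℤ) :
    (univ : Finset (Fin N)).val.map (fun i : Fin N => sigma A i) =
      ((A.map ((↑) : ℤ → ℝ)).transpose * A.map ((↑) : ℤ → ℝ)).charpoly.roots.map Real.sqrt := by
  set R := A.map ((↑) : ℤ → ℝ) with hR
  set T := Matrix.toEuclideanLin R with hT
  have hn : Module.finrank ℝ (EuclideanSpace ℝ (Fin N)) = N := by simp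
  have h1 : LinearMap.adjoint T ∘ₗ T = Matrix.toEuclideanLin (R.transpose * R) := by
    rw [hT, ← Matrix.toEuclideanLin_conjTranspose_eq_adjoint, Matrix.conjTranspose_eq_transpose_of_trivial]
    exact (Matrix.toLpLin_mul 2 2 2 _ _).symm
  have h2 := T.isSymmetric_adjoint_comp_self.roots_charpoly_eq_eigenvalues hn
  have h3 : (LinearMap.adjoint T ∘ₗ T).charpoly = (R.transpose * R).charpoly := by
    rw [h1, charpoly_toEuclideanLin]
  rw [← h3, h2, Multiset.map_map]
  refine Multiset.map_congr rfl fun i _ => ?_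
  rw [sigma, LinearMap.singularValues_fin _ hn i]
  rfl

theorem roots_charpoly_mul_self {n : Type*} [Fintype n] [DecidableEq n] {H : Matrix n n ℝ}
    (hH : H.IsHermitian) :
    (H * H).charpoly.roots.map Real.sqrt = H.charpoly.roots.map fun x => |x| := by
  have h1 : H * H = cfc (fun x : ℝ => x ^ 2) H := by
    exact (sq H).symm.trans (cfc_pow_id (R := ℝ) H 2 hH).symm
  have h2 : (H * H).charpoly.roots =
      (univ : Finset n).val.map (fun i => hH.eigenvalues i ^ 2) := by
    rw [h1, hH.charpoly_cfc_eq]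
    simp only [RCLike.ofReal_real_eq_id, id]
    rw [Polynomial.roots_prod _ _ (prod_ne_zero_iff.2 fun i _ => Polynomial.X_sub_C_ne_zero _)]
    simp only [Polynomial.roots_X_sub_C]
    simp [Multiset.bind_singleton]
  rw [h2, hH.roots_charpoly_eq_eigenvalues, Multiset.map_map, Multiset.map_map]
  refine Multiset.map_congr rfl fun i _ => ?_
  simp [Real.sqrt_sq_eq_abs]

end SingularValues

section HardMatrix

variable {t m r N : ℕ}

/-- The all-ones matrix with a prescribed diagonal. -/
def signBlock {R : Type*} [One R] (y : Fin t → R) : Matrix (Fin t) (Fin t) R :=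
  fun p p' => if p = p' then y p else 1

theorem charpoly_blockDiagonal {R : Type*} [CommRing R] {n o : Type*} [Fintype n] [DecidableEq n]
    [Fintype o] [DecidableEq o] (B : o → Matrix n n R) :
    (Matrix.blockDiagonal B).charpoly = ∏ j, (B j).charpoly := by
  simp only [Matrix.charpoly]
  rw [← Matrix.det_blockDiagonal]
  congr 1
  ext ⟨i, j⟩ ⟨i', j'⟩
  by_cases hj : j = j'
  · subst hj
    simp [Matrix.charmatrix_apply, Matrix.blockDiagonal_apply, Matrix.diagonal_apply, Prod.ext_iff]
  · simp [Matrix.blockDiagonal_apply, hj, Prod.ext_iff]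

/-- The vertices of the hypermatching as indices, the edge `j` being `{(p, j)}`. -/
def matchingIndex (e : (Fin t × Fin m) ⊕ Fin r ≃ Fin N) (π : Fin t → Equiv.Perm (Fin m)) :
    (Fin t × Fin m) ⊕ Fin r ≃ Fin N :=
  (Equiv.sumCongr (Equiv.prodShear (Equiv.refl _) π) (Equiv.refl _)).trans e

theorem matchingIndex_inl (e : (Fin t × Fin m) ⊕ Fin r ≃ Fin N) (π : Fin t → Equiv.Perm (Fin m))
    (p : Fin t) (j : Fin m) : matchingIndex e π (Sum.inl (p, j)) = e (Sum.inl (p, π p j)) := rfl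

/-- The sign by which the row of the vertex `p` of an edge of label `c` is multiplied. -/
def rowSign (c : ℤˣ) (p : Fin t) : ℤˣ := if (p : ℕ) = 0 then c else 1

/-- The diagonal of the block of an edge of label `c` with the signs `v`. -/
def blockSigns (c : ℤˣ) (v : Fin t → ℤˣ) (p : Fin t) : ℤˣ := rowSign c p * v p

/-- The matrix with the blocks given by a hypermatching. -/
def hardMatrix (e : (Fin t × Fin m) ⊕ Fin r ≃ Fin N) (π : Fin t → Equiv.Perm (Fin m))
    (x : Fin t × Fin m → ℤˣ) (w : Fin m → ℤˣ) : Matrix (Fin N) (Fin N) ℤ :=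
  Matrix.reindex (matchingIndex e π) (matchingIndex e π)
    (Matrix.fromBlocks (Matrix.diagonal (fun v : Fin t × Fin m => ((rowSign (w v.2) v.1 : ℤˣ) : ℤ)) *
      Matrix.blockDiagonal fun j => signBlock fun p =>
        ((blockSigns (w j) (fun p => x (p, π p j)) p : ℤˣ) : ℤ)) 0 0 0)

/-- The real spectrum of the block with the signs `y`. -/
noncomputable def blockSpectrum (y : Fin t → ℤˣ) : Multiset ℝ :=
  (signBlock fun p => ((y p : ℤ) : ℝ)).charpoly.roots

theorem isHermitian_signBlock (y : Fin t → ℝ) : (signBlock y).IsHermitian := by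
  ext p p'
  simp only [signBlock, Matrix.conjTranspose_apply, star_trivial]
  by_cases h : p = p'
  · subst h; rfl
  · rw [if_neg h, if_neg (Ne.symm h)]

/-- The diagonal matrix of row signs is orthogonal and cancels in `Aᵀ A`, which leaves the square of
a symmetric block matrix; the singular values are the absolute values of its eigenvalues. -/
theorem map_sigma_hardMatrix (e : (Fin t × Fin m) ⊕ Fin r ≃ Fin N)
    (π : Fin t → Equiv.Perm (Fin m)) (x : Fin t × Fin m → ℤˣ) (w : Fin m → ℤˣ) :
    (univ : Finset (Fin N)).val.map (fun i : Fin N => sigma (hardMatrix e π x w) i) =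
      (∑ j, (blockSpectrum (blockSigns (w j) fun p => x (p, π p j))).map fun a => |a|) +
        Multiset.replicate r 0 := by
  set B : Fin m → Matrix (Fin t) (Fin t) ℝ := fun j =>
    signBlock fun p => ((blockSigns (w j) (fun p => x (p, π p j)) p : ℤ) : ℝ) with hB
  set s : Fin t × Fin m → ℝ := fun v => ((rowSign (w v.2) v.1 : ℤ) : ℝ) with hs
  set H₀ := Matrix.fromBlocks (Matrix.blockDiagonal B) 0 0 (0 : Matrix (Fin r) (Fin r) ℝ) with hH₀
  set H := Matrix.reindex (matchingIndex e π) (matchingIndex e π) H₀ with hH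
  set A₀ := Matrix.fromBlocks (Matrix.diagonal s * Matrix.blockDiagonal B) 0 0
    (0 : Matrix (Fin r) (Fin r) ℝ) with hA₀
  have hA : (hardMatrix e π x w).map ((↑) : ℤ → ℝ) =
      Matrix.reindex (matchingIndex e π) (matchingIndex e π) A₀ := by
    rw [hardMatrix, Matrix.reindex_apply, Matrix.reindex_apply, ← Matrix.submatrix_map,
      Matrix.fromBlocks_map, hA₀]
    congr 2
    · ext ⟨p, j⟩ ⟨p', j'⟩
      simp only [Matrix.map_apply, Matrix.diagonal_mul, Matrix.blockDiagonal_apply, hs, hB, signBlock]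
      split_ifs <;> simp
    · ext; simp
    · ext; simp
    · ext; simp
  have hBH : (Matrix.blockDiagonal B).IsHermitian := by
    rw [Matrix.IsHermitian, Matrix.blockDiagonal_conjTranspose]
    congr 1
    funext j
    exact isHermitian_signBlock _
  have hHH : H.IsHermitian := by
    rw [hH, Matrix.reindex_apply]
    refine Matrix.IsHermitian.submatrix ?_ _
    exact Matrix.IsHermitian.fromBlocks hBH (by simp) (by simp [Matrix.IsHermitian])
  have hs2 : Matrix.diagonal s * Matrix.diagonal s = 1 := by
    rw [Matrix.diagonal_mul_diagonal, ← Matrix.diagonal_one]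
    congr 1
    funext v
    rw [← sq]; exact unit_sq _
  have hBT : (Matrix.blockDiagonal B).transpose = Matrix.blockDiagonal B := by
    rw [← Matrix.conjTranspose_eq_transpose_of_trivial]; exact hBH
  have hmul : ((hardMatrix e π x w).map ((↑) : ℤ → ℝ)).transpose *
      (hardMatrix e π x w).map ((↑) : ℤ → ℝ) = H * H := by
    rw [hA, hH, Matrix.reindex_apply, Matrix.reindex_apply, Matrix.transpose_submatrix,
      Matrix.submatrix_mul_equiv, Matrix.submatrix_mul_equiv, hA₀, hH₀]
    congr 1
    rw [Matrix.fromBlocks_transpose, Matrix.fromBlocks_multiply, Matrix.fromBlocks_multiply,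
      Matrix.transpose_mul, hBT, Matrix.diagonal_transpose]
    congr 1
    all_goals simp only [Matrix.transpose_zero, Matrix.mul_zero, Matrix.zero_mul, add_zero]
    rw [Matrix.mul_assoc, ← Matrix.mul_assoc (Matrix.diagonal s), hs2, Matrix.one_mul]
  rw [map_sigma_eq, hmul, roots_charpoly_mul_self hHH, hH, Matrix.charpoly_reindex, hH₀,
    Matrix.charpoly_fromBlocks_zero₁₂, charpoly_blockDiagonal]
  have hne : ∏ j, (B j).charpoly ≠ 0 := prod_ne_zero_iff.2 fun j _ => (B j).charpoly_monic.ne_zero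
  have hz : (0 : Matrix (Fin r) (Fin r) ℝ).charpoly = X ^ r := by
    simp [Matrix.charpoly, Matrix.charmatrix]
  rw [hz, Polynomial.roots_mul (mul_ne_zero hne (pow_ne_zero _ X_ne_zero)), Polynomial.roots_prod _ _ hne,
    Multiset.map_add, Polynomial.roots_X_pow]
  congr 1
  · rw [Multiset.map_bind]; rfl
  · rw [Multiset.nsmul_singleton, Multiset.map_replicate, abs_zero]

end HardMatrix

end

/-! ### Spectrum of a sign block -/

section

open Finset Polynomial

section BlockSpectrum

variable {t : ℕ}

/-- The number of negative signs. -/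
def negCount (y : Fin t → ℤˣ) : ℕ := #{p | y p = -1}

theorem negCount_le (y : Fin t → ℤˣ) : negCount y ≤ t :=
  (card_le_univ _).trans_eq (Fintype.card_fin t)

theorem prod_eq_neg_one_pow_negCount (y : Fin t → ℤˣ) : ∏ p, y p = (-1) ^ negCount y := by
  rw [negCount, ← prod_const, prod_filter]
  refine prod_congr rfl fun p _ => ?_
  rcases Int.units_eq_one_or (y p) with h | h <;> simp [h]

theorem prod_ite_units {M : Type*} [CommMonoid M] (y : Fin t → ℤˣ) (a b : M) :
    ∏ p, (if y p = -1 then a else b) = a ^ negCount y * b ^ (t - negCount y) := by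
  rw [prod_ite, prod_const, prod_const, filter_not, card_sdiff_of_subset (filter_subset _ _),
    card_univ, Fintype.card_fin]
  rfl

theorem sum_ite_units (y : Fin t → ℤˣ) (a b : ℝ) :
    ∑ p, (if y p = -1 then a else b) = negCount y * a + (t - negCount y : ℕ) * b := by
  rw [sum_ite, sum_const, sum_const, filter_not, card_sdiff_of_subset (filter_subset _ _),
    card_univ, Fintype.card_fin, nsmul_eq_mul, nsmul_eq_mul]
  rfl

/-- The discriminant of the quadratic factor of the characteristic polynomial of a sign block. -/
noncomputable def blockRoot (t : ℕ) (j : ℝ) : ℝ := √(((t : ℝ) - 2) ^ 2 + 8 * j)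

/-- A sign block is a diagonal matrix plus a rank-one matrix, so the matrix determinant lemma
applies. The extra factor X (X + 2) on the left avoids the exponents `q - 1` and `t - q - 1`, which
may be negative. -/
theorem charpoly_signBlock (y : Fin t → ℤˣ) :
    X * (X - C (-2)) * (signBlock fun p => ((y p : ℤ) : ℝ)).charpoly =
      (X - C (-2)) ^ negCount y * X ^ (t - negCount y) *
        ((X - C ((t - 2 + blockRoot t (t - negCount y : ℕ)) / 2)) *
          (X - C ((t - 2 - blockRoot t (t - negCount y : ℕ)) / 2))) := by
  set q := negCount y with hq
  set j := t - q with hj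
  set D := blockRoot t j with hD
  have htq : (t : ℝ) = q + j := by
    have := negCount_le y
    rw [hj, Nat.cast_sub this]; ring
  have hD2 : D ^ 2 = ((t : ℝ) - 2) ^ 2 + 8 * j := by
    rw [hD, blockRoot, Real.sq_sqrt (by positivity)]
  -- Away from 0 and -2 the diagonal part of `x - B` is invertible.
  refine Polynomial.eq_of_infinite_eval_eq _ _ (Set.Infinite.mono (s := ({0, -2} : Set ℝ)ᶜ) ?_
    (Set.Finite.infinite_compl (by simp)))
  intro x hx
  simp only [Set.mem_compl_iff, Set.mem_insert_iff, Set.mem_singleton_iff, not_or] at hx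
  obtain ⟨hx0, hx2⟩ := hx
  have hx2' : x + 2 ≠ 0 := fun h => hx2 (by linarith)
  set d : Fin t → ℝ := fun p => if y p = -1 then x + 2 else x with hd
  have hd0 : ∀ p, d p ≠ 0 := fun p => by simp only [hd]; split_ifs <;> assumption
  have hmat : (Matrix.scalar (Fin t)) x - signBlock (fun p => ((y p : ℤ) : ℝ)) =
      Matrix.diagonal d * (1 + Matrix.replicateCol Unit (fun p => -(d p)⁻¹) *
        Matrix.replicateRow Unit (fun _ => (1 : ℝ))) := by
    ext p p'
    rw [Matrix.diagonal_mul]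
    simp only [Matrix.sub_apply, Matrix.add_apply, Matrix.mul_apply, Matrix.replicateCol_apply,
      Matrix.replicateRow_apply, univ_unique, sum_const, card_singleton, one_smul, mul_one,
      Matrix.scalar_apply, signBlock]
    by_cases h : p = p'
    · subst h
      rw [Matrix.diagonal_apply_eq, if_pos rfl, Matrix.one_apply_eq, mul_add, mul_neg,
        mul_inv_cancel₀ (hd0 p)]
      rcases Int.units_eq_one_or (y p) with h | h
      · simp [hd, h]; ring
      · simp [hd, h]; ring
    · rw [Matrix.diagonal_apply_ne _ h, if_neg h, Matrix.one_apply_ne h, zero_add, mul_neg,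
        mul_inv_cancel₀ (hd0 p), zero_sub]
  have hdet : ((signBlock fun p => ((y p : ℤ) : ℝ)).charpoly).eval x =
      (x + 2) ^ q * x ^ j * (1 - (q * (x + 2)⁻¹ + j * x⁻¹)) := by
    rw [Matrix.eval_charpoly, hmat, Matrix.det_mul, Matrix.det_diagonal,
      Matrix.det_one_add_replicateCol_mul_replicateRow, hd, prod_ite_units]
    congr 1
    simp only [dotProduct, one_mul, apply_ite Inv.inv, sum_neg_distrib]
    rw [sum_ite_units]
    ring
  simp only [Set.mem_ofPred_eq, eval_mul, eval_X, eval_sub, eval_C, eval_pow, hdet]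
  have h1 : x * (x - -2) * ((x + 2) ^ q * x ^ j * (1 - (q * (x + 2)⁻¹ + j * x⁻¹))) =
      (x + 2) ^ q * x ^ j * (x * (x + 2) - (q * x + j * (x + 2))) := by
    field_simp
    ring
  rw [h1]
  have h2 : (x - (t - 2 + D) / 2) * (x - (t - 2 - D) / 2) =
      x * (x + 2) - (q * x + j * (x + 2)) := by
    have : (x - (t - 2 + D) / 2) * (x - (t - 2 - D) / 2) =
      x ^ 2 - (t - 2) * x + ((t - 2) ^ 2 - D ^ 2) / 4 := by ring
    rw [this, hD2, htq]; ring
  rw [h2, sub_neg_eq_add]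

theorem blockSpectrum_eq (y : Fin t → ℤˣ) :
    (0 : ℝ) ::ₘ (-2) ::ₘ blockSpectrum y = Multiset.replicate (negCount y) (-2) +
      Multiset.replicate (t - negCount y) 0 +
        {(t - 2 + blockRoot t (t - negCount y : ℕ)) / 2,
          (t - 2 - blockRoot t (t - negCount y : ℕ)) / 2} := by
  have h := congrArg Polynomial.roots (charpoly_signBlock y)
  have n1 : (signBlock fun p => ((y p : ℤ) : ℝ)).charpoly ≠ 0 :=
    (Matrix.charpoly_monic _).ne_zero
  have n2 : ∀ a : ℝ, (X - C a) ≠ 0 := Polynomial.X_sub_C_ne_zero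
  have n3 : (X : ℝ[X]) ≠ 0 := X_ne_zero
  rw [roots_mul (mul_ne_zero (mul_ne_zero n3 (n2 _)) n1), roots_mul (mul_ne_zero n3 (n2 _)),
    roots_mul (mul_ne_zero (mul_ne_zero (pow_ne_zero _ (n2 _)) (pow_ne_zero _ n3))
      (mul_ne_zero (n2 _) (n2 _))), roots_mul (mul_ne_zero (pow_ne_zero _ (n2 _)) (pow_ne_zero _ n3)),
    roots_mul (mul_ne_zero (n2 _) (n2 _)), roots_pow, roots_X_pow] at h
  simp only [roots_X, roots_X_sub_C, Multiset.nsmul_singleton] at h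
  rw [← blockSpectrum] at h
  rw [Multiset.insert_eq_cons, ← Multiset.singleton_add (((t : ℝ) - 2 + _) / 2), ← h,
    ← Multiset.singleton_add 0, ← Multiset.singleton_add (-2), add_assoc]

theorem le_blockRoot {j : ℝ} (hj : 0 ≤ j) : (t : ℝ) - 2 ≤ blockRoot t j :=
  (le_abs_self _).trans (Real.abs_le_sqrt (by linarith))

/-- The nuclear norm of a sign block. -/
theorem sum_abs_blockSpectrum (ht : 2 ≤ t) (y : Fin t → ℤˣ) :
    ((blockSpectrum y).map fun a => |a|).sum =
      2 * (negCount y : ℝ) - 2 + blockRoot t (t - negCount y : ℕ) := by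
  have h := congrArg (fun s => (Multiset.map (fun a : ℝ => |a|) s).sum) (blockSpectrum_eq y)
  have hD := le_blockRoot (t := t) (j := (t - negCount y : ℕ)) (by positivity)
  have ht' : (2 : ℝ) ≤ t := by exact_mod_cast ht
  simp only [Multiset.map_cons, Multiset.sum_cons, Multiset.map_add, Multiset.sum_add,
    Multiset.map_replicate, Multiset.sum_replicate, Multiset.insert_eq_cons,
    Multiset.map_singleton, Multiset.sum_singleton, nsmul_eq_mul, abs_zero, mul_zero] at h
  rw [abs_of_nonneg (a := ((t : ℝ) - 2 + _) / 2) (by linarith),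
    abs_of_nonpos (a := ((t : ℝ) - 2 - _) / 2) (by linarith), abs_neg, abs_two] at h
  linarith

/-- Product -1 forces an odd, hence positive, number of negative signs. The discriminant is then
below (t + 2)², its value when all signs are positive. -/
theorem abs_lt_of_mem_blockSpectrum (ht : 2 ≤ t) {y : Fin t → ℤˣ} (hy : ∏ p, y p = -1) {a : ℝ}
    (ha : a ∈ blockSpectrum y) : |a| < t := by
  have hq : Odd (negCount y) := by
    rw [prod_eq_neg_one_pow_negCount] at hy
    by_contra h
    rw [Nat.not_odd_iff_even] at h
    rw [h.neg_one_pow] at hy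
    exact absurd hy (by decide)
  have hq1 := hq.pos
  have hqt := negCount_le y
  have ht' : (2 : ℝ) ≤ t := by exact_mod_cast ht
  have hbs := blockSpectrum_eq y
  set q := negCount y with hqdef
  set D := blockRoot t (t - q : ℕ) with hD
  have hD0 : (t : ℝ) - 2 ≤ D := le_blockRoot (by positivity)
  have hj : ((t - q : ℕ) : ℝ) ≤ t - 1 := by
    rw [Nat.cast_sub hqt]
    have : (1 : ℝ) ≤ q := by exact_mod_cast hq1
    linarith
  have hD1 : D < t + 2 := by
    rw [hD, blockRoot, Real.sqrt_lt' (by linarith)]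
    nlinarith
  have hmem : a ∈ (0 : ℝ) ::ₘ (-2) ::ₘ blockSpectrum y := by simp [ha]
  rw [hbs] at hmem
  simp only [Multiset.mem_add, Multiset.mem_replicate, Multiset.insert_eq_cons, Multiset.mem_cons,
    Multiset.mem_singleton] at hmem
  rcases hmem with (⟨-, rfl⟩ | ⟨-, rfl⟩) | rfl | rfl
  · rw [abs_neg, abs_two]
    -- The eigenvalue -2 reaches the bound only for `t = 2`. There `q = 1`, and the single -2 on the
    -- right of `blockSpectrum_eq` is the one adjoined on the left, so -2 is not in the spectrum.
    refine lt_of_le_of_ne ht' fun h2 => ?_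
    have h2' : t = 2 := by exact_mod_cast h2.symm
    have hq' : q = 1 := by
      obtain ⟨s, hs⟩ := hq
      omega
    have hc := congrArg (Multiset.count (-2 : ℝ)) hbs
    have hD8 : D ^ 2 = 8 := by
      rw [hD, blockRoot, Real.sq_sqrt (by positivity), hq', h2']; norm_num
    have e1 : (-2 : ℝ) ≠ ((t : ℝ) - 2 + D) / 2 := by
      intro h; rw [← h2] at h; nlinarith
    have e2 : (-2 : ℝ) ≠ ((t : ℝ) - 2 - D) / 2 := by
      intro h; rw [← h2] at h; nlinarith
    have h3 : 0 < Multiset.count (-2 : ℝ) (blockSpectrum y) := Multiset.count_pos.2 ha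
    rw [hq', Multiset.count_cons_of_ne (by norm_num), Multiset.count_cons_self, Multiset.count_add,
      Multiset.count_add, Multiset.insert_eq_cons, Multiset.count_cons_of_ne e1,
      Multiset.count_singleton, if_neg e2, Multiset.count_replicate_self, Multiset.count_replicate,
      if_neg (by norm_num)] at hc
    omega
  · rw [abs_zero]; linarith
  · rw [abs_lt]; constructor <;> linarith
  · rw [abs_lt]; constructor <;> linarith

/-- There are finitely many sign vectors, so the strict inequality is uniform. The gap between `ρ`
and `t` is what a strictly monotone function turns into a gap of values. -/
theorem exists_bound_blockSpectrum (ht : 2 ≤ t) : ∃ ρ : ℝ, 0 ≤ ρ ∧ ρ < t ∧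
    ∀ y : Fin t → ℤˣ, ∏ p, y p = -1 → ∀ a ∈ blockSpectrum y, |a| ≤ ρ := by
  have ht0 : (0 : ℝ) < t := by exact_mod_cast (by omega : 0 < t)
  have key : ∀ y : Fin t → ℤˣ, ∃ ρ : ℝ, 0 ≤ ρ ∧ ρ < t ∧
      (∏ p, y p = -1 → ∀ a ∈ blockSpectrum y, |a| ≤ ρ) := by
    intro y
    by_cases hy : ∏ p, y p = -1
    · set s : Finset ℝ := insert 0 ((blockSpectrum y).map fun a => |a|).toFinset with hs
      have hne : s.Nonempty := insert_nonempty _ _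
      refine ⟨s.max' hne, le_max' _ _ (by simp [hs]), ?_, fun _ a ha => le_max' _ _ ?_⟩
      · rw [max'_lt_iff]
        intro b hb
        simp only [hs, mem_insert, Multiset.mem_toFinset, Multiset.mem_map] at hb
        rcases hb with rfl | ⟨a, ha, rfl⟩
        · exact ht0
        · exact abs_lt_of_mem_blockSpectrum ht hy ha
      · simp only [hs, mem_insert, Multiset.mem_toFinset, Multiset.mem_map]
        exact Or.inr ⟨a, ha, rfl⟩
    · exact ⟨0, le_rfl, ht0, fun h => absurd h hy⟩
  choose ρ h0 h1 h2 using key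
  refine ⟨univ.sup' univ_nonempty ρ, (h0 1).trans (le_sup' ρ (mem_univ 1)), ?_, fun y hy a ha => ?_⟩
  · rw [sup'_lt_iff]
    exact fun y _ => h1 y
  · exact (h2 y hy a ha).trans (le_sup' ρ (mem_univ y))

theorem natCast_mem_blockSpectrum_one (ht : 2 ≤ t) :
    ∃ a ∈ blockSpectrum (1 : Fin t → ℤˣ), |a| = t := by
  have ht' : (2 : ℝ) ≤ t := by exact_mod_cast ht
  have hq : negCount (1 : Fin t → ℤˣ) = 0 := by
    rw [negCount, card_eq_zero, filter_eq_empty_iff]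
    intro p _
    simp only [Pi.one_apply]; decide
  have h := blockSpectrum_eq (1 : Fin t → ℤˣ)
  rw [hq, Nat.sub_zero] at h
  have hD : blockRoot t t = t + 2 := by
    rw [blockRoot, show ((t : ℝ) - 2) ^ 2 + 8 * t = (t + 2) ^ 2 by ring,
      Real.sqrt_sq (by linarith)]
  have hmem : (t : ℝ) ∈ (0 : ℝ) ::ₘ (-2) ::ₘ blockSpectrum (1 : Fin t → ℤˣ) := by
    rw [h, hD]
    simp only [Multiset.mem_add, Multiset.insert_eq_cons, Multiset.mem_cons]
    right; left; ring
  simp only [Multiset.mem_cons] at hmem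
  rcases hmem with h | h | h
  · linarith
  · linarith
  · exact ⟨t, h, abs_of_nonneg (by linarith)⟩

theorem two_mem_blockSpectrum (y : Fin 2 → ℤˣ) (hy : ∏ p, y p = 1) :
    ∃ a ∈ blockSpectrum y, |a| = ((2 : ℕ) : ℝ) := by
  have hcases : y = 1 ∨ y = -1 := by
    rw [Fin.prod_univ_two] at hy
    rcases Int.units_eq_one_or (y 0) with h0 | h0 <;> rcases Int.units_eq_one_or (y 1) with h1 | h1
    · left; funext i; fin_cases i <;> simp [h0, h1]
    · rw [h0, h1] at hy; exact absurd hy (by decide)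
    · rw [h0, h1] at hy; exact absurd hy (by decide)
    · right; funext i; fin_cases i <;> simp [h0, h1]
  rcases hcases with rfl | rfl
  · exact natCast_mem_blockSpectrum_one le_rfl
  · have hq : negCount (-1 : Fin 2 → ℤˣ) = 2 := by decide
    have h := blockSpectrum_eq (-1 : Fin 2 → ℤˣ)
    rw [hq] at h
    have hc := congrArg (Multiset.count (-2 : ℝ)) h
    rw [Multiset.count_cons_of_ne (by norm_num), Multiset.count_cons_self, Multiset.count_add,
      Multiset.count_add, Multiset.count_replicate_self] at hc
    have h3 : 0 < Multiset.count (-2 : ℝ) (blockSpectrum (-1 : Fin 2 → ℤˣ)) := by omega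
    exact ⟨-2, Multiset.count_pos.1 h3, by norm_num⟩

end BlockSpectrum

end

/-! ### Hard streams, and averaging over the random tape -/

section

open Finset

section Streams

variable {t m r N : ℕ}

theorem finalMatrix_apply (s : List (EntryUpdate N)) (a b : Fin N) :
    finalMatrix s a b = (s.map fun u => if u.row = a ∧ u.col = b then u.delta else 0).sum := by
  induction s with
  | nil => rfl
  | cons u s ih =>
    have : finalMatrix (u :: s) = Matrix.single u.row u.col u.delta + finalMatrix s := rfl
    rw [this, Matrix.add_apply, ih, Matrix.single_apply, List.map_cons, List.sum_cons]

theorem matrixNnz_finalMatrix_le (s : List (EntryUpdate N)) :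
    matrixNnz (finalMatrix s) ≤ s.length := by
  classical
  have : (univ.filter fun p : Fin N × Fin N => finalMatrix s p.1 p.2 ≠ 0) ⊆
      (s.map fun u => (u.row, u.col)).toFinset := by
    intro p hp
    rw [mem_filter] at hp
    by_contra hn
    refine hp.2 ?_
    rw [finalMatrix_apply]
    refine List.sum_eq_zero fun z hz => ?_
    obtain ⟨u, hu, rfl⟩ := List.mem_map.1 hz
    rw [if_neg]
    rintro ⟨h1, h2⟩
    exact hn (List.mem_toFinset.2 (List.mem_map.2 ⟨u, hu, by rw [h1, h2]⟩))
  refine (card_le_card this).trans ((List.toFinset_card_le _).trans_eq (by simp))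

/-- The first part of the hard stream writes the signs of the vertices on the diagonal. -/
noncomputable def vertexStream (e : (Fin t × Fin m) ⊕ Fin r ≃ Fin N) (x : Fin t × Fin m → ℤˣ) :
    List (EntryUpdate N) :=
  (univ : Finset (Fin t × Fin m)).toList.map fun v => ⟨e (Sum.inl v), e (Sum.inl v), x v⟩

/-- The second part of the hard stream writes the blocks off the diagonal. -/
noncomputable def edgeStream (e : (Fin t × Fin m) ⊕ Fin r ≃ Fin N)
    (π : Fin t → Equiv.Perm (Fin m)) (w : Fin m → ℤˣ) : List (EntryUpdate N) :=
  (univ : Finset (Fin t × Fin t × Fin m)).toList.map fun c =>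
    ⟨e (Sum.inl (c.1, π c.1 c.2.2)), e (Sum.inl (c.2.1, π c.2.1 c.2.2)),
      -- Zero updates on the diagonal keep the index set a full product.
      if c.1 = c.2.1 then 0 else (rowSign (w c.2.2) c.1 : ℤˣ)⟩

theorem length_vertexStream (e : (Fin t × Fin m) ⊕ Fin r ≃ Fin N) (x : Fin t × Fin m → ℤˣ) :
    (vertexStream e x).length = t * m := by simp [vertexStream]

theorem length_edgeStream (e : (Fin t × Fin m) ⊕ Fin r ≃ Fin N)
    (π : Fin t → Equiv.Perm (Fin m)) (w : Fin m → ℤˣ) :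
    (edgeStream e π w).length = t * (t * m) := by simp [edgeStream]

theorem abs_units_le_one (u : ℤˣ) : |(u : ℤ)| ≤ 1 := by
  rcases Int.units_eq_one_or u with rfl | rfl <;> simp

theorem abs_delta_le_one (e : (Fin t × Fin m) ⊕ Fin r ≃ Fin N) (π : Fin t → Equiv.Perm (Fin m))
    (x : Fin t × Fin m → ℤˣ) (w : Fin m → ℤˣ) :
    ∀ u ∈ vertexStream e x ++ edgeStream e π w, |u.delta| ≤ 1 := by
  intro u hu
  rcases List.mem_append.1 hu with h | h
  · obtain ⟨v, -, rfl⟩ := List.mem_map.1 h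
    exact abs_units_le_one _
  · obtain ⟨v, -, rfl⟩ := List.mem_map.1 h
    simp only
    split_ifs
    · simp
    · exact abs_units_le_one _

/-- On the diagonal the row sign occurs twice and cancels, leaving `x` alone. Hence the first half
of the stream needs no knowledge of the hypermatching or of the labels. -/
theorem finalMatrix_vertexStream_append (e : (Fin t × Fin m) ⊕ Fin r ≃ Fin N)
    (π : Fin t → Equiv.Perm (Fin m)) (x : Fin t × Fin m → ℤˣ) (w : Fin m → ℤˣ) :
    finalMatrix (vertexStream e x ++ edgeStream e π w) = hardMatrix e π x w := by
  ext a b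
  rw [finalMatrix_apply, List.map_append, List.sum_append, vertexStream, edgeStream, List.map_map,
    List.map_map, sum_map_toList, sum_map_toList]
  simp only [Function.comp_def]
  rw [hardMatrix, Matrix.reindex_apply, Matrix.submatrix_apply]
  obtain ⟨a, rfl⟩ := (matchingIndex e π).surjective a
  obtain ⟨b, rfl⟩ := (matchingIndex e π).surjective b
  rw [Equiv.symm_apply_apply, Equiv.symm_apply_apply]
  have inr_ne : ∀ (i : Fin r) (v : Fin t × Fin m), e (Sum.inl v) ≠ matchingIndex e π (Sum.inr i) := by
    intro i v h
    exact Sum.inl_ne_inr (e.injective h)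
  rcases a with ⟨p, j⟩ | i
  · rcases b with ⟨p', j'⟩ | i'
    · rw [Matrix.fromBlocks_apply₁₁, Matrix.diagonal_mul, Matrix.blockDiagonal_apply]
      simp only [matchingIndex_inl, e.injective.eq_iff, Sum.inl.injEq, Prod.mk.injEq]
      have h1 : ∑ v : Fin t × Fin m, (if v = (p, π p j) ∧ v = (p', π p' j') then ((x v : ℤˣ) : ℤ) else 0) =
          if p = p' ∧ j = j' then ((x (p, π p j) : ℤˣ) : ℤ) else 0 := by
        rw [sum_eq_single (p, π p j)]
        · by_cases hp : p = p'
          · subst hp; simp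
          · simp [hp]
        · intro v _ hv; simp [hv]
        · simp
      have h2 : ∑ c : Fin t × Fin t × Fin m, (if (c.1 = p ∧ π c.1 c.2.2 = π p j) ∧
          (c.2.1 = p' ∧ π c.2.1 c.2.2 = π p' j') then
            (if c.1 = c.2.1 then 0 else ((rowSign (w c.2.2) c.1 : ℤˣ) : ℤ)) else 0) =
          if j = j' then (if p = p' then 0 else ((rowSign (w j) p : ℤˣ) : ℤ)) else 0 := by
        rw [sum_eq_single (p, p', j)]
        · simp
        · rintro ⟨c1, c2, c3⟩ _ hc
          rw [if_neg]
          rintro ⟨⟨h1, h2⟩, h3, h4⟩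
          simp only at h1 h2 h3 h4
          subst h1 h3
          rw [(π c1).injective.eq_iff] at h2
          exact hc (by rw [h2])
        · simp
      rw [h1, h2]
      simp only [signBlock, blockSigns]
      by_cases hj : j = j'
      · subst hj
        by_cases hp : p = p'
        · subst hp
          simp only [if_true, and_self, add_zero]
          rw [← Units.val_mul, ← mul_assoc, Int.units_mul_self, one_mul]
        · simp [hp]
      · simp [hj]
    · rw [Matrix.fromBlocks_apply₁₂]
      simp [inr_ne]
  · rcases b with ⟨p', j'⟩ | i'
    · rw [Matrix.fromBlocks_apply₂₁]
      simp [inr_ne]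
    · rw [Matrix.fromBlocks_apply₂₂]
      simp [inr_ne]

end Streams

namespace StreamingAlgorithm

variable {Ω : Type} [MeasurableSpace Ω] {N S : ℕ}

theorem runFrom_append (alg : StreamingAlgorithm Ω N S) (ω : Ω) (n : ℕ) (b : Fin S → Bool)
    (s s' : List (EntryUpdate N)) :
    alg.runFrom ω n b (s ++ s') = alg.runFrom ω (n + s.length) (alg.runFrom ω n b s) s' := by
  induction s generalizing n b with
  | nil => rfl
  | cons u s ih =>
    rw [List.cons_append, runFrom, ih, runFrom, List.length_cons]
    congr 1
    omega

theorem measurable_runFrom (alg : StreamingAlgorithm Ω N S) (s : List (EntryUpdate N)) (n : ℕ)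
    (b : Ω → Fin S → Bool) (hb : Measurable b) :
    Measurable fun ω => alg.runFrom ω n (b ω) s := by
  induction s generalizing n b with
  | nil => exact hb
  | cons u s ih =>
    refine ih (n + 1) (fun ω => alg.update ω n (b ω) u) ?_
    have : Measurable fun p : Ω × (Fin S → Bool) => alg.update p.1 n p.2 u :=
      measurable_from_prod_countable_left fun b => alg.measurable_update n b u
    exact this.comp (measurable_id.prodMk hb)

theorem measurable_answer (alg : StreamingAlgorithm Ω N S) (s : List (EntryUpdate N)) :
    Measurable fun ω => alg.answer ω s := by
  have : Measurable fun p : Ω × (Fin S → Bool) => alg.output p.1 p.2 :=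
    measurable_from_prod_countable_left fun b => alg.measurable_output b
  exact this.comp (measurable_id.prodMk
    (alg.measurable_runFrom s 0 alg.init alg.measurable_init))

end StreamingAlgorithm

/-- The easy direction of Yao's principle: a bound on the advantage for every fixed tape survives
averaging over the tape. -/
theorem sum_measureReal_sub_le {Ω : Type*} [MeasurableSpace Ω] (P : Measure Ω)
    [IsProbabilityMeasure P] {ι : Type*} (s : Finset ι) (A B : ι → Set Ω)
    (hA : ∀ i ∈ s, MeasurableSet (A i)) (hB : ∀ i ∈ s, MeasurableSet (B i)) (κ : ℝ)
    (h : ∀ ω, ∑ i ∈ s, ((A i).indicator 1 ω - (B i).indicator (1 : Ω → ℝ) ω) ≤ κ) :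
    ∑ i ∈ s, (P.real (A i) - P.real (B i)) ≤ κ := by
  have hi : ∀ C : Set Ω, MeasurableSet C → Integrable (C.indicator (1 : Ω → ℝ)) P := fun C hC =>
    (integrable_const (1 : ℝ)).indicator hC
  have hAB : ∀ i ∈ s, Integrable
      (fun ω => (A i).indicator (1 : Ω → ℝ) ω - (B i).indicator (1 : Ω → ℝ) ω) P :=
    fun i his => (hi _ (hA i his)).sub (hi _ (hB i his))
  have h1 : ∑ i ∈ s, (P.real (A i) - P.real (B i)) =
      ∫ ω, ∑ i ∈ s, ((A i).indicator 1 ω - (B i).indicator (1 : Ω → ℝ) ω) ∂P := by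
    rw [integral_finsetSum _ hAB]
    refine sum_congr rfl fun i his => ?_
    rw [integral_sub (hi _ (hA i his)) (hi _ (hB i his)), integral_indicator_one (hA i his),
      integral_indicator_one (hB i his)]
  rw [h1]
  calc ∫ ω, ∑ i ∈ s, ((A i).indicator 1 ω - (B i).indicator (1 : Ω → ℝ) ω) ∂P ≤ ∫ _, κ ∂P :=
        integral_mono (integrable_finsetSum _ hAB) (integrable_const κ) h
    _ = κ := by simp

end

/-! ### From streaming algorithms to one-way protocols -/

section

open Finset

section Reduction

variable {t m r N : ℕ}

/-- The hard stream of the sign `b`. -/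
noncomputable def hardStream (e : (Fin t × Fin m) ⊕ Fin r ≃ Fin N) (b : ℤˣ)
    (π : Fin t → Equiv.Perm (Fin m)) (x : Fin t × Fin m → ℤˣ) : List (EntryUpdate N) :=
  vertexStream e x ++ edgeStream e π fun j => b * edgeProd π x j

/-- The final matrix of the hard stream of the sign `b`. -/
def hardInput (e : (Fin t × Fin m) ⊕ Fin r ≃ Fin N) (b : ℤˣ)
    (π : Fin t → Equiv.Perm (Fin m)) (x : Fin t × Fin m → ℤˣ) : Matrix (Fin N) (Fin N) ℤ :=
  hardMatrix e π x fun j => b * edgeProd π x j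

theorem finalMatrix_hardStream (e : (Fin t × Fin m) ⊕ Fin r ≃ Fin N) (b : ℤˣ)
    (π : Fin t → Equiv.Perm (Fin m)) (x : Fin t × Fin m → ℤˣ) :
    finalMatrix (hardStream e b π x) = hardInput e b π x :=
  finalMatrix_vertexStream_append e π x _

theorem length_hardStream (e : (Fin t × Fin m) ⊕ Fin r ≃ Fin N) (b : ℤˣ)
    (π : Fin t → Equiv.Perm (Fin m)) (x : Fin t × Fin m → ℤˣ) :
    (hardStream e b π x).length = t * m + t * (t * m) := by
  rw [hardStream, List.length_append, length_vertexStream, length_edgeStream]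

/-- For every random tape, an algorithm with few states behaves alike on the hard streams of both
signs. -/
theorem sum_indicator_sub_le {Ω : Type} [MeasurableSpace Ω] {S : ℕ}
    (alg : StreamingAlgorithm Ω N S) (e : (Fin t × Fin m) ⊕ Fin r ≃ Fin N) (b : ℤˣ) (τ : ℝ)
    (S₂ : ℕ) (ω : Ω) :
    ∑ z : (Fin t → Equiv.Perm (Fin m)) × (Fin t × Fin m → ℤˣ),
      ({ω | τ ≤ |alg.answer ω (hardStream e b z.1 z.2)|}.indicator 1 ω -
        {ω | τ ≤ |alg.answer ω (hardStream e (-b) z.1 z.2)|}.indicator (1 : Ω → ℝ) ω) ≤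
      (m.factorial : ℝ) ^ t * 2 ^ (t * m) *
        (2 * ∑ k ∈ (range (m + 1)).filter Odd, advantageTerm t m S₂ S k) := by
  set g : (Fin t × Fin m → ℤˣ) → (Fin S → Bool) := fun x =>
    alg.runFrom ω 0 (alg.init ω) (vertexStream e x) with hg
  set D : (Fin S → Bool) → (Fin t → Equiv.Perm (Fin m)) → (Fin m → ℤˣ) → ℝ := fun a π w =>
    if τ ≤ |alg.output ω (alg.runFrom ω (0 + t * m) a (edgeStream e π fun j => b * w j))|
    then 1 else 0 with hD
  have h := advantage_le g D (fun a π w => by simp only [hD]; split_ifs <;> simp)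
    -- The exponent balances the cost of 2^S cells against the hypercontractive constant; adding 1
    -- keeps it positive.
    (fun k => S₂ / min k (m - k) + 1) (fun k => Nat.le_add_left 1 _)
  have hcard : Fintype.card (Fin S → Bool) = 2 ^ S := by simp
  rw [hcard] at h
  push_cast at h
  have e1 : ∀ (c : ℤˣ) π x, alg.answer ω (hardStream e c π x) =
      alg.output ω (alg.runFrom ω (0 + t * m) (g x) (edgeStream e π fun j => c * edgeProd π x j)) := by
    intro c π x
    rw [StreamingAlgorithm.answer, hardStream, StreamingAlgorithm.runFrom_append,
      length_vertexStream]
  rw [Fintype.sum_prod_type]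
  refine le_trans (le_of_eq ?_) ((le_abs_self _).trans (h.trans (le_of_eq ?_)))
  · refine sum_congr rfl fun π _ => sum_congr rfl fun x _ => ?_
    simp only [Set.indicator_apply, Set.mem_ofPred_eq, e1, hD, Pi.one_apply, Pi.neg_apply,
      mul_neg, neg_mul]
  · simp only [advantageTerm]
    push_cast
    rfl

/-- Comparing the answer with the threshold (1 - c) u is a test for the sign. It errs with
probability at most δ, except on a fraction η of atypical inputs on either side. -/
theorem one_sub_le_advantage {Ω : Type} [MeasurableSpace Ω] {P : Measure Ω}
    [IsProbabilityMeasure P] {S : ℕ}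
    {alg : StreamingAlgorithm Ω N S} {F : Matrix (Fin N) (Fin N) ℤ → ℝ} {c δ : ℝ} {M L B : ℕ}
    (happ : alg.Approximates P F c δ M L B) (hM : 1 ≤ M) (hL : t * m + t * (t * m) ≤ L)
    (hB : t * m + t * (t * m) ≤ B) (hc0 : 0 ≤ c) (hc1 : c ≤ 1) (hδ : 0 ≤ δ)
    (e : (Fin t × Fin m) ⊕ Fin r ≃ Fin N) (b : ℤˣ) {u v η : ℝ} (huv : (1 + c) * v < (1 - c) * u)
    (hu : ∀ π, (#{x | |F (hardInput e b π x)| < u} : ℝ) ≤ η * 2 ^ (t * m))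
    (hv : ∀ π, (#{x | v < |F (hardInput e (-b) π x)|} : ℝ) ≤ η * 2 ^ (t * m)) (S₂ : ℕ) :
    1 - 2 * δ - 2 * η ≤ 2 * ∑ k ∈ (range (m + 1)).filter Odd, advantageTerm t m S₂ S k := by
  have happ' : ∀ b' π x, 1 - δ ≤ P.real {ω | |alg.answer ω (hardStream e b' π x) -
      F (hardInput e b' π x)| ≤ c * |F (hardInput e b' π x)|} := by
    intro b' π x
    rw [← finalMatrix_hardStream]
    refine happ _ ((length_hardStream e b' π x).trans_le hL) (fun w hw => ?_)
      ((matrixNnz_finalMatrix_le _).trans ((length_hardStream e b' π x).trans_le hB))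
    exact (abs_delta_le_one e π x _ w hw).trans (by exact_mod_cast hM)
  set τ := (1 - c) * u with hτ
  set A : (Fin t → Equiv.Perm (Fin m)) × (Fin t × Fin m → ℤˣ) → Set Ω := fun z =>
    {ω | τ ≤ |alg.answer ω (hardStream e b z.1 z.2)|} with hA
  set A' : (Fin t → Equiv.Perm (Fin m)) × (Fin t × Fin m → ℤˣ) → Set Ω := fun z =>
    {ω | τ ≤ |alg.answer ω (hardStream e (-b) z.1 z.2)|} with hA'
  have hmeas : ∀ (b' : ℤˣ) (z : (Fin t → Equiv.Perm (Fin m)) × (Fin t × Fin m → ℤˣ)),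
      MeasurableSet {ω | τ ≤ |alg.answer ω (hardStream e b' z.1 z.2)|} :=
    fun b' z => measurableSet_le measurable_const
        (continuous_abs.measurable.comp (alg.measurable_answer _))
  have hupper := sum_measureReal_sub_le P univ A A' (fun z _ => hmeas b z)
    (fun z _ => hmeas (-b) z) _ (sum_indicator_sub_le alg e b τ S₂)
  have hlowA : ∀ π x, 1 - δ - (if |F (hardInput e b π x)| < u then 1 else 0) ≤ P.real (A (π, x)) := by
    intro π x
    split_ifs with h
    · have : 0 ≤ P.real (A (π, x)) := measureReal_nonneg
      linarith
    · rw [sub_zero]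
      refine (happ' b π x).trans (measureReal_mono fun ω hω => ?_)
      simp only [Set.mem_ofPred_eq, hA] at hω ⊢
      push Not at h
      have h1 := abs_sub_abs_le_abs_sub (F (hardInput e b π x)) (alg.answer ω (hardStream e b π x))
      rw [abs_sub_comm] at h1
      have h2 : (1 - c) * u ≤ (1 - c) * |F (hardInput e b π x)| :=
        mul_le_mul_of_nonneg_left h (by linarith)
      rw [hτ]; linarith
  have hlowA' : ∀ π x, P.real (A' (π, x)) ≤
      δ + (if v < |F (hardInput e (-b) π x)| then 1 else 0) := by
    intro π x
    split_ifs with h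
    · have : P.real (A' (π, x)) ≤ 1 := measureReal_le_one
      linarith
    · have h3 : P.real (A' (π, x)) = 1 - P.real (A' (π, x))ᶜ := by
        rw [probReal_compl_eq_one_sub (hmeas (-b) (π, x))]; ring
      rw [h3, add_zero]
      have h4 : 1 - δ ≤ P.real (A' (π, x))ᶜ := by
        refine (happ' (-b) π x).trans (measureReal_mono fun ω hω => ?_)
        simp only [Set.mem_ofPred_eq, hA', Set.mem_compl_iff, not_le] at hω ⊢
        push Not at h
        have h1 := abs_sub_abs_le_abs_sub (alg.answer ω (hardStream e (-b) π x))
          (F (hardInput e (-b) π x))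
        have h2 : (1 + c) * |F (hardInput e (-b) π x)| ≤ (1 + c) * v :=
          mul_le_mul_of_nonneg_left h (by linarith)
        rw [hτ]; linarith
      linarith
  have hcard : ((univ : Finset (Fin t → Equiv.Perm (Fin m))).card : ℝ) = (m.factorial : ℝ) ^ t := by
    rw [card_univ, Fintype.card_fun, Fintype.card_perm]; simp
  have hcardx : ((univ : Finset (Fin t × Fin m → ℤˣ)).card : ℝ) = 2 ^ (t * m) := by
    rw [card_univ, Fintype.card_fun, Fintype.card_units_int]; simp
  have hlower : (m.factorial : ℝ) ^ t * 2 ^ (t * m) * (1 - 2 * δ - 2 * η) ≤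
      ∑ z, (P.real (A z) - P.real (A' z)) := by
    rw [Fintype.sum_prod_type]
    have : ∀ π, 2 ^ (t * m) * (1 - 2 * δ - 2 * η) ≤ ∑ x, (P.real (A (π, x)) - P.real (A' (π, x))) := by
      intro π
      calc (2 : ℝ) ^ (t * m) * (1 - 2 * δ - 2 * η)
          ≤ 2 ^ (t * m) * (1 - 2 * δ) - #{x | |F (hardInput e b π x)| < u} -
              #{x | v < |F (hardInput e (-b) π x)|} := by linarith [hu π, hv π]
        _ = ∑ x, ((1 - δ - (if |F (hardInput e b π x)| < u then 1 else 0)) -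
              (δ + (if v < |F (hardInput e (-b) π x)| then 1 else 0))) := by
            simp only [sum_sub_distrib, sum_add_distrib, sum_const, nsmul_eq_mul, hcardx, sum_boole]
            ring
        _ ≤ _ := sum_le_sum fun x _ => sub_le_sub (hlowA π x) (hlowA' π x)
    calc _ = ∑ π : Fin t → Equiv.Perm (Fin m), (2 : ℝ) ^ (t * m) * (1 - 2 * δ - 2 * η) := by
          rw [sum_const, nsmul_eq_mul, hcard]; ring
      _ ≤ _ := sum_le_sum fun π _ => this π
  exact le_of_mul_le_mul_left (hlower.trans hupper) (by positivity)

/-- An algorithm without memory does not approximate a functional that vanishes at zero and does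
not vanish at some matrix with a single entry. -/
theorem one_le_space {Ω : Type} [MeasurableSpace Ω] {P : Measure Ω}
    [IsProbabilityMeasure P] {S : ℕ}
    {alg : StreamingAlgorithm Ω N S} {F : Matrix (Fin N) (Fin N) ℤ → ℝ} {c δ : ℝ} {M L B : ℕ}
    (happ : alg.Approximates P F c δ M L B) (hM : 1 ≤ M) (hL : 1 ≤ L) (hB : 1 ≤ B)
    (hc1 : c < 1) (hδ : δ < 1 / 2) (h0 : F 0 = 0) (i : Fin N)
    (h1 : F (Matrix.single i i 1) ≠ 0) : 1 ≤ S := by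
  by_contra hS
  obtain rfl : S = 0 := by omega
  set s : List (EntryUpdate N) := [⟨i, i, 1⟩] with hs
  have hfin : finalMatrix s = Matrix.single i i 1 := by simp [hs, finalMatrix]
  have hfin0 : finalMatrix ([] : List (EntryUpdate N)) = 0 := rfl
  have a1 := happ [] (by simp) (by simp) ((matrixNnz_finalMatrix_le _).trans (by simp))
  have a2 := happ s hL (by simpa [hs] using hM) ((matrixNnz_finalMatrix_le _).trans hB)
  rw [hfin] at a2
  rw [hfin0, h0, abs_zero, mul_zero] at a1
  have hans : ∀ ω, alg.answer ω s = alg.answer ω [] := fun ω => by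
    rw [StreamingAlgorithm.answer, StreamingAlgorithm.answer]
    congr 1
    exact Subsingleton.elim _ _
  simp only [hans] at a2
  -- A relative error forces the exact answer 0 on the zero matrix, and 0 is wrong wherever `F` does
  -- not vanish. Without memory the answers agree, so two events of probability above 1/2 would be
  -- disjoint.
  have hdisj : Disjoint {ω | |alg.answer ω [] - 0| ≤ 0} {ω | |alg.answer ω [] -
      F (Matrix.single i i 1)| ≤ c * |F (Matrix.single i i 1)|} := by
    rw [Set.disjoint_left]
    intro ω h2 h3
    simp only [Set.mem_ofPred_eq] at h2 h3
    have : alg.answer ω [] = 0 := by simpa using h2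
    rw [this, zero_sub, abs_neg] at h3
    have h4 : 0 < |F (Matrix.single i i 1)| := abs_pos.2 h1
    nlinarith
  have hm : MeasurableSet {ω | |alg.answer ω [] - F (Matrix.single i i 1)| ≤
      c * |F (Matrix.single i i 1)|} :=
    measurableSet_le (continuous_abs.measurable.comp ((alg.measurable_answer _).sub_const _))
      measurable_const
  have h5 := measureReal_union (μ := P) hdisj hm
  have h6 : P.real ({ω | |alg.answer ω [] - 0| ≤ 0} ∪ {ω | |alg.answer ω [] -
      F (Matrix.single i i 1)| ≤ c * |F (Matrix.single i i 1)|}) ≤ 1 := measureReal_le_one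
  linarith

end Reduction

end

/-! ### Finite differences of the square root -/

section

open Finset

section FiniteDifferences

theorem hasDerivAt_fwdDiff_iter {g g' : ℝ → ℝ} (h : ∀ x, 0 < x → HasDerivAt g (g' x) x) (n : ℕ) :
    ∀ x, 0 < x → HasDerivAt ((fwdDiff (1 : ℝ))^[n] g) ((fwdDiff (1 : ℝ))^[n] g' x) x := by
  induction n with
  | zero => exact h
  | succ n ih =>
    intro x hx
    rw [Function.iterate_succ_apply', Function.iterate_succ_apply']
    exact ((ih (x + 1) (by linarith)).comp_add_const x 1).sub (ih x hx)

theorem continuous_fwdDiff_iter {g : ℝ → ℝ} (h : Continuous g) (n : ℕ) :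
    Continuous ((fwdDiff (1 : ℝ))^[n] g) := by
  induction n with
  | zero => exact h
  | succ n ih =>
    rw [Function.iterate_succ_apply']
    exact (ih.comp (continuous_add_const 1)).sub ih

theorem hasDerivAt_affine_rpow {a x : ℝ} (ha : 0 ≤ a) (hx : 0 < x) (s : ℝ) :
    HasDerivAt (fun x : ℝ => (a + 8 * x) ^ s) ((8 * s) * (a + 8 * x) ^ (s - 1)) x := by
  have h1 : HasDerivAt (fun x : ℝ => a + 8 * x) 8 x := by
    simpa using ((hasDerivAt_id x).const_mul 8).const_add a
  have := h1.rpow_const (p := s) (Or.inl (by positivity))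
  exact this

/-- Complete monotonicity of negative powers: the mean value theorem trades one difference for one
derivative, which lowers the exponent to `s - 1` and brings out the negative factor `8 s`. -/
theorem neg_one_pow_mul_fwdDiff_rpow_pos {a : ℝ} (ha : 0 ≤ a) (n : ℕ) : ∀ s : ℝ, s < 0 → ∀ x, 0 < x →
    0 < (-1) ^ n * (fwdDiff (1 : ℝ))^[n] (fun x : ℝ => (a + 8 * x) ^ s) x := by
  induction n with
  | zero =>
    intro s _ x hx
    simp only [pow_zero, Function.iterate_zero, id, one_mul]
    positivity
  | succ n ih =>
    intro s hs x hx
    have hd := hasDerivAt_fwdDiff_iter (fun y hy => hasDerivAt_affine_rpow ha hy s) n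
    obtain ⟨c, hc, hc'⟩ := exists_hasDerivAt_eq_slope ((fwdDiff (1 : ℝ))^[n] fun x : ℝ => (a + 8 * x) ^ s) _
      (show x < x + 1 by linarith)
      (fun y hy => (hd y (by linarith [hy.1])).continuousAt.continuousWithinAt)
      (fun y hy => hd y (by linarith [hy.1]))
    have h1 : (fwdDiff (1 : ℝ))^[n] (fun x : ℝ => 8 * s * (a + 8 * x) ^ (s - 1)) c =
        8 * s * (fwdDiff (1 : ℝ))^[n] (fun x : ℝ => (a + 8 * x) ^ (s - 1)) c := by
      have := fwdDiff_iter_const_smul (1 : ℝ) (8 * s) (fun x : ℝ => (a + 8 * x) ^ (s - 1)) n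
      exact congrFun this c
    rw [h1, add_sub_cancel_left, div_one] at hc'
    rw [Function.iterate_succ_apply', fwdDiff, ← hc']
    have h2 := ih (s - 1) (by linarith) c (by linarith [hc.1])
    have h3 : (-1 : ℝ) ^ (n + 1) * (8 * s * (fwdDiff (1 : ℝ))^[n] (fun x : ℝ => (a + 8 * x) ^ (s - 1)) c) =
        (-8 * s) * ((-1) ^ n * (fwdDiff (1 : ℝ))^[n] (fun x : ℝ => (a + 8 * x) ^ (s - 1)) c) := by ring
    rw [h3]
    exact mul_pos (by linarith) h2

/-- One more mean value step reduces to exponent -1/2. When `a = 0` the root is not differentiable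
at 0, but continuity at the left end of the interval suffices. -/
theorem fwdDiff_iter_sqrt_ne_zero {a : ℝ} (ha : 0 ≤ a) {n : ℕ} (hn : 1 ≤ n) :
    (fwdDiff (1 : ℝ))^[n] (fun x : ℝ => √(a + 8 * x)) 0 ≠ 0 := by
  obtain ⟨n, rfl⟩ : ∃ k, n = k + 1 := ⟨n - 1, by omega⟩
  simp only [Real.sqrt_eq_rpow]
  have hd := hasDerivAt_fwdDiff_iter (fun y hy => hasDerivAt_affine_rpow ha hy (1 / 2)) n
  have hcont : Continuous fun x : ℝ => (a + 8 * x) ^ (1 / 2 : ℝ) := by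
    simp only [← Real.sqrt_eq_rpow]; fun_prop
  obtain ⟨c, hc, hc'⟩ := exists_hasDerivAt_eq_slope ((fwdDiff (1 : ℝ))^[n] fun x : ℝ => (a + 8 * x) ^ (1 / 2 : ℝ)) _
    (show (0 : ℝ) < 0 + 1 by norm_num) (continuous_fwdDiff_iter hcont n).continuousOn
    (fun y hy => hd y hy.1)
  have h1 : (fwdDiff (1 : ℝ))^[n] (fun x : ℝ => 8 * (1 / 2) * (a + 8 * x) ^ ((1 / 2 : ℝ) - 1)) c =
      8 * (1 / 2) * (fwdDiff (1 : ℝ))^[n] (fun x : ℝ => (a + 8 * x) ^ ((1 / 2 : ℝ) - 1)) c := by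
    have := fwdDiff_iter_const_smul (1 : ℝ) (8 * (1 / 2) : ℝ)
      (fun x : ℝ => (a + 8 * x) ^ ((1 / 2 : ℝ) - 1)) n
    exact congrFun this c
  rw [h1, add_sub_cancel_left, div_one] at hc'
  rw [Function.iterate_succ_apply', fwdDiff, ← hc']
  have h2 := neg_one_pow_mul_fwdDiff_rpow_pos ha n ((1 / 2 : ℝ) - 1) (by norm_num) c hc.1
  intro h0
  have h3 : (fwdDiff (1 : ℝ))^[n] (fun x : ℝ => (a + 8 * x) ^ ((1 / 2 : ℝ) - 1)) c = 0 := by linarith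
  rw [h3, mul_zero] at h2
  exact lt_irrefl _ h2

/-- The alternating sum of the nuclear norms of the sign blocks. -/
theorem alternating_sum_blockRoot_ne_zero {t : ℕ} (ht : 2 ≤ t) :
    ∑ q ∈ range (t + 1), (t.choose q : ℝ) * ((-1) ^ q * (2 * (q : ℝ) - 2 +
      blockRoot t (t - q : ℕ))) ≠ 0 := by
  set S : ℝ → ℝ := fun x => √(((t : ℝ) - 2) ^ 2 + 8 * x) with hS
  -- In terms of j = t - q the nuclear norm is an affine function plus the square root, and the
  -- `t`-th difference kills the affine part because `t ≥ 2`.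
  set G : ℝ → ℝ := (2 * (t : ℝ) - 2) • (fun r : ℝ => r ^ 0) + (-2 : ℝ) • (fun r : ℝ => r ^ 1) + S
    with hG
  have h1 : (fwdDiff (1 : ℝ))^[t] G 0 = (fwdDiff (1 : ℝ))^[t] S 0 := by
    rw [hG, fwdDiff_iter_add, fwdDiff_iter_add, fwdDiff_iter_const_smul, fwdDiff_iter_const_smul,
      fwdDiff_iter_pow_eq_zero_of_lt (by omega), fwdDiff_iter_pow_eq_zero_of_lt (by omega)]
    simp
  have h2 := fwdDiff_iter_eq_sum_shift (1 : ℝ) G t 0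
  rw [← sum_range_reflect] at h2
  have h3 : ∑ q ∈ range (t + 1), (t.choose q : ℝ) * ((-1) ^ q * (2 * (q : ℝ) - 2 +
      blockRoot t (t - q : ℕ))) = (fwdDiff (1 : ℝ))^[t] G 0 := by
    rw [h2]
    refine sum_congr rfl fun q hq => ?_
    have hq' : q ≤ t := by have := mem_range.1 hq; omega
    have e1 : t + 1 - 1 - q = t - q := by omega
    have e2 : t - (t - q) = q := by omega
    rw [e1, e2, Nat.choose_symm hq']
    simp only [hG, hS, blockRoot, Pi.add_apply, Pi.smul_apply, smul_eq_mul, zsmul_eq_mul, nsmul_eq_mul]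
    rw [Nat.cast_sub hq']
    push_cast
    rw [zero_add, mul_one, pow_zero, pow_one]
    ring
  rw [h3, h1]
  exact fwdDiff_iter_sqrt_ne_zero (by positivity) (by omega)

end FiniteDifferences

/-! ### Concentration of sums over independent blocks -/

section Concentration

/-- Variances of independent centred terms add, as the cross terms vanish. The factor on the left
avoids the exponent `m - 1`. -/
theorem sum_sq_sum_eq {P : Type*} [Fintype P] (h : P → ℝ) (h0 : ∑ p, h p = 0) (m : ℕ) :
    (Fintype.card P : ℝ) * ∑ f : Fin m → P, (∑ j, h (f j)) ^ 2 =
      m * (Fintype.card P : ℝ) ^ m * ∑ p, h p ^ 2 := by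
  induction m with
  | zero => simp
  | succ m ih =>
    rw [← (Fin.consEquiv fun _ => P).sum_comp, Fintype.sum_prod_type]
    simp only [Fin.consEquiv, Equiv.coe_fn_mk, Fin.sum_univ_succ, Fin.cons_zero, Fin.cons_succ]
    have h1 : ∀ p, ∑ f : Fin m → P, (h p + ∑ j, h (f j)) ^ 2 =
        (Fintype.card P : ℝ) ^ m * h p ^ 2 + 2 * h p * ∑ f : Fin m → P, ∑ j, h (f j) +
          ∑ f : Fin m → P, (∑ j, h (f j)) ^ 2 := by
      intro p
      simp only [add_sq, sum_add_distrib, sum_const, card_univ, Fintype.card_fun, Fintype.card_fin,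
        nsmul_eq_mul, ← mul_sum]
      push_cast; ring
    simp only [h1, sum_add_distrib, ← mul_sum, ← sum_mul, h0, sum_const, card_univ, nsmul_eq_mul]
    rw [mul_zero, zero_mul, add_zero, mul_add, ih]
    push_cast; ring

/-- Chebyshev's inequality for sums of independent copies of a function on a finite set. -/
theorem exists_card_deviation_le {P : Type*} [Fintype P] [Nonempty P] (ψ : P → ℝ) {ζ κ : ℝ}
    (hζ : 0 < ζ) (hκ : 0 < κ) : ∃ m₀ : ℕ, ∀ m, m₀ ≤ m →
      (#{f : Fin m → P | ζ * m ≤ |∑ j, ψ (f j) - m * ((∑ p, ψ p) / Fintype.card P)|} : ℝ) ≤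
        κ * (Fintype.card P : ℝ) ^ m := by
  classical
  set c : ℝ := (Fintype.card P : ℝ) with hc
  have hc0 : 0 < c := by rw [hc]; exact_mod_cast Fintype.card_pos
  set μ : ℝ := (∑ p, ψ p) / c with hμ
  set h : P → ℝ := fun p => ψ p - μ with hh
  have h0 : ∑ p, h p = 0 := by
    simp only [hh, sum_sub_distrib, sum_const, card_univ, nsmul_eq_mul]
    rw [hμ, ← hc]; field_simp; ring
  set W := ∑ p, h p ^ 2 with hW
  have hW0 : 0 ≤ W := sum_nonneg fun _ _ => sq_nonneg _
  obtain ⟨m₀, hm₀⟩ := exists_nat_gt (W / (c * ζ ^ 2 * κ))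
  refine ⟨m₀ + 1, fun m hm => ?_⟩
  have hm1 : (0 : ℝ) < m := by exact_mod_cast (by omega : 0 < m)
  have hm2 : W ≤ m * (c * ζ ^ 2 * κ) := by
    rw [div_lt_iff₀ (by positivity)] at hm₀
    refine hm₀.le.trans ?_
    gcongr
    omega
  set bad : Finset (Fin m → P) := {f : Fin m → P | ζ * m ≤ |∑ j, ψ (f j) - m * μ|} with hbad
  have h1 : (#bad : ℝ) * (ζ * m) ^ 2 ≤ ∑ f : Fin m → P, (∑ j, h (f j)) ^ 2 := by
    rw [← nsmul_eq_mul, ← sum_const]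
    refine (sum_le_sum fun f hf => ?_).trans
      (sum_le_sum_of_subset_of_nonneg (subset_univ bad) fun _ _ _ => sq_nonneg _)
    have hf' := (mem_filter.1 hf).2
    have e : ∑ j, h (f j) = ∑ j, ψ (f j) - m * μ := by
      simp [hh, sum_sub_distrib]
    rw [e, ← sq_abs (_ - _)]
    gcongr
  have h2 := sum_sq_sum_eq h h0 m
  rw [← hc, ← hW] at h2
  have h3 : (#bad : ℝ) * (c * (ζ * m) ^ 2) ≤ (κ * c ^ m) * (c * (ζ * m) ^ 2) := by
    calc (#bad : ℝ) * (c * (ζ * m) ^ 2) = c * (#bad * (ζ * m) ^ 2) := by ring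
      _ ≤ m * c ^ m * W := by rw [← h2]; gcongr
      _ ≤ m * c ^ m * (m * (c * ζ ^ 2 * κ)) := by gcongr
      _ = _ := by ring
  exact le_of_mul_le_mul_right h3 (by positivity)

end Concentration

/-! ### Random blocks with prescribed product of signs -/

section Ensembles

variable {t m r N : ℕ}

/-- Signs with the product `b`, obtained from arbitrary signs by changing at most the first. -/
def signsOfProd (b : ℤˣ) (v : Fin t → ℤˣ) : Fin t → ℤˣ := blockSigns (b * ∏ p, v p) v

theorem prod_blockSigns (ht : 1 ≤ t) (c : ℤˣ) (v : Fin t → ℤˣ) :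
    ∏ p, blockSigns c v p = c * ∏ p, v p := by
  obtain ⟨t, rfl⟩ : ∃ d, t = d + 1 := ⟨t - 1, by omega⟩
  simp only [blockSigns, prod_mul_distrib]
  congr 1
  rw [Fin.prod_univ_succ]
  simp [rowSign]

theorem prod_signsOfProd (ht : 1 ≤ t) (b : ℤˣ) (v : Fin t → ℤˣ) :
    ∏ p, signsOfProd b v p = b := by
  rw [signsOfProd, prod_blockSigns ht, mul_assoc, Int.units_mul_self, mul_one]

/-- The signs along the edges of a hypermatching. -/
def edgeSigns (π : Fin t → Equiv.Perm (Fin m)) :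
    (Fin t × Fin m → ℤˣ) ≃ (Fin m → Fin t → ℤˣ) where
  toFun x j p := x (p, π p j)
  invFun f v := f ((π v.1).symm v.2) v.1
  left_inv x := by funext v; simp
  right_inv f := by funext j p; simp

theorem hardInput_eq (e : (Fin t × Fin m) ⊕ Fin r ≃ Fin N) (b : ℤˣ)
    (π : Fin t → Equiv.Perm (Fin m)) (x : Fin t × Fin m → ℤˣ) :
    (univ : Finset (Fin N)).val.map (fun i : Fin N => sigma (hardInput e b π x) i) =
      (∑ j, (blockSpectrum (signsOfProd b (edgeSigns π x j))).map fun a => |a|) +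
        Multiset.replicate r 0 :=
  map_sigma_hardMatrix e π x _

/-- For every `π`, reading `x` along the edges is a bijection, so the blocks are independent and
uniform and `m₀` does not depend on `π`. -/
theorem exists_card_edge_deviation_le (ψ : (Fin t → ℤˣ) → ℝ) {ζ κ : ℝ}
    (hζ : 0 < ζ) (hκ : 0 < κ) : ∃ m₀ : ℕ, ∀ m, m₀ ≤ m → ∀ π : Fin t → Equiv.Perm (Fin m),
      (#{x : Fin t × Fin m → ℤˣ | ζ * m ≤ |∑ j, ψ (edgeSigns π x j) - m * ((∑ v, ψ v) / 2 ^ t)|} : ℝ)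
        ≤ κ * 2 ^ (t * m) := by
  obtain ⟨m₀, h⟩ := exists_card_deviation_le ψ hζ hκ
  refine ⟨m₀, fun m hm π => ?_⟩
  have h1 := h m hm
  have hc : (Fintype.card (Fin t → ℤˣ) : ℝ) = 2 ^ t := by
    rw [Fintype.card_fun, Fintype.card_units_int]; simp
  rw [hc, ← pow_mul] at h1
  refine le_trans ?_ h1
  norm_cast
  refine card_le_card_of_injOn (edgeSigns π) ?_ (edgeSigns π).injective.injOn
  intro x hx
  simpa using hx

theorem blockSigns_one (v : Fin t → ℤˣ) : blockSigns 1 v = v := by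
  funext p; simp [blockSigns, rowSign]

theorem blockSigns_blockSigns (c : ℤˣ) (v : Fin t → ℤˣ) : blockSigns c (blockSigns c v) = v := by
  funext p
  simp only [blockSigns]
  rw [← mul_assoc, Int.units_mul_self, one_mul]

/-- One of the two vectors `signsOfProd (±1) v` is `v` and the other is `v` with its first sign
flipped. The flip is an involution that negates the product. -/
theorem sum_signsOfProd_sub (ht : 1 ≤ t) (φ : (Fin t → ℤˣ) → ℝ) :
    ∑ v, φ (signsOfProd 1 v) - ∑ v, φ (signsOfProd (-1) v) =
      2 * ∑ v : Fin t → ℤˣ, (((∏ p, v p : ℤˣ) : ℤ) : ℝ) * φ v := by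
  have h1 : ∀ v : Fin t → ℤˣ, φ (signsOfProd 1 v) - φ (signsOfProd (-1) v) =
      (((∏ p, v p : ℤˣ) : ℤ) : ℝ) * φ v - (((∏ p, v p : ℤˣ) : ℤ) : ℝ) * φ (blockSigns (-1) v) := by
    intro v
    rw [signsOfProd, signsOfProd]
    rcases Int.units_eq_one_or (∏ p, v p) with h | h
    · simp [h, blockSigns_one]
    · simp [h, blockSigns_one]; ring
  have h2 : ∑ v : Fin t → ℤˣ, (((∏ p, v p : ℤˣ) : ℤ) : ℝ) * φ (blockSigns (-1) v) =
      - ∑ v : Fin t → ℤˣ, (((∏ p, v p : ℤˣ) : ℤ) : ℝ) * φ v := by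
    rw [← Equiv.sum_comp (Function.Involutive.toPerm (blockSigns (-1) : (Fin t → ℤˣ) → _)
      (blockSigns_blockSigns (-1))) (fun v => (((∏ p, v p : ℤˣ) : ℤ) : ℝ) * φ v),
      ← sum_neg_distrib]
    refine sum_congr rfl fun v _ => ?_
    change _ = -((((∏ p, blockSigns (-1) v p : ℤˣ) : ℤ) : ℝ) * φ (blockSigns (-1) v))
    rw [prod_blockSigns ht]
    push_cast; ring
  rw [← sum_sub_distrib, sum_congr rfl fun v _ => h1 v, sum_sub_distrib, h2]
  ring

theorem sum_prod_mul_negCount (G : ℕ → ℝ) :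
    ∑ v : Fin t → ℤˣ, (((∏ p, v p : ℤˣ) : ℤ) : ℝ) * G (negCount v) =
      ∑ q ∈ range (t + 1), (t.choose q : ℝ) * ((-1) ^ q * G q) := by
  have h1 : ∑ v : Fin t → ℤˣ, (((∏ p, v p : ℤˣ) : ℤ) : ℝ) * G (negCount v) =
      ∑ U : Finset (Fin t), (-1) ^ #U * G #U := by
    refine sum_nbij' (fun v => univ.filter fun p => v p = -1) (fun U p => if p ∈ U then -1 else 1)
      (fun _ _ => mem_univ _) (fun _ _ => mem_univ _) ?_ ?_ ?_
    · intro v _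
      funext p
      rcases Int.units_eq_one_or (v p) with h | h <;> simp [h]
    · intro U _
      ext p
      simp only [mem_filter, mem_univ, true_and]
      split_ifs with h
      · simp [h]
      · simp only [h, iff_false]; decide
    · intro v _
      rw [prod_eq_neg_one_pow_negCount]
      simp only [negCount]
      push_cast; rfl
  rw [h1, ← powerset_univ, sum_powerset_apply_card (fun k => (-1 : ℝ) ^ k * G k), card_univ,
    Fintype.card_fin]
  simp only [nsmul_eq_mul]

/-- The nuclear norm of a sign block. -/
noncomputable def blockNuclear (y : Fin t → ℤˣ) : ℝ := ((blockSpectrum y).map fun a => |a|).sum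

theorem blockNuclear_nonneg (y : Fin t → ℤˣ) : 0 ≤ blockNuclear y := by
  refine Multiset.sum_nonneg fun a ha => ?_
  obtain ⟨b, -, rfl⟩ := Multiset.mem_map.1 ha
  exact abs_nonneg b

theorem sum_blockNuclear_ne (ht : 2 ≤ t) :
    ∑ v : Fin t → ℤˣ, blockNuclear (signsOfProd 1 v) ≠
      ∑ v : Fin t → ℤˣ, blockNuclear (signsOfProd (-1) v) := by
  rw [← sub_ne_zero, sum_signsOfProd_sub (by omega)]
  refine mul_ne_zero two_ne_zero ?_
  simp only [blockNuclear, sum_abs_blockSpectrum ht]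
  rw [sum_prod_mul_negCount fun q => 2 * (q : ℝ) - 2 + blockRoot t (t - q : ℕ)]
  exact alternating_sum_blockRoot_ne_zero ht

end Ensembles

end

/-! ### Sums of singular values of the hard inputs -/

section

open Finset

section SingularValueSums

variable {t m r N : ℕ}

theorem sigma_nonneg (A : Matrix (Fin N) (Fin N) ℤ) (i : ℕ) : 0 ≤ sigma A i :=
  LinearMap.singularValues_nonneg _ i

theorem sigma_antitone (A : Matrix (Fin N) (Fin N) ℤ) : Antitone (sigma A) :=
  LinearMap.singularValues_antitone _

theorem sigma_of_le (A : Matrix (Fin N) (Fin N) ℤ) {i : ℕ} (hi : N ≤ i) : sigma A i = 0 :=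
  LinearMap.singularValues_of_finrank_le _ (by simpa using hi)

theorem sigma_zero_matrix (i : ℕ) : sigma (0 : Matrix (Fin N) (Fin N) ℤ) i = 0 := by
  have : (0 : Matrix (Fin N) (Fin N) ℤ).map ((↑) : ℤ → ℝ) = 0 := by ext; simp
  rw [sigma, this, map_zero, LinearMap.singularValues_zero]
  rfl

theorem sigma_zero_pos {A : Matrix (Fin N) (Fin N) ℤ} (hA : A ≠ 0) : 0 < sigma A 0 := by
  refine lt_of_le_of_ne (sigma_nonneg A 0) fun h => hA ?_
  have h0 : (Matrix.toEuclideanLin (A.map ((↑) : ℤ → ℝ))).singularValues = 0 := by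
    ext i
    exact le_antisymm ((sigma_antitone A (Nat.zero_le i)).trans h.ge) (sigma_nonneg A i)
  rw [LinearMap.singularValues_eq_zero_iff, LinearEquiv.map_eq_zero_iff] at h0
  ext i j
  have := congrFun (congrFun h0 i) j
  simpa using this

theorem le_sigma_of_lt_card (A : Matrix (Fin N) (Fin N) ℤ) {a : ℝ} {i : ℕ}
    (h : i < #{j : Fin N | a ≤ sigma A j}) : a ≤ sigma A i := by
  by_contra hlt
  push Not at hlt
  refine absurd h (not_lt.2 ?_)
  calc #{j : Fin N | a ≤ sigma A j} ≤ #(range i) := by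
        refine card_le_card_of_injOn (fun j => (j : ℕ)) ?_ Fin.val_injective.injOn
        intro j hj
        simp only [coe_filter, mem_univ, true_and, Set.mem_ofPred_eq] at hj
        simp only [coe_range, Set.mem_Iio]
        by_contra hij
        push Not at hij
        exact absurd (hj.trans (sigma_antitone A hij)) (not_le.2 hlt)
    _ = i := card_range i

theorem card_filter_sigma (A : Matrix (Fin N) (Fin N) ℤ) (p : ℝ → Prop) [DecidablePred p] :
    #{j : Fin N | p (sigma A j)} =
      ((univ : Finset (Fin N)).val.map fun i : Fin N => sigma A i).countP p := by
  rw [Multiset.countP_map]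
  rfl

theorem card_blockSpectrum_le (y : Fin t → ℤˣ) : Multiset.card (blockSpectrum y) ≤ t := by
  refine (Polynomial.card_roots' _).trans ?_
  rw [Matrix.charpoly_natDegree_eq_dim, Fintype.card_fin]

theorem countP_sum {ι α : Type*} (s : Finset ι) (f : ι → Multiset α) (p : α → Prop)
    [DecidablePred p] : (∑ i ∈ s, f i).countP p = ∑ i ∈ s, (f i).countP p :=
  map_sum (Multiset.countPAddMonoidHom p) f s

/-- Whether a sign block attains the maximal operator norm `t`. -/
def IsExtremal (y : Fin t → ℤˣ) : Prop := ∃ a ∈ blockSpectrum y, |a| = t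

-- Each extremal block contributes at least one singular value equal to `t`.
open Classical in
theorem sum_isExtremal_le_card (e : (Fin t × Fin m) ⊕ Fin r ≃ Fin N) (b : ℤˣ)
    (π : Fin t → Equiv.Perm (Fin m)) (x : Fin t × Fin m → ℤˣ) :
    ∑ j, (if IsExtremal (signsOfProd b (edgeSigns π x j)) then 1 else 0) ≤
      #{i : Fin N | (t : ℝ) ≤ sigma (hardInput e b π x) i} := by
  rw [card_filter_sigma, hardInput_eq, Multiset.countP_add, countP_sum]
  refine le_add_right (sum_le_sum fun j _ => ?_)
  split_ifs with h
  · obtain ⟨a, ha, hat⟩ := h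
    exact Multiset.countP_pos.2 ⟨|a|, Multiset.mem_map.2 ⟨a, ha, rfl⟩, hat.ge⟩
  · exact Nat.zero_le _

theorem sigma_hardInput_le (e : (Fin t × Fin m) ⊕ Fin r ≃ Fin N) (b : ℤˣ)
    (π : Fin t → Equiv.Perm (Fin m)) (x : Fin t × Fin m → ℤˣ) {ρ : ℝ} (hρ : 0 ≤ ρ)
    (h : ∀ v : Fin t → ℤˣ, ∀ a ∈ blockSpectrum (signsOfProd b v), |a| ≤ ρ) (i : ℕ) :
    sigma (hardInput e b π x) i ≤ ρ := by
  rcases le_or_gt N i with hi | hi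
  · rw [sigma_of_le _ hi]; exact hρ
  · have hmem : sigma (hardInput e b π x) i ∈
        (univ : Finset (Fin N)).val.map fun i : Fin N => sigma (hardInput e b π x) i :=
      Multiset.mem_map.2 ⟨⟨i, hi⟩, mem_univ_val _, rfl⟩
    rw [hardInput_eq, Multiset.mem_add, Multiset.mem_sum] at hmem
    rcases hmem with ⟨j, -, hj⟩ | hz
    · obtain ⟨a, ha, haeq⟩ := Multiset.mem_map.1 hj
      rw [← haeq]
      exact h _ a ha
    · rw [Multiset.eq_of_mem_replicate hz]; exact hρ

/-- At most `t * m ≤ k` singular values are nonzero, so the Ky-Fan norm is the full nuclear norm,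
which is additive over the blocks. -/
theorem kyFanNorm_hardInput (e : (Fin t × Fin m) ⊕ Fin r ≃ Fin N) (b : ℤˣ)
    (π : Fin t → Equiv.Perm (Fin m)) (x : Fin t × Fin m → ℤˣ) {k : ℕ} (hk : t * m ≤ k)
    (hkN : k ≤ N) :
    kyFanNorm k (hardInput e b π x) = ∑ j, blockNuclear (signsOfProd b (edgeSigns π x j)) := by
  classical
  have hcard : #{i : Fin N | 0 < sigma (hardInput e b π x) i} ≤ t * m := by
    rw [card_filter_sigma, hardInput_eq, Multiset.countP_add, countP_sum]
    have h0 : (Multiset.replicate r (0 : ℝ)).countP (fun a => 0 < a) = 0 := by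
      rw [Multiset.countP_eq_zero]
      intro a ha
      rw [Multiset.eq_of_mem_replicate ha]; exact lt_irrefl _
    rw [h0, add_zero, mul_comm]
    calc _ ≤ ∑ _j : Fin m, t := sum_le_sum fun j _ => by
            refine (Multiset.countP_le_card _ _).trans ?_
            rw [Multiset.card_map]
            exact card_blockSpectrum_le _
      _ = m * t := by simp
  have hzero : ∀ i, k ≤ i → sigma (hardInput e b π x) i = 0 := by
    intro i hi
    by_contra hne
    have hpos : 0 < sigma (hardInput e b π x) i := lt_of_le_of_ne (sigma_nonneg _ _) (Ne.symm hne)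
    have hiN : i < N := by
      by_contra hn
      exact hne (sigma_of_le _ (not_lt.1 hn))
    have : i + 1 ≤ #{i : Fin N | 0 < sigma (hardInput e b π x) i} := by
      calc i + 1 = #(univ : Finset (Fin (i + 1))) := by simp
        _ ≤ _ := by
          refine card_le_card_of_injOn (fun a => ⟨a, by omega⟩) ?_ ?_
          · intro a _
            simp only [coe_filter, mem_univ, true_and, Set.mem_ofPred_eq]
            exact hpos.trans_le (sigma_antitone _ (by omega))
          · intro a _ a' _ h
            simpa [Fin.ext_iff] using h
    omega
  have h1 : kyFanNorm k (hardInput e b π x) = ∑ i : Fin N, sigma (hardInput e b π x) i := by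
    rw [Fin.sum_univ_eq_sum_range (fun i => sigma (hardInput e b π x) i) N, kyFanNorm]
    refine sum_subset (range_subset_range.2 hkN) fun i _ hi => hzero i ?_
    simpa using hi
  rw [h1, ← sum_map_val, hardInput_eq]
  rw [Multiset.sum_add, Multiset.sum_replicate, smul_zero, add_zero]
  rw [← Multiset.coe_sumAddMonoidHom, map_sum]
  rfl

end SingularValueSums

end

/-! ### The two space lower bounds for a fixed order `t` -/

section

open Finset

section LowerBounds

theorem rpow_le_of_pow_le {t : ℕ} (ht : 1 ≤ t) {A x s : ℝ} (hA : 0 ≤ A) (hx : 0 ≤ x) (hs : 0 ≤ s)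
    (h : A * x ^ (t - 1) ≤ s ^ t) : A ^ (1 / (t : ℝ)) * x ^ (1 - 1 / (t : ℝ)) ≤ s := by
  have ht0 : (0 : ℝ) < t := by exact_mod_cast ht
  refine le_of_pow_le_pow_left₀ (n := t) (by omega) hs (le_trans (le_of_eq ?_) h)
  rw [mul_pow, ← Real.rpow_natCast (A ^ _), ← Real.rpow_mul hA, ← Real.rpow_natCast (x ^ _),
    ← Real.rpow_mul hx, one_div_mul_cancel ht0.ne', Real.rpow_one, sub_mul,
    one_div_mul_cancel ht0.ne', one_mul, ← Real.rpow_natCast x, Nat.cast_sub ht, Nat.cast_one]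

/-- The space bound in terms of the size of the hypermatching. -/
theorem exists_lt_space_pow {t : ℕ} (ht : 2 ≤ t) {δ : ℝ} (hδ0 : 0 < δ) (hδ : δ < 1 / 2) :
    ∃ γ : ℝ, 0 < γ ∧ ∀ {Ω : Type} [MeasurableSpace Ω] {P : Measure Ω} [IsProbabilityMeasure P]
      {m r N S : ℕ} {alg : StreamingAlgorithm Ω N S} {F : Matrix (Fin N) (Fin N) ℤ → ℝ} {c : ℝ}
      {M L B : ℕ} (_ : Even m) (_ : 1 ≤ S) (_ : alg.Approximates P F c δ M L B) (_ : 1 ≤ M)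
      (_ : t * m + t * (t * m) ≤ L) (_ : t * m + t * (t * m) ≤ B) (_ : 0 ≤ c) (_ : c ≤ 1)
      (e : (Fin t × Fin m) ⊕ Fin r ≃ Fin N) (b : ℤˣ) {u v : ℝ} (_ : (1 + c) * v < (1 - c) * u)
      (_ : ∀ π, (#{x | |F (hardInput e b π x)| < u} : ℝ) ≤ (1 - 2 * δ) / 4 * 2 ^ (t * m))
      (_ : ∀ π, (#{x | v < |F (hardInput e (-b) π x)|} : ℝ) ≤ (1 - 2 * δ) / 4 * 2 ^ (t * m)),
      γ * (m : ℝ) ^ (t - 1) ≤ (S : ℝ) ^ t := by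
  obtain ⟨κ, hκ, r₀, hr⟩ := exists_advantageTerm_sum_le ht
    (show 0 < (1 - 2 * δ) / 4 by linarith)
  refine ⟨κ / (1 + r₀) ^ t, by positivity, ?_⟩
  intro Ω _ P _ m r N S alg F c M L B hm hS happ hM hL hB hc0 hc1 e b u v huv hu hv
  by_contra hlt
  push Not at hlt
  rw [div_mul_eq_mul_div, lt_div_iff₀ (by positivity)] at hlt
  -- Since `S ≥ 1`, the additive margin `r₀` is absorbed into the constant.
  have hS' : ((S + r₀ : ℕ) : ℝ) ≤ S * (1 + r₀) := by
    have : (1 : ℝ) ≤ S := by exact_mod_cast hS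
    push_cast
    nlinarith [(Nat.cast_nonneg r₀ : (0 : ℝ) ≤ r₀)]
  have h1 : ((S + r₀ : ℕ) : ℝ) ^ t ≤ κ * (m : ℝ) ^ (t - 1) := by
    refine (pow_le_pow_left₀ (by positivity) hS' t).trans ?_
    rw [mul_pow]; exact hlt.le
  have h2 := hr m S hm h1
  have h3 := one_sub_le_advantage happ hM hL hB hc0 hc1 hδ0.le e b huv hu hv (S + r₀)
  linarith

/-- The indices of an `N × N` matrix that contains a hypermatching with `t * m` vertices. -/
theorem exists_index_equiv {t m N : ℕ} (h : t * m ≤ N) :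
    Nonempty ((Fin t × Fin m) ⊕ Fin (N - t * m) ≃ Fin N) :=
  ⟨Fintype.equivOfCardEq (by simp; omega)⟩

/-- The constant in a lower bound of the form `C * N ^ (1 - 1 / t)`. -/
theorem mul_rpow_le_space {t N m S N₁ : ℕ} (ht : 2 ≤ t) (hN : 1 ≤ N) (hS : 1 ≤ S) {γ β : ℝ}
    (hγ : 0 < γ) (hβ : 0 < β) (h : N₁ ≤ N → β * N ≤ m ∧ γ * (m : ℝ) ^ (t - 1) ≤ (S : ℝ) ^ t) :
    min ((γ * β ^ (t - 1)) ^ (1 / (t : ℝ))) (1 / (N₁ + 1)) * (N : ℝ) ^ (1 - 1 / (t : ℝ)) ≤ S := by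
  have ht0 : (0 : ℝ) < t := by exact_mod_cast (by omega : 0 < t)
  have hN' : (1 : ℝ) ≤ N := by exact_mod_cast hN
  have hS' : (1 : ℝ) ≤ S := by exact_mod_cast hS
  rcases le_or_gt N₁ N with hN₁ | hN₁
  · obtain ⟨h1, h2⟩ := h hN₁
    refine le_trans (mul_le_mul_of_nonneg_right (min_le_left _ _) (by positivity)) ?_
    refine rpow_le_of_pow_le (by omega) (by positivity) (by positivity) (by positivity)
      (le_trans ?_ h2)
    rw [mul_assoc, ← mul_pow]
    gcongr
  -- Below the threshold `N₁` the bound of one bit suffices. This keeps the final `N₀` independent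
  -- of δ although the concentration threshold is not.
  · refine le_trans (mul_le_mul_of_nonneg_right (min_le_right _ _) (by positivity)) ?_
    have h3 : (N : ℝ) ^ (1 - 1 / (t : ℝ)) ≤ N := by
      refine (Real.rpow_le_rpow_of_exponent_le hN' ?_).trans_eq (Real.rpow_one _)
      have : 0 < 1 / (t : ℝ) := by positivity
      linarith
    have h4 : (N : ℝ) ≤ N₁ + 1 := by exact_mod_cast (by omega : N ≤ N₁ + 1)
    calc 1 / ((N₁ : ℝ) + 1) * (N : ℝ) ^ (1 - 1 / (t : ℝ)) ≤ 1 / ((N₁ : ℝ) + 1) * (N₁ + 1) := by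
          gcongr; exact h3.trans h4
      _ = 1 := by field_simp
      _ ≤ S := hS'

theorem stream_length_le {t m N : ℕ} (h : t * m ≤ N) :
    t * m + t * (t * m) ≤ (t + 1) * N := by
  calc t * m + t * (t * m) = (t + 1) * (t * m) := by ring
    _ ≤ _ := by gcongr

/-- The largest even number `m` with `t * m ≤ k`, up to a factor. -/
theorem evenPart_bounds {t : ℕ} (ht : 1 ≤ t) (k : ℕ) :
    t * (2 * (k / (2 * t))) ≤ k ∧ (k : ℝ) / t - 2 ≤ (2 * (k / (2 * t)) : ℕ) := by
  have h1 := Nat.mul_div_le k (2 * t)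
  have h2 := Nat.lt_mul_div_succ k (show 0 < 2 * t by omega)
  refine ⟨by rw [← mul_assoc, mul_comm t 2]; exact h1, ?_⟩
  have ht0 : (0 : ℝ) < t := by exact_mod_cast ht
  have h3 : (k : ℝ) < 2 * t * (k / (2 * t) + 1 : ℕ) := by exact_mod_cast h2
  rw [sub_le_iff_le_add, div_le_iff₀ ht0]
  push_cast at h3 ⊢
  linarith

/-- A strictly monotone function vanishing at zero may be replaced by its absolute value. -/
theorem exists_strictMonoOn_abs {f : ℝ → ℝ}
    (hf : StrictMonoOn f (Set.Ici 0) ∨ StrictAntiOn f (Set.Ici 0)) (f0 : f 0 = 0) :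
    ∃ g : ℝ → ℝ, StrictMonoOn g (Set.Ici 0) ∧ g 0 = 0 ∧
      ∀ (N k : ℕ) (A : Matrix (Fin N) (Fin N) ℤ),
        |partialSpectralSum f k A| = partialSpectralSum g k A := by
  have key : ∀ g : ℝ → ℝ, StrictMonoOn g (Set.Ici 0) → g 0 = 0 →
      ∀ (N k : ℕ) (A : Matrix (Fin N) (Fin N) ℤ), 0 ≤ partialSpectralSum g k A := by
    intro g hg g0 N k A
    refine sum_nonneg fun i _ => ?_
    rw [← g0]
    exact hg.monotoneOn (Set.mem_Ici.2 le_rfl) (Set.mem_Ici.2 (sigma_nonneg A i)) (sigma_nonneg A i)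
  rcases hf with hf | hf
  · exact ⟨f, hf, f0, fun N k A => abs_of_nonneg (key f hf f0 N k A)⟩
  · refine ⟨fun x => -f x, hf.neg, by simp [f0], fun N k A => ?_⟩
    have h := key (fun x => -f x) hf.neg (by simp [f0]) N k A
    have e : partialSpectralSum (fun x => -f x) k A = -partialSpectralSum f k A := by
      simp [partialSpectralSum]
    rw [e] at h ⊢
    exact abs_of_nonpos (by linarith)

theorem partialSpectralSum_zero {g : ℝ → ℝ} (g0 : g 0 = 0) (k N : ℕ) :
    partialSpectralSum g k (0 : Matrix (Fin N) (Fin N) ℤ) = 0 := by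
  simp [partialSpectralSum, sigma_zero_matrix, g0]

theorem partialSpectralSum_pos {g : ℝ → ℝ} (hg : StrictMonoOn g (Set.Ici 0)) (g0 : g 0 = 0)
    {k N : ℕ} (hk : 1 ≤ k) {A : Matrix (Fin N) (Fin N) ℤ} (hA : A ≠ 0) :
    0 < partialSpectralSum g k A := by
  refine sum_pos' (fun i _ => ?_) ⟨0, mem_range.2 hk, ?_⟩
  · rw [← g0]
    exact hg.monotoneOn (Set.mem_Ici.2 le_rfl) (Set.mem_Ici.2 (sigma_nonneg A i)) (sigma_nonneg A i)
  · rw [← g0]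
    exact hg (Set.mem_Ici.2 le_rfl) (Set.mem_Ici.2 (sigma_nonneg A 0)) (sigma_zero_pos hA)

open Classical in
/-- The lower bound for sums over few singular values: `α * t` is less than the probability that
a random block of positive type has norm `t`. -/
theorem space_partialSpectralSum {t : ℕ} (ht : 2 ≤ t) {α : ℝ} (hα : 0 < α)
    (hαt : α * t < (∑ v : Fin t → ℤˣ, if IsExtremal (signsOfProd 1 v) then (1 : ℝ) else 0) / 2 ^ t) :
    ∃ C : ℝ → ℝ, (∀ δ : ℝ, 0 < δ → δ < 1 / 2 → 0 < C δ) ∧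
      ∀ f : ℝ → ℝ, (StrictMonoOn f (Set.Ici 0) ∨ StrictAntiOn f (Set.Ici 0)) → f 0 = 0 →
        ∃ c₀ : ℝ, 0 < c₀ ∧ ∀ N k : ℕ, 1 ≤ k → (k : ℝ) ≤ α * (N : ℝ) →
          ∀ c δ : ℝ, 0 < c → c < c₀ → 0 < δ → δ < 1 / 2 →
            ∀ M L B : ℕ, 1 ≤ M → (t + 1) * N ≤ L → (t + 1) * N ≤ B →
              RequiresSpace (N := N) (fun A => partialSpectralSum f k A) c δ M L B
                (C δ * (N : ℝ) ^ (1 - 1 / (t : ℝ))) := by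
  set ψ : (Fin t → ℤˣ) → ℝ := fun v => if IsExtremal (signsOfProd 1 v) then (1 : ℝ) else 0 with hψ
  set p : ℝ := (∑ v, ψ v) / 2 ^ t with hp
  have ht0 : (0 : ℝ) < t := by exact_mod_cast (by omega : 0 < t)
  -- Half of the slack goes to the deviation in Chebyshev's inequality, half to the rounding of `N /
  -- t` to an even `m`.
  set ζ : ℝ := (p - α * t) / 2 with hζ
  have hζ0 : 0 < ζ := by rw [hζ]; linarith
  have hp0 : 0 < p := lt_trans (by positivity) hαt
  have hpζ : 0 < p - ζ := by
    have : 0 < α * t := by positivity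
    rw [hζ]; linarith
  choose γ hγ0 hγ using fun δ : {δ : ℝ // 0 < δ ∧ δ < 1 / 2} =>
    exists_lt_space_pow ht δ.2.1 δ.2.2
  choose m₀ hm₀ using fun δ : {δ : ℝ // 0 < δ ∧ δ < 1 / 2} =>
    exists_card_edge_deviation_le (t := t) ψ hζ0 (show 0 < (1 - 2 * δ.1) / 4 by linarith [δ.2.2])
  set β : ℝ := 1 / (2 * t) with hβ
  have hβ0 : 0 < β := by positivity
  -- The summands ensure in turn `m ≥ m₀`, `m ≥ β N` despite the rounding, and `k ≤ α N ≤ (p - ζ)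
  -- m`.
  set N₁ : {δ : ℝ // 0 < δ ∧ δ < 1 / 2} → ℕ := fun δ =>
    ⌈(2 * t) * (m₀ δ : ℝ) + 4 * t + 2 * t * p / ζ⌉₊ with hN₁
  refine ⟨fun δ => if h : 0 < δ ∧ δ < 1 / 2 then
    min ((γ ⟨δ, h⟩ * β ^ (t - 1)) ^ (1 / (t : ℝ))) (1 / (N₁ ⟨δ, h⟩ + 1)) else 1, ?_, ?_⟩
  · intro δ h1 h2
    simp only [dif_pos (And.intro h1 h2)]
    have := hγ0 ⟨δ, h1, h2⟩
    refine lt_min (by positivity) (by positivity)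
  intro f hf f0
  obtain ⟨g, hg, g0, hgf⟩ := exists_strictMonoOn_abs hf f0
  obtain ⟨ρ, hρ0, hρt, hρ⟩ := exists_bound_blockSpectrum ht
  have hgρ : 0 ≤ g ρ := by
    rw [← g0]; exact hg.monotoneOn (Set.mem_Ici.2 le_rfl) (Set.mem_Ici.2 hρ0) hρ0
  have hgt : g ρ < g t := hg (Set.mem_Ici.2 hρ0) (Set.mem_Ici.2 ht0.le) hρt
  -- For `c` below this value, (1 + c) g(ρ) < (1 - c) g(t).
  refine ⟨(g t - g ρ) / (g t + g ρ), div_pos (by linarith) (by linarith), ?_⟩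
  intro N k hk hkN c δ hc hc₀ hδ0 hδ M L B hM hL hB Ω _ P _ S alg happ
  rw [lt_div_iff₀ (by linarith)] at hc₀
  have hc1 : c < 1 := by nlinarith
  have hN : 1 ≤ N := by
    rcases Nat.eq_zero_or_pos N with rfl | h
    · have : (1 : ℝ) ≤ k := by exact_mod_cast hk
      simp at hkN; omega
    · exact h
  have hLN : N ≤ (t + 1) * N := Nat.le_mul_of_pos_left N (by omega)
  have hS : 1 ≤ S := by
    refine one_le_space happ hM (by omega) (by omega) hc1 hδ (partialSpectralSum_zero f0 k N)
      ⟨0, hN⟩ ?_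
    rw [← abs_pos, hgf]
    refine partialSpectralSum_pos hg g0 hk fun h => ?_
    have := congrFun (congrFun h ⟨0, hN⟩) ⟨0, hN⟩
    simp at this
  have hδ' : 0 < δ ∧ δ < 1 / 2 := ⟨hδ0, hδ⟩
  simp only [dif_pos hδ']
  refine mul_rpow_le_space (m := 2 * (N / (2 * t))) ht hN hS (hγ0 _) hβ0 fun hNN => ?_
  obtain ⟨hm1, hm2⟩ := evenPart_bounds (show 1 ≤ t by omega) N
  set m := 2 * (N / (2 * t)) with hm
  have hNr : (2 * t) * (m₀ ⟨δ, hδ'⟩ : ℝ) + 4 * t + 2 * t * p / ζ ≤ N :=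
    (Nat.le_ceil _).trans (Nat.cast_le.2 hNN)
  have hz : 0 ≤ 2 * t * p / ζ := by positivity
  have hm₀nn : 0 ≤ (2 * t) * (m₀ ⟨δ, hδ'⟩ : ℝ) := by positivity
  have hβm : β * N ≤ m := by
    refine le_trans ?_ hm2
    have : β * N = (N : ℝ) / t - (N : ℝ) / (2 * t) := by rw [hβ]; field_simp; ring
    rw [this]
    have : 2 ≤ (N : ℝ) / (2 * t) := by rw [le_div_iff₀ (by positivity)]; linarith
    linarith
  have hmm₀ : m₀ ⟨δ, hδ'⟩ ≤ m := by
    have : (m₀ ⟨δ, hδ'⟩ : ℝ) ≤ m := by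
      refine le_trans ?_ hβm
      rw [hβ, div_mul_eq_mul_div, one_mul, le_div_iff₀ (by positivity)]
      linarith
    exact_mod_cast this
  have hkm : α * N ≤ (p - ζ) * m := by
    have h1 : (p - ζ) * ((N : ℝ) / t - 2) ≤ (p - ζ) * m := by gcongr
    refine le_trans ?_ h1
    have h2 : 2 * t * p ≤ N * ζ := by
      rw [← div_le_iff₀ hζ0]; linarith
    have h3 : (p - ζ) * ((N : ℝ) / t - 2) - α * N = (N * ζ - 2 * t * (p - ζ)) / t := by
      have : α * t = p - 2 * ζ := by rw [hζ]; ring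
      field_simp
      linear_combination (-(N : ℝ)) * this
    have h4 : 0 ≤ (N * ζ - 2 * t * (p - ζ)) / t := by
      refine div_nonneg ?_ ht0.le
      have : 0 ≤ 2 * t * ζ := by positivity
      linarith
    linarith
  refine ⟨hβm, ?_⟩
  obtain ⟨e⟩ := exists_index_equiv hm1
  have hk0 : (0 : ℝ) < k := by exact_mod_cast hk
  refine hγ ⟨δ, hδ'⟩ (even_two_mul _) hS happ hM ((stream_length_le hm1).trans hL)
    ((stream_length_le hm1).trans hB) hc.le hc1.le e 1 (u := k * g t) (v := k * g ρ) ?_ ?_ ?_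
  · have : (1 + c) * g ρ < (1 - c) * g t := by linarith
    nlinarith
  · intro π
    refine le_trans ?_ (hm₀ ⟨δ, hδ'⟩ m hmm₀ π)
    refine Nat.cast_le.2 (card_le_card fun x hx => ?_)
    simp only [mem_filter, mem_univ, true_and] at hx ⊢
    by_contra hdev
    push Not at hdev
    rw [hgf] at hx
    refine absurd hx (not_lt.2 ?_)
    have h1 : (k : ℝ) < ∑ j, ψ (edgeSigns π x j) := by
      have := (abs_lt.1 hdev).1
      rw [← hp] at this
      linarith
    have h2 : k < ∑ j, (if IsExtremal (signsOfProd 1 (edgeSigns π x j)) then 1 else 0) := by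
      have e1 : ∑ j, ψ (edgeSigns π x j) =
          ((∑ j, (if IsExtremal (signsOfProd 1 (edgeSigns π x j)) then 1 else 0) : ℕ) : ℝ) := by
        push_cast; rfl
      rw [e1] at h1
      exact_mod_cast h1
    have h3 := h2.trans_le (sum_isExtremal_le_card e 1 π x)
    calc (k : ℝ) * g t = ∑ _i ∈ range k, g t := by simp
      _ ≤ _ := by
        refine sum_le_sum fun i hi => ?_
        have h4 := le_sigma_of_lt_card _ ((mem_range.1 hi).trans h3)
        exact hg.monotoneOn (Set.mem_Ici.2 ht0.le) (Set.mem_Ici.2 (sigma_nonneg _ _)) h4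
  · intro π
    -- For the sign -1 every singular value is at most `ρ`, so there are no exceptional inputs.
    have : (univ.filter fun x => (k : ℝ) * g ρ < |partialSpectralSum f k (hardInput e (-1) π x)|) =
        ∅ := by
      rw [filter_eq_empty_iff]
      intro x _
      rw [hgf, not_lt]
      calc _ ≤ ∑ _i ∈ range k, g ρ := by
            refine sum_le_sum fun i _ => ?_
            refine hg.monotoneOn (Set.mem_Ici.2 (sigma_nonneg _ _)) (Set.mem_Ici.2 hρ0) ?_
            exact sigma_hardInput_le e (-1) π x hρ0
              (fun v a ha => hρ _ (prod_signsOfProd (by omega) _ v) a ha) i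
        _ = k * g ρ := by simp
    rw [this]
    have : 0 ≤ (1 - 2 * δ) / 4 * 2 ^ (t * m) := mul_nonneg (by linarith) (by positivity)
    simpa using this

/-- The lower bound for Ky-Fan norms over at least a constant fraction of the singular values. -/
theorem space_kyFanNorm {t : ℕ} (ht : 2 ≤ t) {β : ℝ} (hβ0 : 0 < β) :
    ∃ (C : ℝ → ℝ) (c₀ : ℝ), (∀ δ : ℝ, 0 < δ → δ < 1 / 2 → 0 < C δ) ∧ 0 < c₀ ∧
      ∀ N k : ℕ, 1 ≤ k → k ≤ N → β * N ≤ k →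
        ∀ c δ : ℝ, 0 < c → c < c₀ → 0 < δ → δ < 1 / 2 →
          ∀ M L B : ℕ, 1 ≤ M → (t + 1) * N ≤ L → (t + 1) * N ≤ B →
            RequiresSpace (N := N) (fun A => kyFanNorm k A) c δ M L B
              (C δ * (N : ℝ) ^ (1 - 1 / (t : ℝ))) := by
  have ht0 : (0 : ℝ) < t := by exact_mod_cast (by omega : 0 < t)
  set μ : ℤˣ → ℝ := fun b => (∑ v : Fin t → ℤˣ, blockNuclear (signsOfProd b v)) / 2 ^ t with hμ
  have hμ0 : ∀ b, 0 ≤ μ b := fun b =>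
    div_nonneg (sum_nonneg fun v _ => blockNuclear_nonneg _) (by positivity)
  -- Only the inequality of the two means is known; which sign has the larger one is immaterial.
  obtain ⟨b, hb⟩ : ∃ b, μ (-b) < μ b := by
    have h : μ 1 ≠ μ (-1) := by
      simp only [hμ]
      intro h
      exact sum_blockNuclear_ne ht ((div_left_inj' (by positivity)).1 h)
    rcases lt_or_gt_of_ne h with h | h
    · exact ⟨-1, by rwa [neg_neg]⟩
    · exact ⟨1, h⟩
  -- Deviations by a quarter of the gap on both sides leave half of it, which is what `c₀` below
  -- requires.
  set ζ : ℝ := (μ b - μ (-b)) / 4 with hζ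
  have hζ0 : 0 < ζ := by rw [hζ]; linarith
  have hb0 := hμ0 (-b)
  choose γ hγ0 hγ using fun δ : {δ : ℝ // 0 < δ ∧ δ < 1 / 2} =>
    exists_lt_space_pow ht δ.2.1 δ.2.2
  choose m₀ hm₀ using fun (δ : {δ : ℝ // 0 < δ ∧ δ < 1 / 2}) (b : ℤˣ) =>
    exists_card_edge_deviation_le (t := t) (fun v => blockNuclear (signsOfProd b v)) hζ0
      (show 0 < (1 - 2 * δ.1) / 4 by linarith [δ.2.2])
  set β' : ℝ := β / (2 * t) with hβ'
  have hβ'0 : 0 < β' := by positivity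
  -- Beyond this threshold k/(2t) exceeds both concentration thresholds, and the summand 2
  -- compensates the rounding in `evenPart_bounds`.
  set N₁ : {δ : ℝ // 0 < δ ∧ δ < 1 / 2} → ℕ := fun δ =>
    ⌈(2 * t) * ((m₀ δ b : ℝ) + m₀ δ (-b) + 2) / β⌉₊ with hN₁
  refine ⟨fun δ => if h : 0 < δ ∧ δ < 1 / 2 then
    min ((γ ⟨δ, h⟩ * β' ^ (t - 1)) ^ (1 / (t : ℝ))) (1 / (N₁ ⟨δ, h⟩ + 1)) else 1,
    (μ b - μ (-b)) / (2 * (μ b + μ (-b))), ?_, div_pos (by linarith) (by linarith), ?_⟩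
  · intro δ h1 h2
    simp only [dif_pos (And.intro h1 h2)]
    have := hγ0 ⟨δ, h1, h2⟩
    refine lt_min (by positivity) (by positivity)
  intro N k hk hkN hβk c δ hc hc₀ hδ0 hδ M L B hM hL hB Ω _ P _ S alg happ
  rw [lt_div_iff₀ (by linarith)] at hc₀
  have hc1 : c < 1 := by nlinarith
  have hN : 1 ≤ N := hk.trans hkN
  have hLN : N ≤ (t + 1) * N := Nat.le_mul_of_pos_left N (by omega)
  have hid : StrictMonoOn (fun x : ℝ => x) (Set.Ici 0) := strictMono_id.strictMonoOn _
  have hS : 1 ≤ S := by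
    refine one_le_space happ hM (by omega) (by omega) hc1 hδ
      (partialSpectralSum_zero (g := fun x => x) rfl k N) ⟨0, hN⟩ ?_
    refine (partialSpectralSum_pos hid rfl hk fun h => ?_).ne'
    have := congrFun (congrFun h ⟨0, hN⟩) ⟨0, hN⟩
    simp at this
  have hδ' : 0 < δ ∧ δ < 1 / 2 := ⟨hδ0, hδ⟩
  simp only [dif_pos hδ']
  refine mul_rpow_le_space (m := 2 * (k / (2 * t))) ht hN hS (hγ0 _) hβ'0 fun hNN => ?_
  obtain ⟨hm1, hm2⟩ := evenPart_bounds (show 1 ≤ t by omega) k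
  set m := 2 * (k / (2 * t)) with hm
  have hNr : (2 * t) * ((m₀ ⟨δ, hδ'⟩ b : ℝ) + m₀ ⟨δ, hδ'⟩ (-b) + 2) / β ≤ N :=
    (Nat.le_ceil _).trans (Nat.cast_le.2 hNN)
  rw [div_le_iff₀ hβ0, mul_comm (N : ℝ)] at hNr
  have hk2 : (m₀ ⟨δ, hδ'⟩ b : ℝ) + m₀ ⟨δ, hδ'⟩ (-b) + 2 ≤ (k : ℝ) / (2 * t) := by
    rw [le_div_iff₀ (by positivity)]; linarith
  have hm3 : (k : ℝ) / (2 * t) ≤ m := by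
    refine le_trans ?_ hm2
    have e1 : (k : ℝ) / t = k / (2 * t) + k / (2 * t) := by field_simp; ring
    rw [e1]
    have h1 : (0 : ℝ) ≤ m₀ ⟨δ, hδ'⟩ b := by positivity
    have h2 : (0 : ℝ) ≤ m₀ ⟨δ, hδ'⟩ (-b) := by positivity
    linarith
  have hβm : β' * N ≤ m := by
    refine le_trans ?_ hm3
    rw [hβ', div_mul_eq_mul_div]
    gcongr
  have hmm : m₀ ⟨δ, hδ'⟩ b + m₀ ⟨δ, hδ'⟩ (-b) + 2 ≤ m := by
    exact_mod_cast hk2.trans hm3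
  refine ⟨hβm, ?_⟩
  obtain ⟨e⟩ := exists_index_equiv (hm1.trans hkN)
  have hm0 : (0 : ℝ) < m := by exact_mod_cast (by omega : 0 < m)
  have hF : ∀ b' π x, |kyFanNorm k (hardInput e b' π x)| =
      ∑ j, blockNuclear (signsOfProd b' (edgeSigns π x j)) := by
    intro b' π x
    rw [kyFanNorm_hardInput e b' π x hm1 hkN]
    exact abs_of_nonneg (sum_nonneg fun j _ => blockNuclear_nonneg _)
  refine hγ ⟨δ, hδ'⟩ (even_two_mul _) hS happ hM
    ((stream_length_le (hm1.trans hkN)).trans hL)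
    ((stream_length_le (hm1.trans hkN)).trans hB) hc.le hc1.le e b
    (u := (μ b - ζ) * m) (v := (μ (-b) + ζ) * m) ?_ ?_ ?_
  · have : (1 + c) * (μ (-b) + ζ) < (1 - c) * (μ b - ζ) := by
      rw [hζ]; linarith
    nlinarith
  · intro π
    refine le_trans ?_ (hm₀ ⟨δ, hδ'⟩ b m (by omega) π)
    refine Nat.cast_le.2 (card_le_card fun x hx => ?_)
    simp only [mem_filter, mem_univ, true_and] at hx ⊢
    rw [hF] at hx
    have h1 : (μ b - ζ) * m =
        m * ((∑ v : Fin t → ℤˣ, blockNuclear (signsOfProd b v)) / 2 ^ t) - ζ * m := by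
      simp only [hμ]; ring
    rw [h1] at hx
    refine le_trans ?_ (neg_le_abs _)
    linarith
  · intro π
    refine le_trans ?_ (hm₀ ⟨δ, hδ'⟩ (-b) m (by omega) π)
    refine Nat.cast_le.2 (card_le_card fun x hx => ?_)
    simp only [mem_filter, mem_univ, true_and] at hx ⊢
    rw [hF] at hx
    have h1 : (μ (-b) + ζ) * m =
        m * ((∑ v : Fin t → ℤˣ, blockNuclear (signsOfProd (-b) v)) / 2 ^ t) + ζ * m := by
      simp only [hμ]; ring
    rw [h1] at hx
    refine le_trans ?_ (le_abs_self _)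
    linarith

end LowerBounds

end

/-! ### Choice of the order `t` -/

section

open Finset

section Main

theorem isExtremal_one {t : ℕ} (ht : 2 ≤ t) : IsExtremal (1 : Fin t → ℤˣ) :=
  natCast_mem_blockSpectrum_one ht

-- The all-ones vector and its flip in the first sign are both sent to the all-ones block.
open Classical in
theorem two_le_sum_isExtremal {t : ℕ} (ht : 2 ≤ t) :
    2 ≤ ∑ v : Fin t → ℤˣ, if IsExtremal (signsOfProd 1 v) then (1 : ℝ) else 0 := by
  have h1 : signsOfProd 1 (1 : Fin t → ℤˣ) = 1 := by
    simp [signsOfProd, blockSigns_one]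
  have h2 : signsOfProd 1 (blockSigns (-1) (1 : Fin t → ℤˣ)) = 1 := by
    rw [signsOfProd, prod_blockSigns (by omega)]
    simp [blockSigns_blockSigns]
  have hne : (1 : Fin t → ℤˣ) ≠ blockSigns (-1) 1 := by
    intro h
    have h3 := congrArg (fun v => ∏ p, v p) h
    simp only [prod_blockSigns (show 1 ≤ t by omega)] at h3
    simp at h3
  calc (2 : ℝ) = ∑ v ∈ {(1 : Fin t → ℤˣ), blockSigns (-1) 1},
        if IsExtremal (signsOfProd 1 v) then (1 : ℝ) else 0 := by
        rw [sum_pair hne, h1, h2, if_pos (isExtremal_one ht)]; norm_num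
    _ ≤ _ := sum_le_sum_of_subset_of_nonneg (subset_univ _) fun v _ _ => by split_ifs <;> norm_num

open Classical in
theorem sum_isExtremal_two :
    ∑ v : Fin 2 → ℤˣ, (if IsExtremal (signsOfProd 1 v) then (1 : ℝ) else 0) = 4 := by
  have h : ∀ v : Fin 2 → ℤˣ, IsExtremal (signsOfProd 1 v) := fun v =>
    two_mem_blockSpectrum _ (prod_signsOfProd (by omega) _ v)
  simp [h]

/-- The order of the hypermatching for sums over at most `α * N` singular values. -/
noncomputable def matchingOrder (α : ℝ) : ℕ := max 2 ⌊Real.log (1 / α) / Real.log 4⌋₊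

theorem two_le_matchingOrder (α : ℝ) : 2 ≤ matchingOrder α := le_max_left _ _

/-- Rounding down costs at most a factor 2 since `t ≥ 1`. When the maximum is 2, the lower bound
follows from log(1/α) > log 2. -/
theorem one_div_matchingOrder_bounds {α : ℝ} (hα : 0 < α) (hα2 : α < 1 / 2) :
    (Real.log 2 / 2) / Real.log (1 / α) ≤ 1 / (matchingOrder α : ℝ) ∧
      1 / (matchingOrder α : ℝ) ≤ (2 * Real.log 4) / Real.log (1 / α) := by
  have hx : Real.log 2 < Real.log (1 / α) := by
    refine Real.log_lt_log (by norm_num) ?_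
    rw [lt_div_iff₀ hα]; linarith
  have h2 : 0 < Real.log 2 := Real.log_pos (by norm_num)
  have h4 : Real.log 4 = 2 * Real.log 2 := by
    rw [show (4 : ℝ) = 2 ^ 2 by norm_num, Real.log_pow]; norm_num
  set x := Real.log (1 / α) with hxdef
  have ht : (2 : ℝ) ≤ matchingOrder α := by exact_mod_cast two_le_matchingOrder α
  constructor
  · rw [div_le_div_iff₀ (by linarith) (by linarith), one_mul]
    rcases le_total ⌊x / Real.log 4⌋₊ 2 with h | h
    · have : matchingOrder α = 2 := max_eq_left h
      rw [this]; push_cast; linarith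
    · have e : matchingOrder α = ⌊x / Real.log 4⌋₊ := max_eq_right h
      have h5 : (matchingOrder α : ℝ) ≤ x / Real.log 4 := by
        rw [e]; exact Nat.floor_le (div_nonneg (by linarith) (by linarith))
      rw [le_div_iff₀ (by linarith), h4] at h5
      nlinarith
  · rw [div_le_div_iff₀ (by linarith) (by linarith), one_mul]
    have h5 : x / Real.log 4 < ⌊x / Real.log 4⌋₊ + 1 := Nat.lt_floor_add_one _
    have h6 : (⌊x / Real.log 4⌋₊ : ℝ) ≤ matchingOrder α := by exact_mod_cast le_max_right _ _
    rw [div_lt_iff₀ (by linarith)] at h5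
    have h7 : ((⌊x / Real.log 4⌋₊ : ℝ) + 1) * Real.log 4 ≤ (2 * matchingOrder α) * Real.log 4 := by
      refine mul_le_mul_of_nonneg_right (by linarith) (by linarith)
    linarith

theorem mul_inv_pow_lt {t : ℕ} {α : ℝ} (h : α * 4 ^ t ≤ 1) : α * t < 2 / 2 ^ t := by
  have h2 : (t : ℝ) < 2 ^ t := by exact_mod_cast Nat.lt_two_pow_self
  rw [lt_div_iff₀ (by positivity)]
  rcases le_or_gt α 0 with hα | hα
  · have : α * t * 2 ^ t ≤ 0 := by
      rw [mul_assoc]; exact mul_nonpos_of_nonpos_of_nonneg hα (by positivity)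
    linarith
  · have e : (4 : ℝ) ^ t = 2 ^ t * 2 ^ t := by rw [← mul_pow]; norm_num
    rw [e, ← mul_assoc] at h
    have : α * t * 2 ^ t ≤ α * 2 ^ t * 2 ^ t := by gcongr
    linarith

-- For `t = 2` every block of product 1 is extremal, so the condition is 2α < 1, the full range of
-- α. Otherwise α 4^t ≤ 1, and the probability 2/2^t of the two evident vectors suffices.
open Classical in
theorem mul_matchingOrder_lt {α : ℝ} (hα : 0 < α) (hα2 : α < 1 / 2) :
    α * matchingOrder α < (∑ v : Fin (matchingOrder α) → ℤˣ,
      if IsExtremal (signsOfProd 1 v) then (1 : ℝ) else 0) / 2 ^ matchingOrder α := by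
  rcases le_total ⌊Real.log (1 / α) / Real.log 4⌋₊ 2 with h | h
  · have e : matchingOrder α = 2 := max_eq_left h
    rw [e, sum_isExtremal_two]
    push_cast
    linarith
  · have e : matchingOrder α = ⌊Real.log (1 / α) / Real.log 4⌋₊ := max_eq_right h
    have h4 : 0 < Real.log 4 := Real.log_pos (by norm_num)
    have h0 : 0 ≤ Real.log (1 / α) := Real.log_nonneg (by rw [le_div_iff₀ hα]; linarith)
    have h5 : (matchingOrder α : ℝ) ≤ Real.log (1 / α) / Real.log 4 := by
      rw [e]; exact Nat.floor_le (div_nonneg h0 h4.le)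
    rw [le_div_iff₀ h4, ← Real.log_pow, Real.log_le_log_iff (by positivity) (by positivity),
      le_div_iff₀ hα, mul_comm] at h5
    refine (mul_inv_pow_lt h5).trans_le ?_
    have := two_le_sum_isExtremal (two_le_matchingOrder α)
    gcongr

theorem RequiresSpace.mono {N : ℕ} {F : Matrix (Fin N) (Fin N) ℤ → ℝ} {c δ : ℝ} {M L B : ℕ}
    {b b' : ℝ} (h : RequiresSpace F c δ M L B b) (hb : b' ≤ b) : RequiresSpace F c δ M L B b' :=
  fun Ω _ P _ S alg ha => hb.trans (h Ω P S alg ha)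

end Main

end

theorem theorem3 :
    -- sums of a strictly monotone function over the `k ≤ α N` largest singular values
    (∃ (θ : ℝ → ℝ) (a₁ a₂ : ℝ), 0 < a₁ ∧ 0 < a₂ ∧
      ∀ α : ℝ, 0 < α → α < 1 / 2 →
        (a₁ / Real.log (1 / α) ≤ θ α ∧ θ α ≤ a₂ / Real.log (1 / α) ∧ θ α < 1) ∧
        ∃ (K : ℕ) (C : ℝ → ℝ), (∀ δ : ℝ, 0 < δ → δ < 1 / 2 → 0 < C δ) ∧
          ∀ f : ℝ → ℝ, (StrictMonoOn f (Set.Ici 0) ∨ StrictAntiOn f (Set.Ici 0)) → f 0 = 0 →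
            ∃ (c₀ : ℝ) (N₀ : ℕ), 0 < c₀ ∧
              ∀ N k : ℕ, N₀ ≤ N → 1 ≤ k → (k : ℝ) ≤ α * (N : ℝ) →
                ∀ c δ : ℝ, 0 < c → c < c₀ → 0 < δ → δ < 1 / 2 →
                  ∀ M L : ℕ, 1 ≤ M → K * N ≤ L →
                    RequiresSpace (N := N) (fun A => partialSpectralSum f k A) c δ M L (K * N)
                      (C δ * (N : ℝ) ^ (1 - θ α))) ∧
    -- Ky-Fan `k`-norms, for every `k`
    (∀ η : ℝ, 0 < η → η < 1 →
      ∃ (K : ℕ) (C : ℝ → ℝ) (c₀ : ℝ) (N₀ : ℕ),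
        (∀ δ : ℝ, 0 < δ → δ < 1 / 2 → 0 < C δ) ∧ 0 < c₀ ∧
          ∀ N k : ℕ, N₀ ≤ N → 1 ≤ k → k ≤ N →
            ∀ c δ : ℝ, 0 < c → c < c₀ → 0 < δ → δ < 1 / 2 →
              ∀ M L : ℕ, 1 ≤ M → K * N ≤ L →
                RequiresSpace (N := N) (fun A => kyFanNorm k A) c δ M L (K * N)
                  (C δ * (N : ℝ) ^ (1 - η))) := by
  constructor
  · refine ⟨fun α => 1 / (matchingOrder α : ℝ), Real.log 2 / 2, 2 * Real.log 4,
      half_pos (Real.log_pos (by norm_num)), mul_pos two_pos (Real.log_pos (by norm_num)), ?_⟩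
    intro α hα hα2
    have ht := two_le_matchingOrder α
    have ht' : (2 : ℝ) ≤ matchingOrder α := by exact_mod_cast ht
    obtain ⟨h1, h2⟩ := one_div_matchingOrder_bounds hα hα2
    refine ⟨⟨h1, h2, (div_lt_one (by linarith)).2 (by linarith)⟩, ?_⟩
    obtain ⟨C, hC, h⟩ := space_partialSpectralSum ht hα (mul_matchingOrder_lt hα hα2)
    refine ⟨matchingOrder α + 1, C, hC, fun f hf f0 => ?_⟩
    obtain ⟨c₀, hc₀, h⟩ := h f hf f0
    refine ⟨c₀, 0, hc₀, fun N k _ hk hkN c δ hc hcc hδ hδ' M L hM hL => ?_⟩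
    exact h N k hk hkN c δ hc hcc hδ hδ' M L _ hM hL le_rfl
  · intro η hη _
    obtain ⟨n, hn⟩ := exists_nat_one_div_lt hη
    obtain ⟨t, ht, htη⟩ : ∃ t : ℕ, 2 ≤ t ∧ 1 / (t : ℝ) ≤ η := by
      refine ⟨n + 2, by omega, le_trans ?_ hn.le⟩
      push_cast
      exact one_div_le_one_div_of_le (by positivity) (by linarith)
    have ht0 : (0 : ℝ) < t := by exact_mod_cast (by omega : 0 < t)
    -- At k = N/4^t the argument changes: the operator norm of the blocks serves smaller `k`, their
    -- nuclear norm larger `k`, both with the same order `t`.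
    have hα : (0 : ℝ) < 1 / 4 ^ t := by positivity
    have hαt : (1 : ℝ) / 4 ^ t * t < _ :=
      (mul_inv_pow_lt (by rw [one_div_mul_cancel (by positivity)])).trans_le
        (div_le_div_of_nonneg_right (two_le_sum_isExtremal ht) (by positivity))
    obtain ⟨C, hC, h⟩ := space_partialSpectralSum ht hα hαt
    obtain ⟨c₀, hc₀, h⟩ := h (fun x => x) (Or.inl (strictMono_id.strictMonoOn _)) rfl
    obtain ⟨C', c₀', hC', hc₀', h'⟩ := space_kyFanNorm ht hα
    refine ⟨t + 1, fun δ => min (C δ) (C' δ), min c₀ c₀', 0,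
      fun δ hδ hδ' => lt_min (hC δ hδ hδ') (hC' δ hδ hδ'), lt_min hc₀ hc₀', ?_⟩
    intro N k _ hk hkN c δ hc hcc hδ hδ' M L hM hL
    have hN : (1 : ℝ) ≤ N := by exact_mod_cast hk.trans hkN
    have hpow : (N : ℝ) ^ (1 - η) ≤ (N : ℝ) ^ (1 - 1 / (t : ℝ)) :=
      Real.rpow_le_rpow_of_exponent_le hN (by linarith)
    have hp : 0 ≤ (N : ℝ) ^ (1 - η) := by positivity
    rcases le_total (k : ℝ) (1 / 4 ^ t * N) with hkα | hkα
    · exact (h N k hk hkα c δ hc (hcc.trans_le (min_le_left _ _)) hδ hδ' M L _ hM hL le_rfl).mono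
        (mul_le_mul (min_le_left _ _) hpow hp (hC δ hδ hδ').le)
    · exact (h' N k hk hkN hkα c δ hc (hcc.trans_le (min_le_right _ _)) hδ hδ' M L _ hM hL
        le_rfl).mono (mul_le_mul (min_le_right _ _) hpow hp (hC' δ hδ hδ').le)
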